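/- Let $V$ be a one-dimensional complex vector space, let $s\in\mathrm{GL}(V)$ be an element of finite order $d>2$, and let $W=\langle s\rangle$. Let $R=\mathcal{O}(V)$ be the algebra of polynomial functions on $V$, graded so that $V^*$ has degree $2$. For $A\subseteq W$ let $\mathcal{O}(A)$ be the ring of regular functions on $\bigcup_{x\in A}\{(xv,v)\mid v\in V\}\subseteq V\times V$ (restrictions of polynomial functions on $V\times V$, linear forms having degree $2$), viewed as a graded $R$-bimodule through the two projections: $(f\cdot a\cdot g)(u,w)=f(u)\,a(u,w)\,g(w)$. Write $M[k]$ for the shifted bimodule with $M[k]_i=M_{i+k}$. Let $\mathcal{B}_W$ be the full subcategory of the category of graded $R$-bimodules (with degree-preserving morphisms) generated by $\mathcal{O}(\{e,s\})$, that is, the smallest one containing $\mathcal{O}(\{e,s\})$ and $R$ and closed under isomorphisms, grading shifts, finite direct sums, tensor products over $R$ and direct summands. Let $A_W$ be its split Grothendieck ring: the free abelian group on the isomorphism classes $\langle M\rangle$ of objects $M$ of $\mathcal{B}_W$ modulo $\langle M\oplus N\rangle=\langle M\rangle+\langle N\rangle$, with product $\langle M\rangle\langle N\rangle=\langle M\otimes_R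 N\rangle$; it is a $\mathbb{Z}[v,v^{-1}]$-algebra with $v\langle M\rangle=\langle M[1]\rangle$. **Proposition (Second presentation of the Grothendieck ring).** The bimodules $\mathcal{O}(\{s\})$ and $\mathcal{O}(W)$ belong to $\mathcal{B}_W$, and, with $s:=\langle\mathcal{O}(\{s\})\rangle$ and $C:=\langle\mathcal{O}(\{e,s\})[1]\rangle$, the $\mathbb{Z}[v,v^{-1}]$-algebra $A_W$ is presented by the generators $s$ and $C$ and the relations - $s^d=1$; - $sC=Cs$; - $sC_{d-1}=C_{d-1}$; - $CC_{d-1}=(v+v^{-1})C_{d-1}$, where $C_{d-1}:=\sum_{i=0}^{\lfloor (d-1)/2\rfloor}\binom{d-1-i}{i}(-s)^iC^{d-1-2i}$. That is, the morphism from the associative unital $\mathbb{Z}[v,v^{-1}]$-algebra with these generators and relations to $A_W$ given by these two classes is an isomorphism. Moreover, it sends $C_{d-1}$ to $\langle\mathcal{O}(W)[d-1]\rangle$. -/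

import Mathlib

open scoped TensorProduct LaurentPolynomial

universe u

/-! ## Graded bimodules over a commutative graded `ℂ`-algebra -/

/-- A `ℤ`-graded bimodule over the commutative `ℤ`-graded `ℂ`-algebra `R` (graded by `𝓡`), with the
same operation of `ℂ` on both sides.  The left and the right action are commuting algebra morphisms
`R → End_ℂ(M)` (`R` is commutative, so right actions are also given by algebra morphisms). -/
structure GrBimod {R : Type u} [CommRing R] [Algebra ℂ R] (𝓡 : ℤ → Submodule ℂ R) where
  carrier : Type u
  [grp : AddCommGroup carrier]
  [mod : Module ℂ carrier]
  /-- left action `m ↦ r · m` -/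
  lact : R →ₐ[ℂ] Module.End ℂ carrier
  /-- right action `m ↦ m · r` -/
  ract : R →ₐ[ℂ] Module.End ℂ carrier
  act_comm : ∀ r t m, lact r (ract t m) = ract t (lact r m)
  /-- homogeneous components -/
  deg : ℤ → Submodule ℂ carrier
  internal : DirectSum.IsInternal deg
  lact_mem : ∀ {i j r m}, r ∈ 𝓡 i → m ∈ deg j → lact r m ∈ deg (i + j)
  ract_mem : ∀ {i j r m}, r ∈ 𝓡 i → m ∈ deg j → ract r m ∈ deg (j + i)

namespace GrBimod

section General

variable {R : Type u} [CommRing R] [Algebra ℂ R] {𝓡 : ℤ → Submodule ℂ R}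

instance : CoeSort (GrBimod 𝓡) (Type u) := ⟨carrier⟩
instance (M : GrBimod 𝓡) : AddCommGroup M := M.grp
instance (M : GrBimod 𝓡) : Module ℂ M := M.mod

theorem iSup_deg (M : GrBimod 𝓡) : ⨆ i, M.deg i = ⊤ :=
  M.internal.submodule_iSup_eq_top

/-- Two linear maps agreeing on homogeneous elements are equal. -/
theorem hom_ext {ι : Type*} {M P : Type*} [AddCommGroup M] [Module ℂ M] [AddCommGroup P]
    [Module ℂ P] {A : ι → Submodule ℂ M} (hA : ⨆ i, A i = ⊤) {f g : M →ₗ[ℂ] P}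
    (h : ∀ i, ∀ m ∈ A i, f m = g m) : f = g := by
  have : (⊤ : Submodule ℂ M) ≤ LinearMap.eqLocus f g := by
    rw [← hA]
    exact iSup_le fun i m hm => h i m hm
  ext m
  exact this trivial

/-- A family of submodules with "projection maps" is an internal grading. -/
theorem isInternal_of_coact {T : Type*} [AddCommGroup T] [Module ℂ T] {A : ℤ → Submodule ℂ T}
    (hA : ⨆ i, A i = ⊤) (D : T →ₗ[ℂ] (ℤ →₀ T))
    (hD : ∀ i, ∀ t ∈ A i, D t = Finsupp.single i t) : DirectSum.IsInternal A := by
  refine DirectSum.isInternal_submodule_of_iSupIndep_of_iSup_eq_top ?_ hA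
  rw [iSupIndep_def]
  intro i
  rw [Submodule.disjoint_def]
  intro x hx hx'
  have : (⨆ (j) (_ : j ≠ i), A j) ≤ LinearMap.ker ((Finsupp.lapply i).comp D) := by
    refine iSup₂_le fun j hj t ht => ?_
    simp [hD j t ht, hj.symm]
  have h2 := this hx'
  rw [LinearMap.mem_ker, LinearMap.comp_apply, hD i x hx] at h2
  simpa using h2

theorem exists_coact (M : GrBimod 𝓡) :
    ∃ D : M →ₗ[ℂ] (ℤ →₀ M), ∀ i, ∀ m ∈ M.deg i, D m = Finsupp.single i m := by
  let E := LinearEquiv.ofBijective (DirectSum.coeLinearMap M.deg) M.internal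
  let F : (DirectSum ℤ fun i => M.deg i) →ₗ[ℂ] (ℤ →₀ M) :=
    DirectSum.toModule ℂ ℤ (ℤ →₀ M) fun i => (Finsupp.lsingle i).comp (M.deg i).subtype
  refine ⟨F.comp E.symm.toLinearMap, fun i m hm => ?_⟩
  have : E.symm m = DirectSum.lof ℂ ℤ (fun i => M.deg i) i ⟨m, hm⟩ := by
    rw [LinearEquiv.symm_apply_eq]
    exact (DirectSum.coeLinearMap_lof M.deg i ⟨m, hm⟩).symm
  simp [this, F]

/-- Isomorphisms of graded bimodules: bijective bimodule maps that preserve degrees. -/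
structure Iso (M N : GrBimod 𝓡) where
  e : M ≃ₗ[ℂ] N
  map_lact : ∀ r m, e (M.lact r m) = N.lact r (e m)
  map_ract : ∀ r m, e (M.ract r m) = N.ract r (e m)
  map_deg : ∀ i m, m ∈ M.deg i ↔ e m ∈ N.deg i

namespace Iso

def refl (M : GrBimod 𝓡) : Iso M M where
  e := LinearEquiv.refl ℂ M
  map_lact _ _ := rfl
  map_ract _ _ := rfl
  map_deg _ _ := Iff.rfl

def symm {M N : GrBimod 𝓡} (f : Iso M N) : Iso N M where
  e := f.e.symm
  map_lact r m := by rw [LinearEquiv.symm_apply_eq, f.map_lact, LinearEquiv.apply_symm_apply]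
  map_ract r m := by rw [LinearEquiv.symm_apply_eq, f.map_ract, LinearEquiv.apply_symm_apply]
  map_deg i m := by rw [f.map_deg, LinearEquiv.apply_symm_apply]

def trans {M N P : GrBimod 𝓡} (f : Iso M N) (g : Iso N P) : Iso M P where
  e := f.e.trans g.e
  map_lact r m := by simp [f.map_lact, g.map_lact]
  map_ract r m := by simp [f.map_ract, g.map_ract]
  map_deg i m := by rw [f.map_deg, g.map_deg]; rfl

/-- An isomorphism from a pair of mutually inverse degree-preserving maps, one of which is a
bimodule map. -/
def mk' {M N : GrBimod 𝓡} (f : M →ₗ[ℂ] N) (g : N →ₗ[ℂ] M)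
    (h1 : f ∘ₗ g = LinearMap.id) (h2 : g ∘ₗ f = LinearMap.id)
    (hl : ∀ r m, f (M.lact r m) = N.lact r (f m)) (hr : ∀ r m, f (M.ract r m) = N.ract r (f m))
    (hf : ∀ i, ∀ m ∈ M.deg i, f m ∈ N.deg i) (hg : ∀ i, ∀ n ∈ N.deg i, g n ∈ M.deg i) :
    Iso M N where
  e := LinearEquiv.ofLinearMap f g h1 h2
  map_lact := hl
  map_ract := hr
  map_deg i m := ⟨hf i m, fun h => by
    have := hg i _ h
    rwa [LinearEquiv.coe_ofLinearMap, ← LinearMap.comp_apply, h2] at this⟩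

end Iso

instance isoSetoid : Setoid (GrBimod 𝓡) where
  r M N := Nonempty (Iso M N)
  iseqv := ⟨fun M => ⟨Iso.refl M⟩, fun ⟨f⟩ => ⟨f.symm⟩, fun ⟨f⟩ ⟨g⟩ => ⟨f.trans g⟩⟩

/-- The grading shift `M[k]`, with `M[k]_i = M_{i+k}`. -/
def shift (M : GrBimod 𝓡) (k : ℤ) : GrBimod 𝓡 where
  carrier := M
  lact := M.lact
  ract := M.ract
  act_comm := M.act_comm
  deg i := M.deg (i + k)
  internal := by
    refine DirectSum.isInternal_submodule_of_iSupIndep_of_iSup_eq_top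
      (M.internal.submodule_iSupIndep.comp (add_left_injective k)) ?_
    rw [← M.iSup_deg]
    exact (Equiv.addRight k).iSup_comp (g := M.deg)
  lact_mem hr hm := by rw [add_assoc]; exact M.lact_mem hr hm
  ract_mem {i j r m} hr hm := by
    rw [show j + i + k = (j + k) + i by ring]; exact M.ract_mem hr hm

/-- The direct sum `M ⊕ N`. -/
def sum (M N : GrBimod 𝓡) : GrBimod 𝓡 where
  carrier := M × N
  lact := AlgHom.ofLinearMap
    (LinearMap.mk (AddHom.mk (fun r => (M.lact r).prodMap (N.lact r))
      (fun r t => by ext <;> simp)) (fun c r => by ext <;> simp))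
    (by ext <;> simp) (fun r t => by ext <;> simp)
  ract := AlgHom.ofLinearMap
    (LinearMap.mk (AddHom.mk (fun r => (M.ract r).prodMap (N.ract r))
      (fun r t => by ext <;> simp)) (fun c r => by ext <;> simp))
    (by ext <;> simp) (fun r t => by ext <;> simp)
  act_comm r t m := Prod.ext (M.act_comm r t m.1) (N.act_comm r t m.2)
  deg i := (M.deg i).prod (N.deg i)
  internal := by
    obtain ⟨D, hD⟩ := M.exists_coact
    obtain ⟨D', hD'⟩ := N.exists_coact
    refine isInternal_of_coact ?_
      (LinearMap.coprod (Finsupp.mapRange.linearMap (LinearMap.inl ℂ M N) ∘ₗ D)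
        (Finsupp.mapRange.linearMap (LinearMap.inr ℂ M N) ∘ₗ D')) ?_
    · rw [eq_top_iff]
      have h1 : (⨆ i, M.deg i) ≤ (⨆ i, (M.deg i).prod (N.deg i)).comap (LinearMap.inl ℂ M N) :=
        iSup_le fun i m hm => Submodule.mem_iSup_of_mem i ⟨hm, (N.deg i).zero_mem⟩
      have h2 : (⨆ i, N.deg i) ≤ (⨆ i, (M.deg i).prod (N.deg i)).comap (LinearMap.inr ℂ M N) :=
        iSup_le fun i m hm => Submodule.mem_iSup_of_mem i ⟨(M.deg i).zero_mem, hm⟩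
      rw [M.iSup_deg] at h1
      rw [N.iSup_deg] at h2
      rintro ⟨m, n⟩ -
      have h3 : (m, (0 : N)) ∈ ⨆ i, (M.deg i).prod (N.deg i) := h1 (x := m) trivial
      have h4 : ((0 : M), n) ∈ ⨆ i, (M.deg i).prod (N.deg i) := h2 (x := n) trivial
      simpa using Submodule.add_mem _ h3 h4
    · rintro i ⟨m, n⟩ ⟨hm, hn⟩
      simp [hD i m hm, hD' i n hn, ← Finsupp.single_add]
  lact_mem hr hm := ⟨M.lact_mem hr hm.1, N.lact_mem hr hm.2⟩
  ract_mem hr hm := ⟨M.ract_mem hr hm.1, N.ract_mem hr hm.2⟩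

/-- The regular bimodule `R`. -/
def regular (𝓡 : ℤ → Submodule ℂ R) [GradedAlgebra 𝓡] : GrBimod 𝓡 where
  carrier := R
  lact := Algebra.lmul ℂ R
  ract := Algebra.lmul ℂ R
  act_comm r t m := by simp [mul_left_comm]
  deg := 𝓡
  internal := DirectSum.Decomposition.isInternal 𝓡
  lact_mem hr hm := SetLike.mul_mem_graded hr hm
  ract_mem {i j r m} hr hm := by
    rw [add_comm]; exact SetLike.mul_mem_graded hr hm

/-! ### Tensor product over `R` -/

/-- The subspace of `M ⊗_ℂ N` spanned by the elements `m·r ⊗ n - m ⊗ r·n`. -/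
def balanced (M N : GrBimod 𝓡) : Submodule ℂ (M ⊗[ℂ] N) :=
  Submodule.span ℂ {x | ∃ (m : M) (r : R) (n : N), x = M.ract r m ⊗ₜ n - m ⊗ₜ N.lact r n}

/-- The vector space underlying `M ⊗_R N`. -/
abbrev Tens (M N : GrBimod 𝓡) : Type u := (M ⊗[ℂ] N) ⧸ balanced M N

/-- The class of `m ⊗ n` in `M ⊗_R N`, as a bilinear map. -/
def tmul (M N : GrBimod 𝓡) : M →ₗ[ℂ] N →ₗ[ℂ] Tens M N :=
  (TensorProduct.mk ℂ M N).compr₂ (balanced M N).mkQ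

theorem tmul_bal {M N : GrBimod 𝓡} (m : M) (r : R) (n : N) :
    tmul M N (M.ract r m) n = tmul M N m (N.lact r n) := by
  simp only [tmul, LinearMap.compr₂_apply, TensorProduct.mk_apply]
  rw [← sub_eq_zero, ← map_sub, Submodule.mkQ_apply, Submodule.Quotient.mk_eq_zero]
  exact Submodule.subset_span ⟨m, r, n, rfl⟩

/-- `R`-balanced bilinear maps factor through `M ⊗_R N`. -/
def tlift {M N : GrBimod 𝓡} {P : Type*} [AddCommGroup P] [Module ℂ P] (f : M →ₗ[ℂ] N →ₗ[ℂ] P)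
    (hf : ∀ m r n, f (M.ract r m) n = f m (N.lact r n)) : Tens M N →ₗ[ℂ] P :=
  (balanced M N).liftQ (TensorProduct.lift f) (by
    rw [balanced, Submodule.span_le]
    rintro _ ⟨m, r, n, rfl⟩
    simp [hf])

@[simp]
theorem tlift_tmul {M N : GrBimod 𝓡} {P : Type*} [AddCommGroup P] [Module ℂ P]
    (f : M →ₗ[ℂ] N →ₗ[ℂ] P) (hf : ∀ m r n, f (M.ract r m) n = f m (N.lact r n)) (m : M) (n : N) :
    tlift f hf (tmul M N m n) = f m n := by
  simp [tlift, tmul]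

theorem tens_ext {M N : GrBimod 𝓡} {P : Type*} [AddCommGroup P] [Module ℂ P]
    {f g : Tens M N →ₗ[ℂ] P} (h : ∀ m n, f (tmul M N m n) = g (tmul M N m n)) : f = g := by
  refine Submodule.linearMap_qext _ (TensorProduct.ext' fun m n => ?_)
  exact h m n

/-- The degree `k` part of `M ⊗_R N`: the span of the `m ⊗ n` with `deg m + deg n = k`. -/
def tensDeg (M N : GrBimod 𝓡) (k : ℤ) : Submodule ℂ (Tens M N) :=
  Submodule.span ℂ {x | ∃ i j m n, m ∈ M.deg i ∧ n ∈ N.deg j ∧ i + j = k ∧ x = tmul M N m n}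

theorem tmul_mem {M N : GrBimod 𝓡} {i j k : ℤ} {m : M} {n : N} (hm : m ∈ M.deg i)
    (hn : n ∈ N.deg j) (h : i + j = k) : tmul M N m n ∈ tensDeg M N k :=
  Submodule.subset_span ⟨i, j, m, n, hm, hn, h, rfl⟩

/-- A linear map sending homogeneous pure tensors to a degree lands in that degree. -/
theorem map_tensDeg {M N : GrBimod 𝓡} {P : Type*} [AddCommGroup P] [Module ℂ P]
    (f : Tens M N →ₗ[ℂ] P) (A : Submodule ℂ P) {k : ℤ}
    (h : ∀ i j m n, m ∈ M.deg i → n ∈ N.deg j → i + j = k → f (tmul M N m n) ∈ A) :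
    ∀ x ∈ tensDeg M N k, f x ∈ A := by
  have : tensDeg M N k ≤ A.comap f := by
    rw [tensDeg, Submodule.span_le]
    rintro _ ⟨i, j, m, n, hm, hn, hk, rfl⟩
    exact h i j m n hm hn hk
  exact this

theorem hom_ext₂ {M N : GrBimod 𝓡} {P : Type*} [AddCommGroup P] [Module ℂ P]
    {f g : M →ₗ[ℂ] N →ₗ[ℂ] P}
    (h : ∀ i j, ∀ m ∈ M.deg i, ∀ n ∈ N.deg j, f m n = g m n) : f = g :=
  hom_ext M.iSup_deg fun i m hm => hom_ext N.iSup_deg fun j n hn => h i j m hm n hn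

theorem tens_internal [GradedAlgebra 𝓡] (M N : GrBimod 𝓡) :
    DirectSum.IsInternal (tensDeg M N) := by
  obtain ⟨D, hD⟩ := M.exists_coact
  obtain ⟨D', hD'⟩ := N.exists_coact
  let B : (ℤ →₀ M) →ₗ[ℂ] (ℤ →₀ N) →ₗ[ℂ] (ℤ →₀ Tens M N) :=
    Finsupp.lsum ℂ fun i => LinearMap.flip (Finsupp.lsum ℂ fun j => LinearMap.flip
      ((tmul M N).compr₂ (Finsupp.lsingle (i + j))))
  have hB : ∀ i j m n, B (Finsupp.single i m) (Finsupp.single j n)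
      = Finsupp.single (i + j) (tmul M N m n) := by
    intro i j m n
    simp [B]
  let F : M →ₗ[ℂ] N →ₗ[ℂ] (ℤ →₀ Tens M N) := B.compl₁₂ D D'
  have hF : ∀ i j, ∀ m ∈ M.deg i, ∀ n ∈ N.deg j,
      F m n = Finsupp.single (i + j) (tmul M N m n) := by
    intro i j m hm n hn
    simp only [F, LinearMap.compl₁₂_apply, hD i m hm, hD' j n hn, hB]
  have hR : ⨆ i, 𝓡 i = ⊤ := (DirectSum.Decomposition.isInternal 𝓡).submodule_iSup_eq_top
  have hbal : ∀ m r n, F (M.ract r m) n = F m (N.lact r n) := by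
    intro m r n
    let G₁ : R →ₗ[ℂ] M →ₗ[ℂ] N →ₗ[ℂ] (ℤ →₀ Tens M N) :=
      (LinearMap.llcomp ℂ M M (N →ₗ[ℂ] (ℤ →₀ Tens M N)) F).comp M.ract.toLinearMap
    let G₂ : R →ₗ[ℂ] M →ₗ[ℂ] N →ₗ[ℂ] (ℤ →₀ Tens M N) :=
      (LinearMap.flip
        ((LinearMap.llcomp ℂ N N (ℤ →₀ Tens M N)).comp F)).comp N.lact.toLinearMap
    have : G₁ = G₂ := by
      refine hom_ext hR fun k r hr => hom_ext₂ fun i j m hm n hn => ?_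
      have h1 : G₁ r m n = F (M.ract r m) n := rfl
      have h2 : G₂ r m n = F m (N.lact r n) := rfl
      rw [h1, h2, hF _ _ _ (M.ract_mem hr hm) _ hn, hF _ _ _ hm _ (N.lact_mem hr hn), tmul_bal,
        add_assoc]
    exact congrArg (fun G => G r m n) this
  refine isInternal_of_coact ?_ (tlift F hbal) ?_
  · rw [eq_top_iff]
    have : (⨆ i, tensDeg M N i).mkQ.comp LinearMap.id = 0 := by
      refine tens_ext fun m n => ?_
      refine congrArg (fun G => G m n) (?_ : (tmul M N).compr₂ (⨆ i, tensDeg M N i).mkQ = 0)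
      refine hom_ext₂ fun i j m hm n hn => ?_
      rw [LinearMap.compr₂_apply, Submodule.mkQ_apply, LinearMap.zero_apply, LinearMap.zero_apply,
        Submodule.Quotient.mk_eq_zero]
      exact Submodule.mem_iSup_of_mem (i + j) (tmul_mem hm hn rfl)
    intro x _
    rw [← Submodule.Quotient.mk_eq_zero, ← Submodule.mkQ_apply]
    exact congrArg (fun G => G x) this
  · intro k t ht
    have := map_tensDeg (tlift F hbal - Finsupp.lsingle k) ⊥ (k := k) (by
      rintro i j m n hm hn rfl
      simp [hF i j m hm n hn]) t ht
    simpa [sub_eq_zero] using this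

/-- The left action `r · (m ⊗ n) = (r · m) ⊗ n`. -/
def tensLact (M N : GrBimod 𝓡) : R →ₐ[ℂ] Module.End ℂ (Tens M N) :=
  AlgHom.ofLinearMap
    (LinearMap.mk (AddHom.mk
      (fun r => tlift ((tmul M N).comp (M.lact r)) (fun m t n => by
        simp [M.act_comm, tmul_bal]))
      (fun r t => tens_ext fun m n => by simp)) (fun c r => tens_ext fun m n => by simp))
    (tens_ext fun m n => by simp) (fun r t => tens_ext fun m n => by simp)

/-- The right action `(m ⊗ n) · r = m ⊗ (n · r)`. -/
def tensRact (M N : GrBimod 𝓡) : R →ₐ[ℂ] Module.End ℂ (Tens M N) :=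
  AlgHom.ofLinearMap
    (LinearMap.mk (AddHom.mk
      (fun r => tlift ((tmul M N).compl₂ (N.ract r)) (fun m t n => by
        simp [← N.act_comm, tmul_bal]))
      (fun r t => tens_ext fun m n => by simp)) (fun c r => tens_ext fun m n => by simp))
    (tens_ext fun m n => by simp) (fun r t => tens_ext fun m n => by simp)

@[simp]
theorem tensLact_tmul (M N : GrBimod 𝓡) (r : R) (m : M) (n : N) :
    tensLact M N r (tmul M N m n) = tmul M N (M.lact r m) n := by
  simp [tensLact]

@[simp]
theorem tensRact_tmul (M N : GrBimod 𝓡) (r : R) (m : M) (n : N) :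
    tensRact M N r (tmul M N m n) = tmul M N m (N.ract r n) := by
  simp [tensRact]

/-- The tensor product `M ⊗_R N` of graded bimodules. -/
def tens [GradedAlgebra 𝓡] (M N : GrBimod 𝓡) : GrBimod 𝓡 where
  carrier := Tens M N
  lact := tensLact M N
  ract := tensRact M N
  act_comm r t := by
    refine LinearMap.congr_fun (f := (tensLact M N r).comp (tensRact M N t))
      (g := (tensRact M N t).comp (tensLact M N r)) (tens_ext fun m n => ?_)
    simp
  deg := tensDeg M N
  internal := tens_internal M N
  lact_mem {i j r} := fun {m} hr => map_tensDeg (tensLact M N r) _ (fun a b m n hm hn hk => by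
    rw [tensLact_tmul]
    exact tmul_mem (M.lact_mem hr hm) hn (by omega)) m
  ract_mem {i j r} := fun {m} hr => map_tensDeg (tensRact M N r) _ (fun a b m n hm hn hk => by
    rw [tensRact_tmul]
    exact tmul_mem hm (N.ract_mem hr hn) (by omega)) m

/-! ### Structural isomorphisms -/

section Basic

variable {M N : GrBimod 𝓡}

/-! Shifts -/

/-- The identity map `M → M[k]`. -/
def toShift (M : GrBimod 𝓡) (k : ℤ) : M ≃ₗ[ℂ] M.shift k := LinearEquiv.refl ℂ M

@[simp]
theorem lact_toShift (k : ℤ) (r : R) (m : M) :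
    (M.shift k).lact r (M.toShift k m) = M.toShift k (M.lact r m) := rfl

@[simp]
theorem ract_toShift (k : ℤ) (r : R) (m : M) :
    (M.shift k).ract r (M.toShift k m) = M.toShift k (M.ract r m) := rfl

theorem toShift_mem {i k : ℤ} {m : M} : M.toShift k m ∈ (M.shift k).deg i ↔ m ∈ M.deg (i + k) :=
  Iff.rfl

theorem toShift_symm_mem {i k : ℤ} {m : M.shift k} :
    (M.toShift k).symm m ∈ M.deg (i + k) ↔ m ∈ (M.shift k).deg i := Iff.rfl

theorem shift_congr {M N : GrBimod 𝓡} (h : M ≈ N) (k : ℤ) : M.shift k ≈ N.shift k := by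
  obtain ⟨f⟩ := h
  exact ⟨⟨f.e, f.map_lact, f.map_ract, fun i => f.map_deg (i + k)⟩⟩

theorem shift_shift (M : GrBimod 𝓡) (k l : ℤ) : (M.shift k).shift l ≈ M.shift (k + l) :=
  ⟨⟨LinearEquiv.refl ℂ M, fun _ _ => rfl, fun _ _ => rfl, fun i m => by
    change m ∈ M.deg (i + l + k) ↔ m ∈ M.deg (i + (k + l))
    rw [show i + l + k = i + (k + l) by ring]⟩⟩

theorem shift_zero (M : GrBimod 𝓡) : M.shift 0 ≈ M :=
  ⟨⟨LinearEquiv.refl ℂ M, fun _ _ => rfl, fun _ _ => rfl, fun i m => by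
    change m ∈ M.deg (i + 0) ↔ m ∈ M.deg i
    rw [add_zero]⟩⟩

/-! Direct sums -/

def inl (M N : GrBimod 𝓡) : M →ₗ[ℂ] M.sum N := LinearMap.inl ℂ M N
def inr (M N : GrBimod 𝓡) : N →ₗ[ℂ] M.sum N := LinearMap.inr ℂ M N
def fst (M N : GrBimod 𝓡) : M.sum N →ₗ[ℂ] M := LinearMap.fst ℂ M N
def snd (M N : GrBimod 𝓡) : M.sum N →ₗ[ℂ] N := LinearMap.snd ℂ M N

@[simp] theorem fst_inl (m : M) : fst M N (inl M N m) = m := rfl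
@[simp] theorem snd_inl (m : M) : snd M N (inl M N m) = 0 := rfl
@[simp] theorem fst_inr (n : N) : fst M N (inr M N n) = 0 := rfl
@[simp] theorem snd_inr (n : N) : snd M N (inr M N n) = n := rfl
theorem inl_fst_add (x : M.sum N) : inl M N (fst M N x) + inr M N (snd M N x) = x :=
  Prod.ext (add_zero (fst M N x)) (zero_add (snd M N x))
@[simp] theorem fst_lact (r : R) (x : M.sum N) :
    fst M N ((M.sum N).lact r x) = M.lact r (fst M N x) := rfl
@[simp] theorem snd_lact (r : R) (x : M.sum N) :
    snd M N ((M.sum N).lact r x) = N.lact r (snd M N x) := rfl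
@[simp] theorem fst_ract (r : R) (x : M.sum N) :
    fst M N ((M.sum N).ract r x) = M.ract r (fst M N x) := rfl
@[simp] theorem snd_ract (r : R) (x : M.sum N) :
    snd M N ((M.sum N).ract r x) = N.ract r (snd M N x) := rfl
theorem lact_inl (r : R) (m : M) : (M.sum N).lact r (inl M N m) = inl M N (M.lact r m) :=
  Prod.ext rfl (map_zero (N.lact r))
theorem ract_inl (r : R) (m : M) : (M.sum N).ract r (inl M N m) = inl M N (M.ract r m) :=
  Prod.ext rfl (map_zero (N.ract r))
theorem lact_inr (r : R) (n : N) : (M.sum N).lact r (inr M N n) = inr M N (N.lact r n) :=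
  Prod.ext (map_zero (M.lact r)) rfl
theorem ract_inr (r : R) (n : N) : (M.sum N).ract r (inr M N n) = inr M N (N.ract r n) :=
  Prod.ext (map_zero (M.ract r)) rfl
theorem mem_sum {i : ℤ} {x : M.sum N} :
    x ∈ (M.sum N).deg i ↔ fst M N x ∈ M.deg i ∧ snd M N x ∈ N.deg i := Iff.rfl
theorem sum_ext {x y : M.sum N} (h1 : fst M N x = fst M N y) (h2 : snd M N x = snd M N y) :
    x = y := Prod.ext h1 h2

end Basic

section Tensor

variable [GradedAlgebra 𝓡] {M N : GrBimod 𝓡}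

/-- The element `m ⊗ n` of the bimodule `M ⊗_R N`. -/
def tm (M N : GrBimod 𝓡) : M →ₗ[ℂ] N →ₗ[ℂ] M.tens N := tmul M N

theorem tm_bal (m : M) (r : R) (n : N) : tm M N (M.ract r m) n = tm M N m (N.lact r n) :=
  tmul_bal m r n

@[simp]
theorem lact_tm (r : R) (m : M) (n : N) :
    (M.tens N).lact r (tm M N m n) = tm M N (M.lact r m) n := tensLact_tmul M N r m n

@[simp]
theorem ract_tm (r : R) (m : M) (n : N) :
    (M.tens N).ract r (tm M N m n) = tm M N m (N.ract r n) := tensRact_tmul M N r m n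

theorem tm_mem {i j k : ℤ} {m : M} {n : N} (hm : m ∈ M.deg i)
    (hn : n ∈ N.deg j) (h : i + j = k) : tm M N m n ∈ (M.tens N).deg k := tmul_mem hm hn h

section Lift

variable {P : Type*} [AddCommGroup P] [Module ℂ P]

def lift (f : M →ₗ[ℂ] N →ₗ[ℂ] P) (hf : ∀ m r n, f (M.ract r m) n = f m (N.lact r n)) :
    M.tens N →ₗ[ℂ] P := tlift f hf

@[simp]
theorem lift_tm (f : M →ₗ[ℂ] N →ₗ[ℂ] P) (hf : ∀ m r n, f (M.ract r m) n = f m (N.lact r n))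
    (m : M) (n : N) : lift f hf (tm M N m n) = f m n := tlift_tmul f hf m n

theorem ext_tm {f g : M.tens N →ₗ[ℂ] P} (h : ∀ m n, f (tm M N m n) = g (tm M N m n)) : f = g :=
  tens_ext h

theorem map_deg_tm (f : M.tens N →ₗ[ℂ] P) (A : Submodule ℂ P) {k : ℤ}
    (h : ∀ i j m n, m ∈ M.deg i → n ∈ N.deg j → i + j = k → f (tm M N m n) ∈ A) :
    ∀ x ∈ (M.tens N).deg k, f x ∈ A :=
  map_tensDeg f A h

end Lift

/-- Degree-preserving bimodule isomorphisms out of a tensor product, checked on pure tensors. -/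
theorem isoOfTens {P : GrBimod 𝓡} (f : M.tens N →ₗ[ℂ] P) (g : P →ₗ[ℂ] M.tens N)
    (h1 : ∀ p, f (g p) = p) (h2 : ∀ m n, g (f (tm M N m n)) = tm M N m n)
    (hl : ∀ r m n, f (tm M N (M.lact r m) n) = P.lact r (f (tm M N m n)))
    (hr : ∀ r m n, f (tm M N m (N.ract r n)) = P.ract r (f (tm M N m n)))
    (hf : ∀ i j m n, m ∈ M.deg i → n ∈ N.deg j → f (tm M N m n) ∈ P.deg (i + j))
    (hg : ∀ i, ∀ p ∈ P.deg i, g p ∈ (M.tens N).deg i) : M.tens N ≈ P :=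
  ⟨Iso.mk' f g (LinearMap.ext h1) (ext_tm (f := g ∘ₗ f) (g := LinearMap.id) h2)
    (fun r m => LinearMap.congr_fun (ext_tm (f := f ∘ₗ (M.tens N).lact r) (g := P.lact r ∘ₗ f)
      (fun m n => by simp [hl])) m)
    (fun r m => LinearMap.congr_fun (ext_tm (f := f ∘ₗ (M.tens N).ract r) (g := P.ract r ∘ₗ f)
      (fun m n => by simp [hr])) m)
    (fun i m => map_deg_tm f _ (fun a b m n hm hn h => h ▸ hf a b m n hm hn) m)
    hg⟩

def tensMap {M' N' : GrBimod 𝓡} (f : Iso M M') (g : Iso N N') : M.tens N →ₗ[ℂ] M'.tens N' :=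
  lift ((tm M' N').compl₁₂ f.e.toLinearMap g.e.toLinearMap) (fun m r n => by
    simp [f.map_ract, g.map_lact, tm_bal])

@[simp]
theorem tensMap_tm {M' N' : GrBimod 𝓡} (f : Iso M M') (g : Iso N N') (m : M) (n : N) :
    tensMap f g (tm M N m n) = tm M' N' (f.e m) (g.e n) := by
  simp [tensMap]

/-- The tensor product is compatible with isomorphisms. -/
theorem tens_congr {M' N' : GrBimod 𝓡} (hM : M ≈ M') (hN : N ≈ N') :
    M.tens N ≈ M'.tens N' := by
  obtain ⟨f⟩ := hM
  obtain ⟨g⟩ := hN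
  exact isoOfTens (tensMap f g) (tensMap f.symm g.symm)
    (fun p => LinearMap.congr_fun (ext_tm (f := tensMap f g ∘ₗ tensMap f.symm g.symm)
      (g := LinearMap.id) (fun m n => by simp [Iso.symm])) p)
    (fun m n => by simp [Iso.symm])
    (fun r m n => by simp [f.map_lact])
    (fun r m n => by simp [g.map_ract])
    (fun i j m n hm hn => by
      rw [tensMap_tm]
      exact tm_mem ((f.map_deg i m).1 hm) ((g.map_deg j n).1 hn) rfl)
    (fun i p => map_deg_tm (tensMap f.symm g.symm) _ (fun a b m n hm hn h => by
      rw [tensMap_tm]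
      exact tm_mem ((f.symm.map_deg a m).1 hm) ((g.symm.map_deg b n).1 hn) h) p)

theorem exists_assocHom (M N P : GrBimod 𝓡) : ∃ f : (M.tens N).tens P →ₗ[ℂ] M.tens (N.tens P),
    ∀ m n p, f (tm _ _ (tm _ _ m n) p) = tm _ _ m (tm _ _ n p) := by
  let f₁ : M →ₗ[ℂ] N →ₗ[ℂ] P →ₗ[ℂ] M.tens (N.tens P) :=
    ((LinearMap.llcomp ℂ P (N.tens P) (M.tens (N.tens P))).comp
      (tm M (N.tens P))).compl₂ (tm N P)
  have h₁ : ∀ m n p, f₁ m n p = tm _ _ m (tm _ _ n p) := fun _ _ _ => rfl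
  let f₂ : M.tens N →ₗ[ℂ] P →ₗ[ℂ] M.tens (N.tens P) :=
    lift f₁ (fun m r n => LinearMap.ext fun p => by simp [h₁, tm_bal])
  have h₂ : ∀ m n p, f₂ (tm _ _ m n) p = tm _ _ m (tm _ _ n p) := fun m n p => by
    simp [f₂, h₁]
  refine ⟨lift f₂ (fun x r p => LinearMap.congr_fun (ext_tm
    (f := (LinearMap.flip f₂ p) ∘ₗ (M.tens N).ract r) (g := LinearMap.flip f₂ (P.lact r p))
    (fun m n => by
      change f₂ ((M.tens N).ract r (tm _ _ m n)) p = f₂ (tm _ _ m n) (P.lact r p)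
      rw [ract_tm, h₂, h₂, tm_bal])) x), fun m n p => (lift_tm _ _ _ _).trans (h₂ m n p)⟩

theorem exists_assocInv (M N P : GrBimod 𝓡) : ∃ f : M.tens (N.tens P) →ₗ[ℂ] (M.tens N).tens P,
    ∀ m n p, f (tm _ _ m (tm _ _ n p)) = tm _ _ (tm _ _ m n) p := by
  let f₁ : M →ₗ[ℂ] N →ₗ[ℂ] P →ₗ[ℂ] (M.tens N).tens P :=
    (tm M N).compr₂ (tm (M.tens N) P)
  have h₁ : ∀ m n p, f₁ m n p = tm _ _ (tm _ _ m n) p := fun _ _ _ => rfl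
  have h₂ : ∀ m, ∃ g : N.tens P →ₗ[ℂ] (M.tens N).tens P,
      ∀ n p, g (tm _ _ n p) = tm _ _ (tm _ _ m n) p := fun m =>
    ⟨lift (f₁ m) (fun n r p => by simp [h₁, ← tm_bal]), fun n p => by simp [h₁]⟩
  choose g hg using h₂
  let f₂ : M →ₗ[ℂ] N.tens P →ₗ[ℂ] (M.tens N).tens P :=
    { toFun := g
      map_add' := fun m m' => ext_tm fun n p => by simp [hg]
      map_smul' := fun c m => ext_tm fun n p => by simp [hg] }
  have h₃ : ∀ m n p, f₂ m (tm _ _ n p) = tm _ _ (tm _ _ m n) p := hg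
  refine ⟨lift f₂ (fun m r x => LinearMap.congr_fun (ext_tm
    (f := f₂ (M.ract r m)) (g := f₂ m ∘ₗ (N.tens P).lact r)
    (fun n p => by simp [h₃, tm_bal])) x), fun m n p => by simp [h₃]⟩

theorem tens_assoc (M N P : GrBimod 𝓡) : (M.tens N).tens P ≈ M.tens (N.tens P) := by
  obtain ⟨f, hf⟩ := exists_assocHom M N P
  obtain ⟨g, hg⟩ := exists_assocInv M N P
  have key : ∀ {Q : GrBimod 𝓡} {a b : (M.tens N).tens P →ₗ[ℂ] Q},
      (∀ m n p, a (tm _ _ (tm _ _ m n) p) = b (tm _ _ (tm _ _ m n) p)) → a = b := by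
    intro Q a b h
    refine ext_tm fun x p => ?_
    exact LinearMap.congr_fun (ext_tm (f := a ∘ₗ (tm (M.tens N) P).flip p)
      (g := b ∘ₗ (tm (M.tens N) P).flip p) (fun m n => by simp [h])) x
  have key' : ∀ {Q : GrBimod 𝓡} {a b : M.tens (N.tens P) →ₗ[ℂ] Q},
      (∀ m n p, a (tm _ _ m (tm _ _ n p)) = b (tm _ _ m (tm _ _ n p))) → a = b := by
    intro Q a b h
    refine ext_tm fun m x => ?_
    exact LinearMap.congr_fun (ext_tm (f := a ∘ₗ tm M (N.tens P) m)
      (g := b ∘ₗ tm M (N.tens P) m) (fun n p => by simp [h])) x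
  refine ⟨Iso.mk' f g ?_ ?_ ?_ ?_ ?_ ?_⟩
  · exact key' fun m n p => by simp [hf, hg]
  · exact key fun m n p => by simp [hf, hg]
  · exact fun r => LinearMap.congr_fun (key (a := f ∘ₗ ((M.tens N).tens P).lact r)
      (b := (M.tens (N.tens P)).lact r ∘ₗ f) fun m n p => by simp [hf])
  · exact fun r => LinearMap.congr_fun (key (a := f ∘ₗ ((M.tens N).tens P).ract r)
      (b := (M.tens (N.tens P)).ract r ∘ₗ f) fun m n p => by simp [hf])
  · refine fun k => map_deg_tm f _ fun a b x p hx hp hk => ?_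
    refine map_deg_tm (f ∘ₗ (tm (M.tens N) P).flip p) _ (fun i j m n hm hn hij => ?_) x hx
    simp only [LinearMap.comp_apply, LinearMap.flip_apply, hf]
    exact tm_mem hm (tm_mem hn hp rfl) (by omega)
  · refine fun k => map_deg_tm g _ fun a b m x hm hx hk => ?_
    refine map_deg_tm (g ∘ₗ tm M (N.tens P) m) _ (fun i j n p hn hp hij => ?_) x hx
    simp only [LinearMap.comp_apply, hg]
    exact tm_mem (tm_mem hm hn rfl) hp (by omega)

theorem shift_tens (M N : GrBimod 𝓡) (k : ℤ) : (M.shift k).tens N ≈ (M.tens N).shift k := by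
  let f : (M.shift k).tens N →ₗ[ℂ] M.tens N :=
    lift ((tm M N).comp (M.toShift k).symm.toLinearMap) (fun m r n => by
      obtain ⟨m, rfl⟩ := (M.toShift k).surjective m
      simp [tm_bal])
  have hf : ∀ m n, f (tm _ _ (M.toShift k m) n) = tm _ _ m n := fun m n => by simp [f]
  let g : M.tens N →ₗ[ℂ] (M.shift k).tens N :=
    lift ((tm (M.shift k) N).comp (M.toShift k).toLinearMap) (fun m r n => by
      simp [← tm_bal])
  have hg : ∀ m n, g (tm _ _ m n) = tm _ _ (M.toShift k m) n := fun m n => by simp [g]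
  refine isoOfTens (((M.tens N).toShift k).toLinearMap ∘ₗ f)
    (g ∘ₗ ((M.tens N).toShift k).symm.toLinearMap) ?_ ?_ ?_ ?_ ?_ ?_
  · have : f ∘ₗ g = LinearMap.id := ext_tm fun m n => by simp [hf, hg]
    intro p
    obtain ⟨p, rfl⟩ := ((M.tens N).toShift k).surjective p
    simpa using LinearMap.congr_fun this p
  · intro m n
    obtain ⟨m, rfl⟩ := (M.toShift k).surjective m
    simp [hf, hg]
  · intro r m n
    obtain ⟨m, rfl⟩ := (M.toShift k).surjective m
    simp [hf]
  · intro r m n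
    obtain ⟨m, rfl⟩ := (M.toShift k).surjective m
    simp [hf]
  · intro i j m n hm hn
    obtain ⟨m, rfl⟩ := (M.toShift k).surjective m
    simp only [LinearMap.comp_apply, hf, LinearEquiv.coe_coe]
    exact toShift_mem.2 (tm_mem (toShift_mem.1 hm) hn (by ring))
  · intro i p hp
    obtain ⟨p, rfl⟩ := ((M.tens N).toShift k).surjective p
    simp only [LinearMap.comp_apply, LinearEquiv.coe_coe, LinearEquiv.symm_apply_apply]
    refine map_deg_tm g _ (fun a b m n hm hn h => ?_) p (toShift_mem.1 hp)
    rw [hg]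
    refine tm_mem (i := a - k) (toShift_mem.2 ?_) hn (by omega)
    rwa [sub_add_cancel]

theorem tens_shift (M N : GrBimod 𝓡) (k : ℤ) : M.tens (N.shift k) ≈ (M.tens N).shift k := by
  let f : M.tens (N.shift k) →ₗ[ℂ] M.tens N :=
    lift ((tm M N).compl₂ (N.toShift k).symm.toLinearMap) (fun m r n => by
      obtain ⟨n, rfl⟩ := (N.toShift k).surjective n
      simp [tm_bal])
  have hf : ∀ m n, f (tm _ _ m (N.toShift k n)) = tm _ _ m n := fun m n => by simp [f]
  let g : M.tens N →ₗ[ℂ] M.tens (N.shift k) :=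
    lift ((tm M (N.shift k)).compl₂ (N.toShift k).toLinearMap) (fun m r n => by
      simp [tm_bal])
  have hg : ∀ m n, g (tm _ _ m n) = tm _ _ m (N.toShift k n) := fun m n => lift_tm _ _ m n
  refine isoOfTens (((M.tens N).toShift k).toLinearMap ∘ₗ f)
    (g ∘ₗ ((M.tens N).toShift k).symm.toLinearMap) ?_ ?_ ?_ ?_ ?_ ?_
  · have : f ∘ₗ g = LinearMap.id := ext_tm fun m n => by simp [hf, hg]
    intro p
    obtain ⟨p, rfl⟩ := ((M.tens N).toShift k).surjective p
    simpa using LinearMap.congr_fun this p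
  · intro m n
    obtain ⟨n, rfl⟩ := (N.toShift k).surjective n
    simp [hf, hg]
  · intro r m n
    obtain ⟨n, rfl⟩ := (N.toShift k).surjective n
    simp [hf]
  · intro r m n
    obtain ⟨n, rfl⟩ := (N.toShift k).surjective n
    simp [hf]
  · intro i j m n hm hn
    obtain ⟨n, rfl⟩ := (N.toShift k).surjective n
    simp only [LinearMap.comp_apply, hf, LinearEquiv.coe_coe]
    exact toShift_mem.2 (tm_mem hm (toShift_mem.1 hn) (by ring))
  · intro i p hp
    obtain ⟨p, rfl⟩ := ((M.tens N).toShift k).surjective p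
    simp only [LinearMap.comp_apply, LinearEquiv.coe_coe, LinearEquiv.symm_apply_apply]
    refine map_deg_tm g _ (fun a b m n hm hn h => ?_) p (toShift_mem.1 hp)
    rw [hg]
    refine tm_mem (j := b - k) hm (toShift_mem.2 ?_) (by omega)
    rwa [sub_add_cancel]

/-! Unit -/

/-- The element of the regular bimodule given by an element of `R`. -/
def toReg (𝓡 : ℤ → Submodule ℂ R) [GradedAlgebra 𝓡] : R ≃ₗ[ℂ] regular 𝓡 := LinearEquiv.refl ℂ R

theorem lact_toReg (r t : R) : (regular 𝓡).lact r (toReg 𝓡 t) = toReg 𝓡 (r * t) := rfl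

theorem ract_toReg (r t : R) : (regular 𝓡).ract r (toReg 𝓡 t) = toReg 𝓡 (t * r) :=
  congrArg (toReg 𝓡) (mul_comm r t)

theorem toReg_mem {r : R} {i : ℤ} : toReg 𝓡 r ∈ (regular 𝓡).deg i ↔ r ∈ 𝓡 i := Iff.rfl

theorem regular_tens (M : GrBimod 𝓡) : (regular 𝓡).tens M ≈ M := by
  let f : (regular 𝓡).tens M →ₗ[ℂ] M :=
    lift (M.lact.toLinearMap ∘ₗ (toReg 𝓡).symm.toLinearMap) (fun m r n => by
      obtain ⟨m, rfl⟩ := (toReg 𝓡).surjective m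
      simp [ract_toReg])
  have hf : ∀ r m, f (tm _ _ (toReg 𝓡 r) m) = M.lact r m := fun r m => by simp [f]
  have h1 : ∀ r (m : M), tm (regular 𝓡) M (toReg 𝓡 1) (M.lact r m)
      = tm _ _ (toReg 𝓡 r) m := fun r m => by
    rw [← tm_bal, ract_toReg, one_mul]
  refine isoOfTens f (tm (regular 𝓡) M (toReg 𝓡 1)) ?_ ?_ ?_ ?_ ?_ ?_
  · intro p
    simp [hf]
  · intro r m
    obtain ⟨r, rfl⟩ := (toReg 𝓡).surjective r
    rw [hf, h1]
  · intro r t m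
    obtain ⟨t, rfl⟩ := (toReg 𝓡).surjective t
    simp [lact_toReg, hf]
  · intro r t m
    obtain ⟨t, rfl⟩ := (toReg 𝓡).surjective t
    simp [hf, M.act_comm]
  · intro i j t m ht hm
    obtain ⟨t, rfl⟩ := (toReg 𝓡).surjective t
    rw [hf]
    exact M.lact_mem (toReg_mem.1 ht) hm
  · intro i p hp
    exact tm_mem (toReg_mem.2 SetLike.GradedOne.one_mem) hp (by ring)

theorem tens_regular (M : GrBimod 𝓡) : M.tens (regular 𝓡) ≈ M := by
  let f : M.tens (regular 𝓡) →ₗ[ℂ] M :=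
    lift ((M.ract.toLinearMap ∘ₗ (toReg 𝓡).symm.toLinearMap).flip) (fun m r n => by
      obtain ⟨n, rfl⟩ := (toReg 𝓡).surjective n
      simp only [lact_toReg, mul_comm r n]
      simp)
  have hf : ∀ r m, f (tm _ _ m (toReg 𝓡 r)) = M.ract r m := fun r m => by simp [f]
  have h1 : ∀ r (m : M), tm M (regular 𝓡) (M.ract r m) (toReg 𝓡 1)
      = tm _ _ m (toReg 𝓡 r) := fun r m => by
    rw [tm_bal, lact_toReg, mul_one]
  refine isoOfTens f ((tm M (regular 𝓡)).flip (toReg 𝓡 1)) ?_ ?_ ?_ ?_ ?_ ?_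
  · intro p
    simp [hf]
  · intro m r
    obtain ⟨r, rfl⟩ := (toReg 𝓡).surjective r
    rw [hf, LinearMap.flip_apply, h1]
  · intro r m t
    obtain ⟨t, rfl⟩ := (toReg 𝓡).surjective t
    simp [hf, M.act_comm]
  · intro r m t
    obtain ⟨t, rfl⟩ := (toReg 𝓡).surjective t
    rw [ract_toReg, hf, hf, mul_comm]
    simp
  · intro i j m t hm ht
    obtain ⟨t, rfl⟩ := (toReg 𝓡).surjective t
    rw [hf]
    exact M.ract_mem (toReg_mem.1 ht) hm
  · intro i p hp
    exact tm_mem hp (toReg_mem.2 SetLike.GradedOne.one_mem) (by ring)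

theorem sum_tens (M N P : GrBimod 𝓡) : (M.sum N).tens P ≈ (M.tens P).sum (N.tens P) := by
  let f : (M.sum N).tens P →ₗ[ℂ] (M.tens P).sum (N.tens P) :=
    lift ((tm M P).compr₂ (inl _ _) ∘ₗ fst M N + (tm N P).compr₂ (inr _ _) ∘ₗ snd M N)
      (fun m r n => by simp [tm_bal])
  have hf : ∀ x p, f (tm _ _ x p) = inl _ _ (tm _ _ (fst M N x) p) +
    inr _ _ (tm _ _ (snd M N x) p) := fun m n => lift_tm _ _ m n
  let g₁ : M.tens P →ₗ[ℂ] (M.sum N).tens P :=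
    lift (tm (M.sum N) P ∘ₗ inl M N) (fun m r n => by simp [← tm_bal, ract_inl])
  have hg₁ : ∀ m p, g₁ (tm _ _ m p) = tm _ _ (inl M N m) p := fun m p => by simp [g₁]
  let g₂ : N.tens P →ₗ[ℂ] (M.sum N).tens P :=
    lift (tm (M.sum N) P ∘ₗ inr M N) (fun m r n => by simp [← tm_bal, ract_inr])
  have hg₂ : ∀ m p, g₂ (tm _ _ m p) = tm _ _ (inr M N m) p := fun m p => by simp [g₂]
  refine isoOfTens f (g₁ ∘ₗ fst _ _ + g₂ ∘ₗ snd _ _) ?_ ?_ ?_ ?_ ?_ ?_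
  · have h1 : f ∘ₗ g₁ = inl _ _ := ext_tm fun m p => by simp [hf, hg₁]
    have h2 : f ∘ₗ g₂ = inr _ _ := ext_tm fun m p => by simp [hf, hg₂]
    intro x
    have e1 := LinearMap.congr_fun h1 (fst _ _ x)
    have e2 := LinearMap.congr_fun h2 (snd _ _ x)
    simp only [LinearMap.comp_apply] at e1 e2
    simp [e1, e2, inl_fst_add]
  · intro x p
    rw [hf]
    simp only [LinearMap.add_apply, LinearMap.comp_apply, map_add, fst_inl, fst_inr, snd_inl, snd_inr,
      map_zero, add_zero, zero_add, hg₁, hg₂]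
    rw [← LinearMap.add_apply, ← map_add, inl_fst_add]
  · intro r x p
    simp [hf, lact_inl, lact_inr]
  · intro r x p
    simp [hf, ract_inl, ract_inr]
  · intro i j x p hx hp
    rw [hf]
    refine mem_sum.2 ⟨?_, ?_⟩
    · simpa using tm_mem (mem_sum.1 hx).1 hp rfl
    · simpa using tm_mem (mem_sum.1 hx).2 hp rfl
  · intro k y hy
    refine Submodule.add_mem _ ?_ ?_
    · refine map_deg_tm g₁ _ (fun i j m p hm hp h => ?_) _ (mem_sum.1 hy).1
      rw [hg₁]
      exact tm_mem (mem_sum.2 ⟨by simpa using hm, by simp⟩) hp h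
    · refine map_deg_tm g₂ _ (fun i j m p hm hp h => ?_) _ (mem_sum.1 hy).2
      rw [hg₂]
      exact tm_mem (mem_sum.2 ⟨by simp, by simpa using hm⟩) hp h

theorem tens_sum (P M N : GrBimod 𝓡) : P.tens (M.sum N) ≈ (P.tens M).sum (P.tens N) := by
  let f : P.tens (M.sum N) →ₗ[ℂ] (P.tens M).sum (P.tens N) :=
    lift (((tm P M).compr₂ (inl _ _)).compl₂ (fst M N) + ((tm P N).compr₂ (inr _ _)).compl₂ (snd M N))
      (fun m r n => by simp [tm_bal])
  have hf : ∀ x p, f (tm _ _ p x) = inl _ _ (tm _ _ p (fst M N x)) +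
    inr _ _ (tm _ _ p (snd M N x)) := fun x p => lift_tm _ _ p x
  let g₁ : P.tens M →ₗ[ℂ] P.tens (M.sum N) :=
    lift ((tm P (M.sum N)).compl₂ (inl M N)) (fun m r n => by simp [tm_bal, lact_inl])
  have hg₁ : ∀ m p, g₁ (tm _ _ p m) = tm _ _ p (inl M N m) := fun m p => lift_tm _ _ p m
  let g₂ : P.tens N →ₗ[ℂ] P.tens (M.sum N) :=
    lift ((tm P (M.sum N)).compl₂ (inr M N)) (fun m r n => by simp [tm_bal, lact_inr])
  have hg₂ : ∀ m p, g₂ (tm _ _ p m) = tm _ _ p (inr M N m) := fun m p => lift_tm _ _ p m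
  refine isoOfTens f (g₁ ∘ₗ fst _ _ + g₂ ∘ₗ snd _ _) ?_ ?_ ?_ ?_ ?_ ?_
  · have h1 : f ∘ₗ g₁ = inl _ _ := ext_tm fun m p => by simp [hf, hg₁]
    have h2 : f ∘ₗ g₂ = inr _ _ := ext_tm fun m p => by simp [hf, hg₂]
    intro x
    have e1 := LinearMap.congr_fun h1 (fst _ _ x)
    have e2 := LinearMap.congr_fun h2 (snd _ _ x)
    simp only [LinearMap.comp_apply] at e1 e2
    simp [e1, e2, inl_fst_add]
  · intro p x
    rw [hf]
    simp only [LinearMap.add_apply, LinearMap.comp_apply, map_add, fst_inl, fst_inr, snd_inl, snd_inr,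
      map_zero, add_zero, zero_add, hg₁, hg₂]
    rw [← map_add, inl_fst_add]
  · intro r p x
    simp [hf, lact_inl, lact_inr]
  · intro r p x
    simp [hf, ract_inl, ract_inr]
  · intro i j p x hp hx
    rw [hf]
    refine mem_sum.2 ⟨?_, ?_⟩
    · simpa using tm_mem hp (mem_sum.1 hx).1 rfl
    · simpa using tm_mem hp (mem_sum.1 hx).2 rfl
  · intro k y hy
    refine Submodule.add_mem _ ?_ ?_
    · refine map_deg_tm g₁ _ (fun i j p m hp hm h => ?_) _ (mem_sum.1 hy).1
      rw [hg₁]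
      exact tm_mem hp (mem_sum.2 ⟨by simpa using hm, by simp⟩) h
    · refine map_deg_tm g₂ _ (fun i j p m hp hm h => ?_) _ (mem_sum.1 hy).2
      rw [hg₂]
      exact tm_mem hp (mem_sum.2 ⟨by simp, by simpa using hm⟩) h

/-! ### The generated category and its split Grothendieck ring -/

/-- The objects of the additive, graded (stable by shifts), monoidal, Karoubian full subcategory of
graded `R`-bimodules generated by `G`: the smallest class that contains `G` and the monoidal unit
`R` and is stable by shifts, direct sums, tensor products over `R` and direct summands (hence by
isomorphisms; it contains the zero bimodule, as a direct summand of `R`). -/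
inductive Generated (G : GrBimod 𝓡) : GrBimod 𝓡 → Prop
  | gen : Generated G G
  | unit : Generated G (regular 𝓡)
  | shift {M : GrBimod 𝓡} (k : ℤ) : Generated G M → Generated G (M.shift k)
  | sum {M N : GrBimod 𝓡} : Generated G M → Generated G N → Generated G (M.sum N)
  | tens {M N : GrBimod 𝓡} : Generated G M → Generated G N → Generated G (M.tens N)
  | summand {M N P : GrBimod 𝓡} : Generated G M → M ≈ N.sum P → Generated G N

/-- The isomorphism classes of objects of the category generated by `G`. -/
def IsoClass (G : GrBimod 𝓡) : Type (u + 1) :=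
  Quotient (Setoid.comap (Subtype.val : {M : GrBimod 𝓡 // Generated G M} → GrBimod 𝓡) isoSetoid)

/-- The isomorphism class of an object. -/
def isoClass {G : GrBimod 𝓡} (M : GrBimod 𝓡) (hM : Generated G M) : IsoClass G :=
  Quotient.mk _ ⟨M, hM⟩

theorem isoClass_eq {G M N : GrBimod 𝓡} {hM : Generated G M} {hN : Generated G N} (h : M ≈ N) :
    isoClass M hM = isoClass N hN :=
  Quotient.sound (s := Setoid.comap Subtype.val isoSetoid) h

theorem isoClass_ind {G : GrBimod 𝓡} {p : IsoClass G → Prop}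
    (h : ∀ M (hM : Generated G M), p (isoClass M hM)) (x : IsoClass G) : p x :=
  Quotient.ind (fun M => h M.1 M.2) x

/-- Isomorphism classes form a monoid under the tensor product over `R`. -/
instance (G : GrBimod 𝓡) : Monoid (IsoClass G) where
  mul := Quotient.map₂ (fun M N => ⟨M.1.tens N.1, M.2.tens N.2⟩)
    (fun _ _ hM _ _ hN => tens_congr hM hN)
  one := isoClass (regular 𝓡) Generated.unit
  mul_assoc x y z := by
    induction x using isoClass_ind
    induction y using isoClass_ind
    induction z using isoClass_ind
    exact isoClass_eq (tens_assoc _ _ _)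
  one_mul x := by
    induction x using isoClass_ind
    exact isoClass_eq (regular_tens _)
  mul_one x := by
    induction x using isoClass_ind
    exact isoClass_eq (tens_regular _)

theorem isoClass_mul {G M N : GrBimod 𝓡} (hM : Generated G M) (hN : Generated G N) :
    isoClass M hM * isoClass N hN = isoClass (M.tens N) (hM.tens hN) := rfl

theorem isoClass_one {G : GrBimod 𝓡} :
    (1 : IsoClass G) = isoClass (regular 𝓡) Generated.unit := rfl

/-- The subgroup generated by the elements `[M ⊕ N] - [M] - [N]`. -/
def splitRel (G : GrBimod 𝓡) : AddSubgroup (FreeAbelianGroup (IsoClass G)) :=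
  AddSubgroup.closure {x | ∃ (M N : GrBimod 𝓡) (hM : Generated G M) (hN : Generated G N),
    x = FreeAbelianGroup.of (isoClass (M.sum N) (hM.sum hN)) - FreeAbelianGroup.of (isoClass M hM)
      - FreeAbelianGroup.of (isoClass N hN)}

theorem mul_splitRel {G : GrBimod 𝓡} (a : FreeAbelianGroup (IsoClass G)) :
    ∀ x ∈ splitRel G, a * x ∈ splitRel G := by
  induction a using FreeAbelianGroup.induction_on with
  | zero => exact fun x _ => by simp
  | of c =>
    induction c using isoClass_ind with
    | h P hP =>
      refine AddSubgroup.closure_le ((splitRel G).comap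
        (AddMonoidHom.mulLeft (FreeAbelianGroup.of (isoClass P hP)))) |>.2 ?_
      rintro _ ⟨M, N, hM, hN, rfl⟩
      refine AddSubgroup.subset_closure ⟨P.tens M, P.tens N, hP.tens hM, hP.tens hN, ?_⟩
      rw [← isoClass_eq (hM := hP.tens (hM.sum hN)) (tens_sum P M N)]
      simp [mul_sub, FreeAbelianGroup.of_mul_of, isoClass_mul]
  | neg c h =>
    intro x hx
    rw [neg_mul]; exact (splitRel G).neg_mem (h x hx)
  | add a b ha hb =>
    intro x hx
    rw [add_mul]; exact (splitRel G).add_mem (ha x hx) (hb x hx)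

theorem splitRel_mul {G : GrBimod 𝓡} (a : FreeAbelianGroup (IsoClass G)) :
    ∀ x ∈ splitRel G, x * a ∈ splitRel G := by
  induction a using FreeAbelianGroup.induction_on with
  | zero => exact fun x _ => by simp
  | of c =>
    induction c using isoClass_ind with
    | h P hP =>
      refine AddSubgroup.closure_le ((splitRel G).comap
        (AddMonoidHom.mulRight (FreeAbelianGroup.of (isoClass P hP)))) |>.2 ?_
      rintro _ ⟨M, N, hM, hN, rfl⟩
      refine AddSubgroup.subset_closure ⟨M.tens P, N.tens P, hM.tens hP, hN.tens hP, ?_⟩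
      rw [← isoClass_eq (hM := (hM.sum hN).tens hP) (sum_tens M N P)]
      simp [sub_mul, FreeAbelianGroup.of_mul_of, isoClass_mul]
  | neg c h =>
    intro x hx
    rw [mul_neg]; exact (splitRel G).neg_mem (h x hx)
  | add a b ha hb =>
    intro x hx
    rw [mul_add]; exact (splitRel G).add_mem (ha x hx) (hb x hx)

/-- The subgroup `splitRel G` is a two-sided ideal for the product induced by `⊗_R`. -/
def splitIdeal (G : GrBimod 𝓡) : Ideal (FreeAbelianGroup (IsoClass G)) :=
  { splitRel G with smul_mem' := fun a x hx => mul_splitRel a x hx }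

instance (G : GrBimod 𝓡) : (splitIdeal G).IsTwoSided :=
  ⟨fun {x} b hx => splitRel_mul b x hx⟩

/-- The split Grothendieck ring of the category generated by `G`: the free abelian group on the
isomorphism classes of objects modulo `[M ⊕ N] = [M] + [N]`, with `[M] * [N] = [M ⊗_R N]`. -/
def GrothRing (G : GrBimod 𝓡) : Type (u + 1) := FreeAbelianGroup (IsoClass G) ⧸ splitIdeal G

noncomputable instance (G : GrBimod 𝓡) : Ring (GrothRing G) := Ideal.Quotient.ring (splitIdeal G)

/-- The class `⟨M⟩` of an object in the split Grothendieck ring. -/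
noncomputable def cls {G : GrBimod 𝓡} (M : GrBimod 𝓡) (hM : Generated G M) : GrothRing G :=
  Ideal.Quotient.mk (splitIdeal G) (FreeAbelianGroup.of (isoClass M hM))

theorem cls_mul {G M N : GrBimod 𝓡} (hM : Generated G M) (hN : Generated G N) :
    cls M hM * cls N hN = cls (M.tens N) (hM.tens hN) := by
  refine (map_mul (Ideal.Quotient.mk (splitIdeal G)) _ _).symm.trans ?_
  rw [FreeAbelianGroup.of_mul_of, isoClass_mul, cls]

theorem cls_eq {G M N : GrBimod 𝓡} {hM : Generated G M} {hN : Generated G N} (h : M ≈ N) :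
    cls M hM = cls N hN := by
  rw [cls, isoClass_eq h, cls]

theorem cls_unit {G : GrBimod 𝓡} : cls (regular 𝓡) (Generated.unit (G := G)) = 1 := rfl

theorem cls_sum {G M N : GrBimod 𝓡} (hM : Generated G M) (hN : Generated G N) :
    cls (M.sum N) (hM.sum hN) = cls M hM + cls N hN := by
  have : FreeAbelianGroup.of (isoClass (M.sum N) (hM.sum hN)) -
      (FreeAbelianGroup.of (isoClass M hM) + FreeAbelianGroup.of (isoClass N hN))
      ∈ splitIdeal G := by
    rw [← sub_sub]
    exact AddSubgroup.subset_closure ⟨M, N, hM, hN, rfl⟩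
  exact (Ideal.Quotient.eq.2 this).trans (map_add (Ideal.Quotient.mk (splitIdeal G)) _ _)

theorem cls_shift_regular_mul {G M : GrBimod 𝓡} (hM : Generated G M) (k : ℤ) :
    cls ((regular 𝓡).shift k) (Generated.unit.shift k) * cls M hM = cls (M.shift k) (hM.shift k) := by
  rw [cls_mul]
  exact cls_eq (Setoid.trans (shift_tens _ _ _) (shift_congr (regular_tens _) _))

theorem cls_mul_shift_regular {G M : GrBimod 𝓡} (hM : Generated G M) (k : ℤ) :
    cls M hM * cls ((regular 𝓡).shift k) (Generated.unit.shift k) = cls (M.shift k) (hM.shift k) := by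
  rw [cls_mul]
  exact cls_eq (Setoid.trans (tens_shift _ _ _) (shift_congr (tens_regular _) _))

/-- The classes of the shifts `R[k]` of the unit. -/
noncomputable def shiftHom (G : GrBimod 𝓡) : Multiplicative ℤ →* GrothRing G where
  toFun k := cls ((regular 𝓡).shift k.toAdd) (Generated.unit.shift _)
  map_one' := (cls_eq (shift_zero _)).trans cls_unit
  map_mul' k l := by
    rw [cls_shift_regular_mul, toAdd_mul, add_comm]
    exact (cls_eq (shift_shift _ _ _)).symm

theorem grothRing_induction {G : GrBimod 𝓡} {p : GrothRing G → Prop} (h0 : p 0)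
    (hc : ∀ M (hM : Generated G M), p (cls M hM)) (hneg : ∀ x, p x → p (-x))
    (hadd : ∀ x y, p x → p y → p (x + y)) (x : GrothRing G) : p x := by
  obtain ⟨a, rfl⟩ := Ideal.Quotient.mk_surjective x
  induction a using FreeAbelianGroup.induction_on with
  | zero => exact h0
  | of c => induction c using isoClass_ind with
    | h M hM => exact hc M hM
  | neg c h => exact hneg _ h
  | add a b ha hb => exact hadd _ _ ha hb

/-- The `ℤ[v, v⁻¹]`-algebra structure on the split Grothendieck ring, for which multiplication by
`v` is induced by the shift `[1]`. -/
noncomputable instance (G : GrBimod 𝓡) : Algebra ℤ[T;T⁻¹] (GrothRing G) :=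
  RingHom.toAlgebra' (AddMonoidAlgebra.lift ℤ (GrothRing G) ℤ (shiftHom G)).toRingHom (by
    intro c x
    induction c using AddMonoidAlgebra.induction_on with
    | of k =>
      simp only [AlgHom.toRingHom_eq_coe, RingHom.coe_coe, AddMonoidAlgebra.lift_of]
      induction x using grothRing_induction with
      | h0 => simp
      | hc M hM =>
        exact (cls_shift_regular_mul hM _).trans (cls_mul_shift_regular hM _).symm
      | hneg x h => rw [mul_neg, neg_mul, h]
      | hadd x y hx hy => rw [mul_add, add_mul, hx, hy]
    | add f g hf hg => rw [map_add, add_mul, mul_add, hf, hg]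
    | smul r f hf =>
      simp only [AlgHom.toRingHom_eq_coe, RingHom.coe_coe, map_smul, smul_mul_assoc,
        mul_smul_comm] at hf ⊢
      rw [hf])

theorem T_smul_cls {G M : GrBimod 𝓡} (hM : Generated G M) (k : ℤ) :
    (LaurentPolynomial.T k : ℤ[T;T⁻¹]) • cls M hM = cls (M.shift k) (hM.shift k) := by
  rw [Algebra.smul_def, ← cls_shift_regular_mul hM]
  exact congrArg (· * cls M hM) (AddMonoidAlgebra.lift_of (R := ℤ) (shiftHom G) (Multiplicative.ofAdd k))

end Tensor

end General

end GrBimod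

/-! ## Regular functions on closed cones -/

namespace RegFun

section Cone

variable {E : Type u} [AddCommGroup E] [Module ℂ E]

/-- The restriction to `Z ⊆ E` of a linear form on `E`. -/
def linForm (Z : Set E) : Module.Dual ℂ E →ₗ[ℂ] (Z → ℂ) where
  toFun φ z := φ z
  map_add' _ _ := rfl
  map_smul' _ _ := rfl

/-- The ring `𝒪(Z)` of regular functions on `Z ⊆ E`: the restrictions to `Z` of the polynomial
functions on `E`, that is, the algebra of functions generated by the restricted linear forms. -/
def regFun (Z : Set E) : Subalgebra ℂ (Z → ℂ) := Algebra.adjoin ℂ (Set.range (linForm Z))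

/-- Restricted linear forms as elements of `𝒪(Z)`. -/
def lin (Z : Set E) : Module.Dual ℂ E →ₗ[ℂ] regFun Z where
  toFun φ := ⟨linForm Z φ, Algebra.subset_adjoin ⟨φ, rfl⟩⟩
  map_add' _ _ := rfl
  map_smul' _ _ := rfl

/-- The grading of `𝒪(Z)`, in which linear forms have degree `2`: the degree `2k` part is
spanned by the products of `k` linear forms, and the odd and negative parts vanish. -/
def regDeg (Z : Set E) (n : ℤ) : Submodule ℂ (regFun Z) :=
  ⨆ (k : ℕ) (_ : 2 * (k : ℤ) = n), LinearMap.range (lin Z) ^ k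

theorem pow_le_regDeg (Z : Set E) (k : ℕ) : LinearMap.range (lin Z) ^ k ≤ regDeg Z (2 * k) :=
  le_iSup₂_of_le k rfl le_rfl

instance (Z : Set E) : SetLike.GradedMonoid (regDeg Z) where
  one_mem := pow_le_regDeg Z 0 (by rw [pow_zero]; exact Submodule.mem_one.2 ⟨1, map_one _⟩)
  mul_mem i j f g hf hg := by
    have : regDeg Z i * regDeg Z j ≤ regDeg Z (i + j) := by
      simp only [regDeg, Submodule.iSup_mul, Submodule.mul_iSup]
      refine iSup₂_le fun l hl => iSup₂_le fun k hk => ?_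
      rw [← pow_add]
      exact le_iSup₂_of_le (k + l) (by push_cast; omega) le_rfl
    exact this (Submodule.mul_mem_mul hf hg)

theorem iSup_regDeg (Z : Set E) : ⨆ n, regDeg Z n = ⊤ := by
  rw [eq_top_iff]
  rintro ⟨f, hf⟩ -
  induction hf using Algebra.adjoin_induction with
  | mem x hx =>
    obtain ⟨φ, rfl⟩ := hx
    refine Submodule.mem_iSup_of_mem 2 (pow_le_regDeg Z 1 ?_)
    rw [pow_one]
    exact ⟨φ, rfl⟩
  | algebraMap r =>
    refine Submodule.mem_iSup_of_mem 0 (pow_le_regDeg Z 0 ?_)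
    rw [pow_zero]
    exact Submodule.mem_one.2 ⟨r, rfl⟩
  | add x y hx hy h1 h2 => exact Submodule.add_mem _ h1 h2
  | mul x y hx hy h1 h2 =>
    have : (⨆ n, regDeg Z n) * (⨆ n, regDeg Z n) ≤ ⨆ n, regDeg Z n := by
      simp only [Submodule.iSup_mul, Submodule.mul_iSup]
      refine iSup_le fun j => iSup_le fun i => le_iSup_of_le (i + j) ?_
      exact Submodule.mul_le.2 fun f hf g hg => SetLike.mul_mem_graded hf hg
    exact this (Submodule.mul_mem_mul h1 h2)

theorem regDeg_internal {Z : Set E} (hZ : ∀ c : ℂ, ∀ z ∈ Z, c • z ∈ Z) :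
    DirectSum.IsInternal (regDeg Z) := by
  refine DirectSum.isInternal_submodule_of_iSupIndep_of_iSup_eq_top ?_ (iSup_regDeg Z)
  -- scaling by `4`
  let σ₀ : (Z → ℂ) →ₐ[ℂ] (Z → ℂ) :=
    { toFun := fun f z => f ⟨(4 : ℂ) • (z : E), hZ _ _ z.2⟩
      map_one' := rfl
      map_mul' := fun _ _ => rfl
      map_zero' := rfl
      map_add' := fun _ _ => rfl
      commutes' := fun _ => rfl }
  let τ : Module.End ℂ (Z → ℂ) := σ₀.toLinearMap
  have hpow : ∀ k : ℕ, (LinearMap.range (lin Z) ^ k).map (regFun Z).val.toLinearMap ≤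
      Module.End.eigenspace τ ((2 : ℂ) ^ (2 * (k : ℤ))) := by
    intro k
    rw [Submodule.map_pow]
    induction k with
    | zero =>
      rw [pow_zero, Submodule.one_le, Module.End.mem_eigenspace_iff]
      simp [τ]
    | succ k ih =>
      rw [pow_succ, Submodule.mul_le]
      intro f hf g hg
      obtain ⟨_, ⟨φ, rfl⟩, rfl⟩ := hg
      have h1 := Module.End.mem_eigenspace_iff.1 (ih hf)
      rw [Module.End.mem_eigenspace_iff]
      have h2 : τ ((regFun Z).val.toLinearMap (lin Z φ)) =
          (4 : ℂ) • (regFun Z).val.toLinearMap (lin Z φ) := by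
        funext z
        exact φ.map_smul 4 (z : E)
      have h3 : τ (f * (regFun Z).val.toLinearMap (lin Z φ)) =
        τ f * τ ((regFun Z).val.toLinearMap (lin Z φ)) := map_mul σ₀ _ _
      rw [h3, h1, h2, smul_mul_smul_comm]
      congr 1
      rw [show 2 * ((k + 1 : ℕ) : ℤ) = 2 * (k : ℤ) + 2 by push_cast; ring, zpow_add₀ two_ne_zero]
      norm_num
  have hle : ∀ n, (regDeg Z n).map (regFun Z).val.toLinearMap ≤
      Module.End.eigenspace τ ((2 : ℂ) ^ n) := by
    intro n
    simp only [regDeg, Submodule.map_iSup]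
    refine iSup₂_le ?_
    rintro k rfl
    exact hpow k
  have hinj : Function.Injective fun n : ℤ => (2 : ℂ) ^ n := by
    intro a b h
    have h' := congrArg norm h
    simp only [norm_zpow, Complex.norm_ofNat] at h'
    exact zpow_right_injective₀ (by norm_num) (by norm_num) h'
  have hind : iSupIndep fun n : ℤ => Module.End.eigenspace τ ((2 : ℂ) ^ n) :=
    (Module.End.eigenspaces_iSupIndep τ).comp hinj
  have hind' := hind.mono hle
  rw [iSupIndep_def] at hind' ⊢
  intro i
  rw [Submodule.disjoint_def]
  intro x hx hx'
  have h1 : (regFun Z).val.toLinearMap x ∈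
      ⨆ (j) (_ : j ≠ i), (regDeg Z j).map (regFun Z).val.toLinearMap := by
    simp only [← Submodule.map_iSup]
    exact Submodule.mem_map_of_mem hx'
  have h2 := Submodule.disjoint_def.1 (hind' i) _ (Submodule.mem_map_of_mem hx) h1
  exact Subtype.ext h2

/-- The ring of regular functions on a vector space is a graded algebra. -/
noncomputable instance : GradedAlgebra (regDeg (Set.univ : Set E)) where
  toDecomposition := (regDeg_internal (Z := Set.univ) (fun _ _ _ => Set.mem_univ _)).chooseDecomposition

/-- Pull-back of regular functions along a linear map `L : E → E'` with `L(Z) ⊆ Z'`. -/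
def pull {E' : Type u} [AddCommGroup E'] [Module ℂ E'] {Z : Set E} {Z' : Set E'} (L : E →ₗ[ℂ] E')
    (hL : ∀ z ∈ Z, L z ∈ Z') : regFun Z' →ₐ[ℂ] regFun Z where
  toFun f := ⟨fun z => f.1 ⟨L z, hL z z.2⟩, by
    obtain ⟨f, hf⟩ := f
    induction hf using Algebra.adjoin_induction with
    | mem x hx =>
      obtain ⟨φ, rfl⟩ := hx
      exact Algebra.subset_adjoin ⟨φ.comp L, rfl⟩
    | algebraMap r => exact (regFun Z).algebraMap_mem r
    | add x y hx hy h1 h2 => exact (regFun Z).add_mem h1 h2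
    | mul x y hx hy h1 h2 => exact (regFun Z).mul_mem h1 h2⟩
  map_one' := rfl
  map_mul' _ _ := rfl
  map_zero' := rfl
  map_add' _ _ := rfl
  commutes' _ := rfl

theorem pull_mem {E' : Type u} [AddCommGroup E'] [Module ℂ E'] {Z : Set E} {Z' : Set E'}
    (L : E →ₗ[ℂ] E') (hL : ∀ z ∈ Z, L z ∈ Z') {n : ℤ} {f : regFun Z'} (hf : f ∈ regDeg Z' n) :
    pull L hL f ∈ regDeg Z n := by
  have hle : (LinearMap.range (lin Z')).map (pull L hL).toLinearMap ≤ LinearMap.range (lin Z) := by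
    rintro _ ⟨_, ⟨φ, rfl⟩, rfl⟩
    exact ⟨φ.comp L, rfl⟩
  have : (regDeg Z' n).map (pull L hL).toLinearMap ≤ regDeg Z n := by
    simp only [regDeg, Submodule.map_iSup, Submodule.map_pow]
    exact iSup₂_le fun k hk => le_iSup₂_of_le k hk (pow_le_pow_left' hle k)
  exact this (Submodule.mem_map_of_mem hf)

end Cone

section Graph

variable {V : Type u} [AddCommGroup V] [Module ℂ V]

/-- The union `⋃_{x ∈ A} Gr(x)` of the reversed graphs `Gr(x) = {(x v, v) | v ∈ V}`. -/
def Gr (A : Set (V ≃ₗ[ℂ] V)) : Set (V × V) := {p | ∃ x ∈ A, p.1 = x p.2}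

theorem Gr_cone (A : Set (V ≃ₗ[ℂ] V)) : ∀ c : ℂ, ∀ z ∈ Gr A, c • z ∈ Gr A := by
  rintro c z ⟨x, hx, h⟩
  exact ⟨x, hx, by simp [h]⟩

/-- The graded bimodule `𝒪(A)` over `R = 𝒪(V)`: the ring of regular functions on
`⋃_{x ∈ A} Gr(x) ⊆ V × V`, on which `R` acts on the left through the first and on the right through
the second projection, `(f · a · g)(u, v) = f(u) a(u, v) g(v)`. -/
def bimod (A : Set (V ≃ₗ[ℂ] V)) : GrBimod (regDeg (Set.univ : Set V)) where
  carrier := regFun (Gr A)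
  lact := (Algebra.lmul ℂ (regFun (Gr A))).comp (pull (LinearMap.fst ℂ V V) fun _ _ => Set.mem_univ _)
  ract := (Algebra.lmul ℂ (regFun (Gr A))).comp (pull (LinearMap.snd ℂ V V) fun _ _ => Set.mem_univ _)
  act_comm r t m := mul_left_comm _ _ m
  deg := regDeg (Gr A)
  internal := regDeg_internal (Gr_cone A)
  lact_mem hr hm := SetLike.mul_mem_graded (pull_mem _ (fun _ _ => Set.mem_univ _) hr) hm
  ract_mem {i j r m} hr hm := by
    rw [add_comm]
    exact SetLike.mul_mem_graded (pull_mem _ (fun _ _ => Set.mem_univ _) hr) hm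

/-- The generator `𝒪(e, s)` of the category `𝓑_W`, `W = ⟨s⟩`. -/
abbrev genBimod (s : V ≃ₗ[ℂ] V) : GrBimod (regDeg (Set.univ : Set V)) := bimod {1, s}

end Graph

end RegFun

/-- The ring `A_W`, `W = ⟨s⟩`: the split Grothendieck ring of the category `𝓑_W` generated by
`𝒪(e, s)`. -/
abbrev AW {V : Type u} [AddCommGroup V] [Module ℂ V] (s : V ≃ₗ[ℂ] V) : Type (u + 1) :=
  GrBimod.GrothRing (RegFun.genBimod s)

/-! ## The presented algebra -/

namespace Pres

/-- The two generators. -/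
inductive Gen
  | s
  | C

/-- The free (noncommutative) `ℤ[v, v⁻¹]`-algebra on `s` and `C`. -/
abbrev Free := FreeAlgebra ℤ[T;T⁻¹] Gen

noncomputable def S : Free := FreeAlgebra.ι ℤ[T;T⁻¹] Gen.s
noncomputable def C : Free := FreeAlgebra.ι ℤ[T;T⁻¹] Gen.C

/-- `C_{d-1} = ∑_{i=0}^{⌊(d-1)/2⌋} binom(d-1-i, i) (-s)^i C^{d-1-2i}`. -/
noncomputable def Clast (d : ℕ) : Free :=
  ∑ i ∈ Finset.range ((d - 1) / 2 + 1), (d - 1 - i).choose i • ((-S) ^ i * C ^ (d - 1 - 2 * i))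

/-- The defining relations. -/
inductive Rel (d : ℕ) : Free → Free → Prop
  | s_pow : Rel d (S ^ d) 1
  | comm : Rel d (S * C) (C * S)
  | s_mul : Rel d (S * Clast d) (Clast d)
  | C_mul : Rel d (C * Clast d)
      ((LaurentPolynomial.T 1 + LaurentPolynomial.T (-1) : ℤ[T;T⁻¹]) • Clast d)

/-- The `ℤ[v, v⁻¹]`-algebra with generators `s`, `C` and the above relations. -/
abbrev Alg (d : ℕ) := RingQuot (Rel d)

/-- The quotient map from the free algebra. -/
noncomputable def mk (d : ℕ) : Free →ₐ[ℤ[T;T⁻¹]] Alg d := RingQuot.mkAlgHom ℤ[T;T⁻¹] (Rel d)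

end Pres

/-! In a coordinate `φ` on the line `V`, `s` is multiplication by some `ζ` with `ζ ^ k = 1` only
when `s ^ k = 1`. The graphs of the powers of `s` are lines `x = ζ ^ j y` in a plane, and the proof
takes place among the bimodules `𝒪(A)` for arcs `A = {sⁱ, …, sⁱ⁺ⁿ⁻¹}`.

Geometry gives the fusion rules. Tensoring with `𝒪(s)` rotates an arc. An element of `𝒪(e, s) ⊗
𝒪(A)` is a function on a fibre product of points `(x, t, y)`, which projects onto `Gr (A ∪ sA)` and
has two points over each nonzero point of `Gr (A ∩ sA)`. A linear form in `x, t, y` that vanishes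
away from `Gr (A ∩ sA)` and really involves `t` separates these two sheets, whence the tensor
product is `𝒪(A ∪ sA) ⊕ 𝒪(A ∩ sA)[-2]` (`FunModel.pair_tens`). For a proper arc the union is the arc
one longer and the intersection the arc one shorter (`fusion_arc`); for `A = W` both are `W`
(`fusion_zpowers`).

The degree-preserving endomorphisms of `𝒪(A)` are scalars, so a Krull–Schmidt argument
(`IsSum.of_summand`) shows that every object is a finite sum of shifts of arc bimodules
(`isSum_of_generated`). With the normalisation `vⁿ ⟨𝒪(sʲ, 0 ≤ j ≤ n)⟩` the fusion rule is the
recursion `C_{n+1} = C C_n - s C_{n-1}`, solved by the binomial sum; this gives the relations and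
the value of `C_{d-1}` (`Pres.relations_of_fusion`), and surjectivity.

For injectivity, the relations make the presented algebra spanned by the `sⁱ C_n` with `i < d`, `n <
d - 1`, together with `C_{d-1}` (`Pres.span_spanning`). Their images are, up to powers of `v`, the
classes of pairwise distinct nonempty arcs. These are independent: for an arc `A` with equation `p =
∏ (x - ζ ^ j y)`, counting generators of a given degree that lift to elements killed by `p` is
additive on direct sums, and on shifts of `𝒪(B)` it is nonzero only if `B ⊆ A`
(`exists_functional`). The resulting system is triangular for inclusion. -/

namespace GrBimod

/-! ### Morphisms, split summands and a Krull–Schmidt argument for graded bimodules. -/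

section Homs

variable {R : Type u} [CommRing R] [Algebra ℂ R] {𝓡 : ℤ → Submodule ℂ R}

/-- A bijective bimodule map sending each homogeneous component into the corresponding one is an
isomorphism of graded bimodules. -/
theorem equiv_of_bijective {M N : GrBimod 𝓡} (f : M →ₗ[ℂ] N) (hb : Function.Bijective f)
    (hl : ∀ r m, f (M.lact r m) = N.lact r (f m)) (hr : ∀ r m, f (M.ract r m) = N.ract r (f m))
    (hf : ∀ i, ∀ m ∈ M.deg i, f m ∈ N.deg i) : M ≈ N := by
  obtain ⟨D, hD⟩ := M.exists_coact
  obtain ⟨D', hD'⟩ := N.exists_coact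
  -- Since `f` commutes with taking homogeneous components, `f m` of degree `i` equals the image of
  -- the `i`-th component of `m`; injectivity then puts `m` itself in degree `i`.
  have h1 : D' ∘ₗ f = Finsupp.mapRange.linearMap f ∘ₗ D := by
    refine hom_ext M.iSup_deg fun i m hm => ?_
    simp [hD i m hm, hD' i _ (hf i m hm)]
  have h2 : ∀ i m, D m i ∈ M.deg i := by
    intro i m
    have : (⨆ j, M.deg j) ≤ (M.deg i).comap ((Finsupp.lapply i).comp D) := by
      refine iSup_le fun j x hx => ?_
      simp only [Submodule.mem_comap, LinearMap.comp_apply, hD j x hx, Finsupp.lapply_apply]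
      by_cases hij : j = i
      · subst hij; simpa using hx
      · simp [hij]
    rw [M.iSup_deg] at this
    exact this (x := m) trivial
  refine ⟨⟨LinearEquiv.ofBijective f hb, hl, hr, fun i m => ⟨hf i m, fun h => ?_⟩⟩⟩
  have h3 := LinearMap.congr_fun h1 m
  simp only [LinearMap.comp_apply] at h3
  have h4 : D' (f m) = Finsupp.single i (f m) := hD' i _ h
  rw [h4] at h3
  have h5 := DFunLike.congr_fun h3 i
  simp only [Finsupp.single_eq_same, Finsupp.mapRange.linearMap_apply, Finsupp.mapRange_apply] at h5
  rw [hb.1 h5]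
  exact h2 i m

/-- Morphisms of graded bimodules. -/
structure Hom (M N : GrBimod 𝓡) where
  toLin : M →ₗ[ℂ] N
  map_lact : ∀ r m, toLin (M.lact r m) = N.lact r (toLin m)
  map_ract : ∀ r m, toLin (M.ract r m) = N.ract r (toLin m)
  map_deg : ∀ i, ∀ m ∈ M.deg i, toLin m ∈ N.deg i

namespace Hom

def comp {M N P : GrBimod 𝓡} (g : Hom N P) (f : Hom M N) : Hom M P where
  toLin := g.toLin ∘ₗ f.toLin
  map_lact r m := by simp [f.map_lact, g.map_lact]
  map_ract r m := by simp [f.map_ract, g.map_ract]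
  map_deg i m hm := g.map_deg i _ (f.map_deg i m hm)

def smul {M N : GrBimod 𝓡} (c : ℂ) (f : Hom M N) : Hom M N where
  toLin := c • f.toLin
  map_lact r m := by simp [f.map_lact]
  map_ract r m := by simp [f.map_ract]
  map_deg i m hm := Submodule.smul_mem _ _ (f.map_deg i m hm)

def sumFst (M N : GrBimod 𝓡) : Hom (M.sum N) M :=
  ⟨fst M N, fun _ _ => rfl, fun _ _ => rfl, fun _ _ hm => hm.1⟩

def sumSnd (M N : GrBimod 𝓡) : Hom (M.sum N) N :=
  ⟨snd M N, fun _ _ => rfl, fun _ _ => rfl, fun _ _ hm => hm.2⟩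

def sumInl (M N : GrBimod 𝓡) : Hom M (M.sum N) :=
  ⟨inl M N, fun r m => (lact_inl r m).symm, fun r m => (ract_inl r m).symm,
    fun _ _ hm => ⟨hm, zero_mem _⟩⟩

def sumInr (M N : GrBimod 𝓡) : Hom N (M.sum N) :=
  ⟨inr M N, fun r m => (lact_inr r m).symm, fun r m => (ract_inr r m).symm,
    fun _ _ hm => ⟨zero_mem _, hm⟩⟩

end Hom

def Iso.hom {M N : GrBimod 𝓡} (f : Iso M N) : Hom M N :=
  ⟨f.e.toLinearMap, f.map_lact, f.map_ract, fun i m hm => (f.map_deg i m).1 hm⟩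

/-- The kernel of a split epimorphism `b`, with section `a`. -/
def splitKer {M X : GrBimod 𝓡} (a : Hom X M) (b : Hom M X)
    (hab : ∀ x, b.toLin (a.toLin x) = x) : GrBimod 𝓡 where
  carrier := LinearMap.ker b.toLin
  lact := AlgHom.ofLinearMap
    (LinearMap.mk (AddHom.mk (fun r => (M.lact r).restrict (p := LinearMap.ker b.toLin)
      (q := LinearMap.ker b.toLin) (fun m hm => by
        rw [LinearMap.mem_ker] at hm ⊢; rw [b.map_lact, hm, map_zero]))
      (fun r t => by ext; simp)) (fun c r => by ext; simp))
    (by ext; simp) (fun r t => by ext; simp)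
  ract := AlgHom.ofLinearMap
    (LinearMap.mk (AddHom.mk (fun r => (M.ract r).restrict (p := LinearMap.ker b.toLin)
      (q := LinearMap.ker b.toLin) (fun m hm => by
        rw [LinearMap.mem_ker] at hm ⊢; rw [b.map_ract, hm, map_zero]))
      (fun r t => by ext; simp)) (fun c r => by ext; simp))
    (by ext; simp) (fun r t => by ext; simp)
  act_comm r t m := Subtype.ext (M.act_comm r t m)
  deg i := (M.deg i).comap (LinearMap.ker b.toLin).subtype
  internal := by
    obtain ⟨D, hD⟩ := M.exists_coact
    -- The degree-preserving projection onto the kernel along the image of `a`; it transports the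
    -- grading of `M` to the kernel.
    let π : M →ₗ[ℂ] LinearMap.ker b.toLin :=
      LinearMap.codRestrict _ (LinearMap.id - a.toLin ∘ₗ b.toLin) (fun m => by simp [hab])
    have hπ : ∀ m : LinearMap.ker b.toLin, π m = m := fun m => by
      ext
      have := m.2
      rw [LinearMap.mem_ker] at this
      simp [π, this]
    refine isInternal_of_coact ?_
      (Finsupp.mapRange.linearMap π ∘ₗ D ∘ₗ (LinearMap.ker b.toLin).subtype) ?_
    · rw [eq_top_iff]
      intro m _
      have h : (⨆ i, M.deg i) ≤
          (⨆ i, (M.deg i).comap (LinearMap.ker b.toLin).subtype).comap π := by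
        refine iSup_le fun i x hx => Submodule.mem_iSup_of_mem i ?_
        exact Submodule.sub_mem _ hx (a.map_deg i _ (b.map_deg i x hx))
      rw [M.iSup_deg] at h
      rw [← hπ m]
      exact h (x := (m : M)) trivial
    · intro i m hm
      have : D (m : M) = Finsupp.single i (m : M) := hD i _ hm
      simp [this, hπ]
  lact_mem hr hm := M.lact_mem hr hm
  ract_mem hr hm := M.ract_mem hr hm

section SplitKer

variable {M X : GrBimod 𝓡} (a : Hom X M) (b : Hom M X) (hab : ∀ x, b.toLin (a.toLin x) = x)

/-- The inclusion of the kernel. -/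
def splitKerι : Hom (splitKer a b hab) M :=
  ⟨(LinearMap.ker b.toLin).subtype, fun _ _ => rfl, fun _ _ => rfl, fun _ _ hm => hm⟩

theorem splitKerι_injective : Function.Injective (splitKerι a b hab).toLin :=
  (LinearMap.ker b.toLin).injective_subtype

theorem apply_splitKerι (m : splitKer a b hab) : b.toLin ((splitKerι a b hab).toLin m) = 0 :=
  LinearMap.mem_ker.1 m.2

theorem exists_splitKerι {m : M} (hm : b.toLin m = 0) :
    ∃ m' : splitKer a b hab, (splitKerι a b hab).toLin m' = m := ⟨⟨m, hm⟩, rfl⟩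

theorem sum_splitKer : X.sum (splitKer a b hab) ≈ M := by
  refine equiv_of_bijective (a.toLin ∘ₗ fst _ _ + (splitKerι a b hab).toLin ∘ₗ snd _ _)
    ⟨?_, ?_⟩ ?_ ?_ ?_
  · rw [← LinearMap.ker_eq_bot, LinearMap.ker_eq_bot']
    intro x hx
    simp only [LinearMap.add_apply, LinearMap.comp_apply] at hx
    have h1 : fst _ _ x = 0 := by
      simpa [hab, apply_splitKerι] using congrArg b.toLin hx
    rw [h1, map_zero, zero_add] at hx
    exact sum_ext h1 (splitKerι_injective a b hab (by rw [hx]; simp))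
  · intro m
    obtain ⟨m', hm'⟩ := exists_splitKerι a b hab (m := m - a.toLin (b.toLin m)) (by simp [hab])
    refine ⟨inl _ _ (b.toLin m) + inr _ _ m', ?_⟩
    simp [hm']
  · intro r x
    simp [a.map_lact, (splitKerι a b hab).map_lact]
  · intro r x
    simp [a.map_ract, (splitKerι a b hab).map_ract]
  · intro i x hx
    exact Submodule.add_mem _ (a.map_deg i _ hx.1) ((splitKerι a b hab).map_deg i _ hx.2)

end SplitKer

theorem sum_comm (M N : GrBimod 𝓡) : M.sum N ≈ N.sum M :=
  ⟨⟨LinearEquiv.prodComm ℂ M N, fun _ _ => rfl, fun _ _ => rfl, fun _ _ => and_comm⟩⟩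

theorem sum_assoc (M N P : GrBimod 𝓡) : (M.sum N).sum P ≈ M.sum (N.sum P) :=
  ⟨⟨LinearEquiv.prodAssoc ℂ M N P, fun _ _ => rfl, fun _ _ => rfl, fun _ _ => and_assoc⟩⟩

theorem sum_congr {M N M' N' : GrBimod 𝓡} (hM : M ≈ M') (hN : N ≈ N') :
    M.sum N ≈ M'.sum N' := by
  obtain ⟨f⟩ := hM
  obtain ⟨g⟩ := hN
  exact ⟨⟨f.e.prodCongr g.e, fun r m => Prod.ext (f.map_lact r _) (g.map_lact r _),
    fun r m => Prod.ext (f.map_ract r _) (g.map_ract r _),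
    fun i m => and_congr (f.map_deg i _) (g.map_deg i _)⟩⟩

theorem sum_shift (M N : GrBimod 𝓡) (k : ℤ) : (M.sum N).shift k ≈ (M.shift k).sum (N.shift k) :=
  ⟨⟨LinearEquiv.refl ℂ (M × N), fun _ _ => rfl, fun _ _ => rfl, fun _ _ => Iff.rfl⟩⟩

theorem sum_subsingleton (M : GrBimod 𝓡) {N : GrBimod 𝓡} (hN : Subsingleton N) : M.sum N ≈ M :=
  equiv_of_bijective (fst M N)
    ⟨fun _ _ h => sum_ext h (Subsingleton.elim _ _), fun m => ⟨inl M N m, rfl⟩⟩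
    (fun _ _ => rfl) (fun _ _ => rfl) (fun _ _ h => h.1)

/-- Exchange: if `X` splits off `N` compatibly with a decomposition `N ⊕ P ≅ X ⊕ Q`, then the
complement of `X` can be cancelled. -/
theorem exchange {N P X Q : GrBimod 𝓡} (φ : Iso (X.sum Q) (N.sum P)) (a : Hom X N) (b : Hom N X)
    (ha : ∀ x, a.toLin x = fst N P (φ.e (inl X Q x))) (hab : ∀ x, b.toLin (a.toLin x) = x) :
    Q ≈ (splitKer a b hab).sum P := by
  have hab' : ∀ x, b.toLin (fst N P (φ.e (inl X Q x))) = x := fun x => by rw [← ha, hab]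
  -- Inside `N ⊕ P`, the subobject `ker b ⊕ P` is the kernel of `b ∘ fst`, which maps `φ(X)`
  -- isomorphically to `X`. So `ker b ⊕ P` and `φ(Q)` are both complements of `φ(X)`, and projecting
  -- along `φ(X)` identifies them.
  refine Setoid.symm (equiv_of_bijective (snd X Q ∘ₗ φ.e.symm.toLinearMap ∘ₗ
    (inl N P ∘ₗ (splitKerι a b hab).toLin ∘ₗ fst _ _ + inr N P ∘ₗ snd _ _)) ⟨?_, ?_⟩ ?_ ?_ ?_)
  · rw [← LinearMap.ker_eq_bot, LinearMap.ker_eq_bot']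
    intro y hy
    simp only [LinearMap.add_apply, LinearMap.comp_apply, LinearEquiv.coe_coe] at hy
    set z := φ.e.symm (inl N P ((splitKerι a b hab).toLin (fst _ _ y)) + inr N P (snd _ _ y))
      with hz
    have h1 : φ.e z = inl N P ((splitKerι a b hab).toLin (fst _ _ y)) + inr N P (snd _ _ y) := by
      rw [hz, LinearEquiv.apply_symm_apply]
    have h2 : z = inl X Q (fst X Q z) := sum_ext (by simp) (by simp [hy])
    have h3 : fst X Q z = 0 := by
      rw [← hab' (fst X Q z), ← h2, h1]
      simp [apply_splitKerι]
    rw [h2, h3, map_zero, map_zero] at h1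
    have h4 := congrArg (fst N P) h1
    have h5 := congrArg (snd N P) h1
    simp only [map_zero, map_add, fst_inl, fst_inr, add_zero, snd_inl, snd_inr, zero_add] at h4 h5
    refine sum_ext (splitKerι_injective a b hab ?_) ?_
    · rw [← h4]; simp
    · rw [← h5]; simp
  · intro q
    set w := φ.e (inr X Q q) with hw
    set x := b.toLin (fst N P w) with hx
    set y := w - φ.e (inl X Q x) with hy
    obtain ⟨n, hn⟩ := exists_splitKerι a b hab (m := fst N P y) (by
      rw [hy, map_sub, map_sub, hab', sub_self])
    refine ⟨inl _ _ n + inr _ _ (snd N P y), ?_⟩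
    simp only [LinearMap.add_apply, LinearMap.comp_apply, LinearEquiv.coe_coe, map_add, fst_inl,
      fst_inr, add_zero, snd_inl, snd_inr, zero_add, map_zero, hn]
    rw [← map_add, ← map_add, inl_fst_add, hy, map_sub, hw]
    simp
  · intro r y
    simp only [LinearMap.add_apply, LinearMap.comp_apply, LinearEquiv.coe_coe, fst_lact, snd_lact,
      (splitKerι a b hab).map_lact, ← lact_inl, ← lact_inr, ← map_add]
    exact congrArg (snd X Q) (φ.symm.map_lact r _)
  · intro r y
    simp only [LinearMap.add_apply, LinearMap.comp_apply, LinearEquiv.coe_coe, fst_ract, snd_ract,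
      (splitKerι a b hab).map_ract, ← ract_inl, ← ract_inr, ← map_add]
    exact congrArg (snd X Q) (φ.symm.map_ract r _)
  · intro i y hy
    refine (Hom.sumSnd X Q).map_deg i _ ((φ.symm.map_deg i _).1 (Submodule.add_mem _ ?_ ?_))
    · exact (Hom.sumInl N P).map_deg i _ ((splitKerι a b hab).map_deg i _ hy.1)
    · exact (Hom.sumInr N P).map_deg i _ hy.2

/-- Finite direct sums of objects satisfying `S`. -/
inductive IsSum (S : GrBimod 𝓡 → Prop) : GrBimod 𝓡 → Prop
  | zero {M : GrBimod 𝓡} : Subsingleton M → IsSum S M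
  | cons {X M N : GrBimod 𝓡} : S X → IsSum S M → N ≈ X.sum M → IsSum S N

namespace IsSum

variable {S : GrBimod 𝓡 → Prop}

theorem congr {M N : GrBimod 𝓡} (hM : IsSum S M) (h : N ≈ M) : IsSum S N := by
  cases hM with
  | zero h0 =>
    obtain ⟨f⟩ := h
    exact zero f.e.toEquiv.subsingleton
  | cons hX hM h1 => exact cons hX hM (Setoid.trans h h1)

theorem single {X : GrBimod 𝓡} (hX : S X) {Z : GrBimod 𝓡} (hZ : Subsingleton Z) : IsSum S X :=
  cons hX (zero hZ) (Setoid.symm (sum_subsingleton X hZ))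

theorem sum {M N : GrBimod 𝓡} (hM : IsSum S M) (hN : IsSum S N) : IsSum S (M.sum N) := by
  induction hM with
  | zero h0 => exact hN.congr (Setoid.trans (sum_comm _ _) (sum_subsingleton _ h0))
  | cons hX hM h1 ih =>
    exact cons hX ih (Setoid.trans (sum_congr h1 (Setoid.refl _)) (sum_assoc _ _ _))

theorem shift {M : GrBimod 𝓡} (hS : ∀ X k, S X → S (X.shift k)) (hM : IsSum S M) (k : ℤ) :
    IsSum S (M.shift k) := by
  induction hM with
  | zero h0 => exact zero h0
  | cons hX hM h1 ih =>
    exact cons (hS _ k hX) ih (Setoid.trans (shift_congr h1 k) (sum_shift _ _ _))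

/-- Krull–Schmidt: if the objects satisfying `S` are nonzero with scalar endomorphisms only, direct
summands of finite direct sums of such objects are again of this form. -/
theorem of_summand (hS : ∀ X, S X → Nontrivial X)
    (hE : ∀ X, S X → ∀ f : Hom X X, ∃ c : ℂ, ∀ x, f.toLin x = c • x)
    {M : GrBimod 𝓡} (hM : IsSum S M) :
    ∀ {N P : GrBimod 𝓡}, M ≈ N.sum P → IsSum S N ∧ IsSum S P := by
  induction hM with
  | zero h0 =>
    intro N P h
    obtain ⟨φ⟩ := h
    have h1 : Subsingleton (N.sum P) := φ.e.symm.toEquiv.subsingleton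
    refine ⟨zero ⟨fun x y => ?_⟩, zero ⟨fun x y => ?_⟩⟩
    · simpa using congrArg (fst N P) (Subsingleton.elim (inl N P x) (inl N P y))
    · simpa using congrArg (snd N P) (Subsingleton.elim (inr N P x) (inr N P y))
  | @cons X Q M hX hQ hM ih =>
    -- If the composite `X → N → X` is a nonzero scalar, dividing by it splits `X` off `N`. By
    -- `exchange` the rest of `N` together with `P` is then a decomposition of `Q`, to which the
    -- induction hypothesis applies.
    have key : ∀ {N P : GrBimod 𝓡} (φ : Iso (X.sum Q) (N.sum P)) (c : ℂ), c ≠ 0 →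
        (∀ x, fst X Q (φ.e.symm (inl N P (fst N P (φ.e (inl X Q x))))) = c • x) →
        IsSum S N ∧ IsSum S P := by
      intro N P φ c hc h
      let a : Hom X N := (Hom.sumFst N P).comp (φ.hom.comp (Hom.sumInl X Q))
      let b : Hom N X := ((Hom.sumFst X Q).comp (φ.symm.hom.comp (Hom.sumInl N P))).smul c⁻¹
      have hb : ∀ n, b.toLin n = c⁻¹ • fst X Q (φ.e.symm (inl N P n)) := fun _ => rfl
      have hab : ∀ x, b.toLin (a.toLin x) = x := fun x => by
        rw [hb]
        change c⁻¹ • fst X Q (φ.e.symm (inl N P (fst N P (φ.e (inl X Q x))))) = x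
        rw [h, smul_smul, inv_mul_cancel₀ hc, one_smul]
      obtain ⟨h1, h2⟩ := ih (exchange φ a b (fun _ => rfl) hab)
      exact ⟨cons hX h1 (Setoid.symm (sum_splitKer _ b hab)), h2⟩
    intro N P h
    obtain ⟨ψ⟩ := Setoid.trans (Setoid.symm hM) h
    obtain ⟨c, hc⟩ := hE X hX ((Hom.sumFst X Q).comp (ψ.symm.hom.comp ((Hom.sumInl N P).comp
      ((Hom.sumFst N P).comp (ψ.hom.comp (Hom.sumInl X Q))))))
    obtain ⟨c', hc'⟩ := hE X hX ((Hom.sumFst X Q).comp (ψ.symm.hom.comp ((Hom.sumInr N P).comp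
      ((Hom.sumSnd N P).comp (ψ.hom.comp (Hom.sumInl X Q))))))
    -- The endomorphisms of `X` through `N` and through `P` add up to the identity, so for `X ≠ 0`
    -- one of the two scalars is nonzero; if only the second is, the roles of `N` and `P` are
    -- exchanged.
    have hcc : ∀ x : X, (c + c') • x = x := fun x => by
      rw [add_smul, ← hc, ← hc']
      change fst X Q (ψ.e.symm (inl N P (fst N P (ψ.e (inl X Q x))))) +
        fst X Q (ψ.e.symm (inr N P (snd N P (ψ.e (inl X Q x))))) = x
      rw [← map_add, ← map_add, inl_fst_add]
      simp
    by_cases h0 : c = 0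
    · have h1 : c' ≠ 0 := by
        rintro rfl
        have := hS X hX
        obtain ⟨x, hx⟩ := exists_ne (0 : X)
        have := hcc x
        rw [h0, add_zero, zero_smul] at this
        exact hx this.symm
      let τ : Iso (N.sum P) (P.sum N) :=
        ⟨LinearEquiv.prodComm ℂ N P, fun _ _ => rfl, fun _ _ => rfl, fun _ _ => and_comm⟩
      exact (key (ψ.trans τ) c' h1 hc').symm
    · exact key ψ c h0 hc

end IsSum

end Homs

end GrBimod

namespace GrBimod

/-! ### Additive numerical invariants of graded bimodules. -/

section Invariants

variable {R : Type u} [CommRing R] [Algebra ℂ R] {𝓡 : ℤ → Submodule ℂ R}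

/-- The action of `R ⊗ R` on a bimodule. -/
noncomputable def act (M : GrBimod 𝓡) : R ⊗[ℂ] R →ₐ[ℂ] Module.End ℂ M :=
  Algebra.TensorProduct.lift M.lact M.ract (fun r t => LinearMap.ext (M.act_comm r t))

theorem act_tmul (M : GrBimod 𝓡) (r t : R) : M.act (r ⊗ₜ t) = M.lact r * M.ract t :=
  Algebra.TensorProduct.lift_tmul _ _ _ _ _

theorem Hom.map_act {M N : GrBimod 𝓡} (f : Hom M N) (p : R ⊗[ℂ] R) (m : M) :
    f.toLin (M.act p m) = N.act p (f.toLin m) := by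
  induction p using TensorProduct.induction_on with
  | zero => simp
  | tmul r t => simp [act_tmul, f.map_lact, f.map_ract]
  | add p q hp hq => simp [hp, hq]

/-- The submodule `X M + M X`. -/
def rad (X : R) (M : GrBimod 𝓡) : Submodule ℂ M :=
  LinearMap.range (M.lact X) ⊔ LinearMap.range (M.ract X)

theorem Hom.map_rad {M N : GrBimod 𝓡} (f : Hom M N) (X : R) :
    rad X M ≤ (rad X N).comap f.toLin := by
  refine sup_le ?_ ?_
  · rintro _ ⟨m, rfl⟩
    exact Submodule.mem_sup_left ⟨f.toLin m, (f.map_lact X m).symm⟩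
  · rintro _ ⟨m, rfl⟩
    exact Submodule.mem_sup_right ⟨f.toLin m, (f.map_ract X m).symm⟩

/-- The elements of degree `k` annihilated by `p`. -/
noncomputable def ann (p : R ⊗[ℂ] R) (k : ℤ) (M : GrBimod 𝓡) : Submodule ℂ M :=
  M.deg k ⊓ LinearMap.ker (M.act p)

theorem Hom.map_ann {M N : GrBimod 𝓡} (f : Hom M N) (p : R ⊗[ℂ] R) (k : ℤ) :
    ann p k M ≤ (ann p k N).comap f.toLin := by
  rintro m ⟨h1, h2⟩
  refine ⟨f.map_deg k m h1, ?_⟩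
  rw [SetLike.mem_coe, LinearMap.mem_ker] at h2 ⊢
  rw [← f.map_act, h2, map_zero]

/-- The dimension of the space of generators of degree `k` (elements modulo `X M + M X`) which can
be lifted to elements annihilated by `p`. -/
noncomputable def inv (p : R ⊗[ℂ] R) (X : R) (k : ℤ) (M : GrBimod 𝓡) : ℤ :=
  Module.finrank ℂ (ann p k M) - Module.finrank ℂ (ann p k M ⊓ rad X M : Submodule ℂ M)

theorem inv_congr (p : R ⊗[ℂ] R) (X : R) (k : ℤ) {M N : GrBimod 𝓡} (h : M ≈ N) :
    inv p X k M = inv p X k N := by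
  obtain ⟨f⟩ := h
  have h1 : (ann p k M).map f.e.toLinearMap = ann p k N := by
    refine le_antisymm (Submodule.map_le_iff_le_comap.2 (f.hom.map_ann p k)) fun n hn => ?_
    exact ⟨f.e.symm n, f.symm.hom.map_ann p k hn, f.e.apply_symm_apply n⟩
  have h2 : (rad X M).map f.e.toLinearMap = rad X N := by
    refine le_antisymm (Submodule.map_le_iff_le_comap.2 (f.hom.map_rad X)) fun n hn => ?_
    exact ⟨f.e.symm n, f.symm.hom.map_rad X hn, f.e.apply_symm_apply n⟩
  have h3 : (ann p k M ⊓ rad X M).map f.e.toLinearMap = ann p k N ⊓ rad X N := by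
    rw [Submodule.map_inf _ f.e.injective, h1, h2]
  rw [inv, inv, ← h3, ← h1]
  congr 2
  · exact (LinearEquiv.finrank_map_eq f.e _).symm
  · exact (LinearEquiv.finrank_map_eq f.e _).symm

theorem finrank_submodule_sum {M N : GrBimod 𝓡} (A : Submodule ℂ (M.sum N)) (p : Submodule ℂ M)
    (q : Submodule ℂ N) [FiniteDimensional ℂ p] [FiniteDimensional ℂ q]
    (hA : ∀ x, x ∈ A ↔ fst M N x ∈ p ∧ snd M N x ∈ q) :
    Module.finrank ℂ A = Module.finrank ℂ p + Module.finrank ℂ q := by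
  let e : A ≃ₗ[ℂ] p × q :=
    { toFun := fun x => (⟨fst M N x, ((hA x).1 x.2).1⟩, ⟨snd M N x, ((hA x).1 x.2).2⟩)
      invFun := fun y => ⟨inl M N y.1 + inr M N y.2, (hA _).2 (by simp)⟩
      map_add' := fun _ _ => rfl
      map_smul' := fun _ _ => rfl
      left_inv := fun x => Subtype.ext (inl_fst_add (x : M.sum N))
      right_inv := fun y => Prod.ext (Subtype.ext (by simp)) (Subtype.ext (by simp)) }
  rw [e.finrank_eq, Module.finrank_prod]

theorem mem_ann_sum {p : R ⊗[ℂ] R} {k : ℤ} {M N : GrBimod 𝓡} (x : M.sum N) :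
    x ∈ ann p k (M.sum N) ↔ fst M N x ∈ ann p k M ∧ snd M N x ∈ ann p k N := by
  refine ⟨fun hx => ⟨(Hom.sumFst M N).map_ann p k hx, (Hom.sumSnd M N).map_ann p k hx⟩,
    fun hx => ?_⟩
  rw [← inl_fst_add x]
  exact Submodule.add_mem _ ((Hom.sumInl M N).map_ann p k hx.1)
    ((Hom.sumInr M N).map_ann p k hx.2)

theorem mem_rad_sum {X : R} {M N : GrBimod 𝓡} (x : M.sum N) :
    x ∈ rad X (M.sum N) ↔ fst M N x ∈ rad X M ∧ snd M N x ∈ rad X N := by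
  refine ⟨fun hx => ⟨(Hom.sumFst M N).map_rad X hx, (Hom.sumSnd M N).map_rad X hx⟩,
    fun hx => ?_⟩
  rw [← inl_fst_add x]
  exact Submodule.add_mem _ ((Hom.sumInl M N).map_rad X hx.1)
    ((Hom.sumInr M N).map_rad X hx.2)

/-- Both `ann` and `rad` are preserved by the inclusions and projections of a direct sum, hence
split. Finiteness of the degree `k` parts is needed because `finrank` is `0` on infinite-dimensional
spaces. -/
theorem inv_sum (p : R ⊗[ℂ] R) (X : R) (k : ℤ) (M N : GrBimod 𝓡)
    [FiniteDimensional ℂ (M.deg k)] [FiniteDimensional ℂ (N.deg k)] :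
    inv p X k (M.sum N) = inv p X k M + inv p X k N := by
  have : FiniteDimensional ℂ (ann p k M) := Submodule.finiteDimensional_of_le inf_le_left
  have : FiniteDimensional ℂ (ann p k N) := Submodule.finiteDimensional_of_le inf_le_left
  have : FiniteDimensional ℂ (ann p k M ⊓ rad X M : Submodule ℂ M) :=
    Submodule.finiteDimensional_of_le inf_le_left
  have : FiniteDimensional ℂ (ann p k N ⊓ rad X N : Submodule ℂ N) :=
    Submodule.finiteDimensional_of_le inf_le_left
  rw [inv, inv, inv, finrank_submodule_sum _ _ _ (mem_ann_sum (p := p) (k := k)),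
    finrank_submodule_sum _ (ann p k M ⊓ rad X M) (ann p k N ⊓ rad X N) (fun x => by
      rw [Submodule.mem_inf, mem_ann_sum, mem_rad_sum, Submodule.mem_inf, Submodule.mem_inf]
      tauto)]
  push_cast
  ring

theorem IsSum.finiteDimensional_deg {S : GrBimod 𝓡 → Prop}
    (hS : ∀ X, S X → ∀ k, FiniteDimensional ℂ (X.deg k)) {M : GrBimod 𝓡} (hM : IsSum S M) (k : ℤ) :
    FiniteDimensional ℂ (M.deg k) := by
  induction hM with
  | @zero M h =>
    have : FiniteDimensional ℂ M := Module.Finite.of_finite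
    infer_instance
  | @cons X M N hX _ h ih =>
    obtain ⟨f⟩ := h
    have := hS X hX k
    let g : N.deg k →ₗ[ℂ] (X.deg k × M.deg k) :=
      { toFun := fun n => (⟨fst X M (f.e n), ((f.map_deg k _).1 n.2).1⟩,
          ⟨snd X M (f.e n), ((f.map_deg k _).1 n.2).2⟩)
        map_add' := fun x y => Prod.ext (Subtype.ext (by simp)) (Subtype.ext (by simp))
        map_smul' := fun c x => Prod.ext (Subtype.ext (by simp)) (Subtype.ext (by simp)) }
    refine FiniteDimensional.of_injective g fun x y hxy => Subtype.ext (f.e.injective ?_)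
    exact sum_ext (congrArg (fun z => (z.1 : X)) hxy) (congrArg (fun z => (z.2 : M)) hxy)

end Invariants

/-! ### Additive functions on the Grothendieck ring, and the objects of the generated category. -/

section Groth

variable {R : Type u} [CommRing R] [Algebra ℂ R] {𝓡 : ℤ → Submodule ℂ R} [GradedAlgebra 𝓡]
  {G : GrBimod 𝓡}

theorem exists_addHom (μ : GrBimod 𝓡 → ℤ) (hiso : ∀ M N : GrBimod 𝓡, M ≈ N → μ M = μ N)
    (hsum : ∀ M N, Generated G M → Generated G N → μ (M.sum N) = μ M + μ N) :
    ∃ f : GrothRing G →+ ℤ, ∀ M (hM : Generated G M), f (cls M hM) = μ M := by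
  let f₀ : FreeAbelianGroup (IsoClass G) →+ ℤ :=
    FreeAbelianGroup.lift (Quotient.lift (fun M => μ M.1) (fun M N h => hiso _ _ h))
  have h₀ : ∀ M (hM : Generated G M), f₀ (FreeAbelianGroup.of (isoClass M hM)) = μ M :=
    fun M hM => FreeAbelianGroup.lift_apply_of _ _
  have h : splitRel G ≤ f₀.ker := by
    rw [splitRel, AddSubgroup.closure_le]
    rintro _ ⟨M, N, hM, hN, rfl⟩
    rw [SetLike.mem_coe, AddMonoidHom.mem_ker, map_sub, map_sub, h₀, h₀, h₀, hsum M N hM hN]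
    ring
  exact ⟨QuotientAddGroup.lift (splitRel G) f₀ h, fun M hM => h₀ M hM⟩

/-- Closure under isomorphism is the case of `summand` with zero complement; the zero bimodule is
obtained as the kernel of the identity of `R`. -/
theorem Generated.congr {M N : GrBimod 𝓡} (hM : Generated G M) (h : M ≈ N) : Generated G N := by
  have h0 : Subsingleton (splitKer (M := regular 𝓡) (Iso.refl _).hom (Iso.refl _).hom
    (fun _ => rfl)) := ⟨fun x y => by
      have hx := apply_splitKerι _ _ _ x
      have hy := apply_splitKerι _ _ _ y
      exact splitKerι_injective _ _ _ (hx.trans hy.symm)⟩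
  exact hM.summand (Setoid.trans h (Setoid.symm (sum_subsingleton N h0)))

theorem Generated.of_subsingleton {M : GrBimod 𝓡} (hM : Subsingleton M) : Generated G M :=
  Generated.unit.summand (Setoid.symm (Setoid.trans (sum_comm M (regular 𝓡))
    (sum_subsingleton _ hM)))

theorem Generated.of_sum_left {M N P : GrBimod 𝓡} (hM : Generated G M) (h : M ≈ N.sum P) :
    Generated G N := hM.summand h

theorem Generated.of_sum_right {M N P : GrBimod 𝓡} (hM : Generated G M) (h : M ≈ N.sum P) :
    Generated G P := hM.summand (Setoid.trans h (sum_comm N P))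

theorem Generated.of_shift {M : GrBimod 𝓡} {k : ℤ} (hM : Generated G (M.shift k)) :
    Generated G M :=
  (hM.shift (-k)).congr (Setoid.trans (shift_shift M k (-k)) (by
    rw [add_neg_cancel]; exact shift_zero M))

theorem cls_eq_zero {M : GrBimod 𝓡} (hM : Generated G M) (h : Subsingleton M) :
    cls M hM = 0 := by
  have h1 := cls_sum hM hM
  rw [cls_eq (hN := hM) (sum_subsingleton M h)] at h1
  simpa using h1

theorem cls_of_sum {M N P : GrBimod 𝓡} (hM : Generated G M) (hN : Generated G N)
    (hP : Generated G P) (h : M ≈ N.sum P) : cls M hM = cls N hN + cls P hP := by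
  rw [← cls_sum, cls_eq h]

/-- If the finite sums of objects satisfying `S` are stable by tensoring with `G` on the left, and
by direct summands, then all objects of the category generated by `G` are such sums. -/
theorem Generated.isSum {S : GrBimod 𝓡 → Prop} (hshift : ∀ X k, S X → S (X.shift k))
    (hunit : IsSum S (regular 𝓡)) (hG : ∀ X, S X → IsSum S (G.tens X))
    (hsummand : ∀ {M N P : GrBimod 𝓡}, IsSum S M → M ≈ N.sum P → IsSum S N)
    {M : GrBimod 𝓡} (hM : Generated G M) : IsSum S M := by
  -- Strengthened so that tensor products can be treated by associativity: `(M ⊗ M') ⊗ N` is handled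
  -- by applying `M'` and then `M`. Only left multiplication by the generator has to be known.
  suffices ∀ N, IsSum S N → IsSum S (M.tens N) from
    (this _ hunit).congr (Setoid.symm (tens_regular M))
  induction hM with
  | gen =>
    intro N hN
    induction hN with
    | @zero N h0 =>
      refine IsSum.zero ⟨fun x y => ?_⟩
      have : (LinearMap.id : G.tens N →ₗ[ℂ] G.tens N) = 0 := ext_tm fun m n => by
        rw [Subsingleton.elim n 0, map_zero, map_zero, map_zero]
      rw [← LinearMap.id_apply (R := ℂ) x, ← LinearMap.id_apply (R := ℂ) y, this]
      rfl
    | cons hX hQ h ih =>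
      exact ((hG _ hX).sum ih).congr
        (Setoid.trans (tens_congr (Setoid.refl _) h) (tens_sum _ _ _))
  | unit => exact fun N hN => hN.congr (regular_tens N)
  | shift k _ ih => exact fun N hN => ((ih N hN).shift hshift k).congr (shift_tens _ _ _)
  | sum _ _ h1 h2 => exact fun N hN => ((h1 N hN).sum (h2 N hN)).congr (sum_tens _ _ _)
  | tens _ _ h1 h2 => exact fun N hN => (h1 _ (h2 N hN)).congr (tens_assoc _ _ _)
  | summand _ h ih =>
    exact fun N hN => hsummand (ih N hN)
      (Setoid.trans (tens_congr h (Setoid.refl _)) (sum_tens _ _ _))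

end Groth

end GrBimod

theorem GrBimod.eq_top_of_tm {R : Type u} [CommRing R] [Algebra ℂ R] {𝓡 : ℤ → Submodule ℂ R}
    [GradedAlgebra 𝓡] {M N : GrBimod 𝓡} {K : Submodule ℂ (M.tens N)}
    (h : ∀ m n, GrBimod.tm M N m n ∈ K) : K = ⊤ := by
  rw [← Submodule.ker_mkQ K, LinearMap.ker_eq_top]
  refine ext_tm fun m n => ?_
  rw [Submodule.mkQ_apply, LinearMap.zero_apply, Submodule.Quotient.mk_eq_zero]
  exact h m n

/-! ### The bimodules `𝒪(A)`: generation by `1`, degrees and endomorphisms. -/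

namespace RegFun

open GrBimod

variable {V : Type u} [AddCommGroup V] [Module ℂ V]

/-- The ring `𝒪(V)`. -/
abbrev coordRing (V : Type u) [AddCommGroup V] [Module ℂ V] : Type u :=
  regFun (Set.univ : Set V)

/-- The value of `f ∈ 𝒪(V)` at a point. -/
def coordRing.eval (f : coordRing V) (v : V) : ℂ := f.1 ⟨v, Set.mem_univ v⟩

section Bimod

variable {A : Set (V ≃ₗ[ℂ] V)}

/-- Elements of `𝒪(A)` as regular functions. -/
def fn (A : Set (V ≃ₗ[ℂ] V)) : bimod A ≃ₗ[ℂ] regFun (Gr A) := LinearEquiv.refl ℂ (regFun (Gr A))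

/-- Values of elements of `𝒪(A)`. -/
def val (A : Set (V ≃ₗ[ℂ] V)) : bimod A →ₗ[ℂ] (Gr A → ℂ) :=
  (regFun (Gr A)).val.toLinearMap ∘ₗ (fn A).toLinearMap

theorem val_injective : Function.Injective (val A) := fun _ _ h => Subtype.ext h

@[simp]
theorem val_lact (r : coordRing V) (m : bimod A) (z : Gr A) :
    val A ((bimod A).lact r m) z = r.eval z.1.1 * val A m z := rfl

@[simp]
theorem val_ract (r : coordRing V) (m : bimod A) (z : Gr A) :
    val A ((bimod A).ract r m) z = r.eval z.1.2 * val A m z := rfl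

/-- The constant function `1`. -/
def one (A : Set (V ≃ₗ[ℂ] V)) : bimod A := (fn A).symm 1

@[simp]
theorem val_one (z : Gr A) : val A (one A) z = 1 := rfl

theorem one_mem_deg : one A ∈ (bimod A).deg 0 := SetLike.GradedOne.one_mem (A := regDeg (Gr A))

/-- A linear form on `V × V` is a form in the first variable plus one in the second. Hence the
multiplication of `𝒪(A)` is determined by its bimodule structure, and `𝒪(A)` is generated by `1` as
a bimodule. -/
theorem lin_mul (ψ : Module.Dual ℂ (V × V)) (m : bimod A) :
    (fn A).symm (lin (Gr A) ψ * fn A m) =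
      (bimod A).lact (lin Set.univ (ψ ∘ₗ LinearMap.inl ℂ V V)) m +
      (bimod A).ract (lin Set.univ (ψ ∘ₗ LinearMap.inr ℂ V V)) m := by
  apply val_injective
  funext z
  rw [map_add, Pi.add_apply, val_lact, val_ract, ← add_mul]
  change ψ z.1 * val A m z = (ψ (z.1.1, 0) + ψ (0, z.1.2)) * val A m z
  rw [← map_add]
  simp

/-- Sub-bimodules of `𝒪(A)` containing `1` are everything. -/
theorem eq_top_of_stable (K : Submodule ℂ (bimod A)) (h1 : one A ∈ K)
    (hl : ∀ r, ∀ m ∈ K, (bimod A).lact r m ∈ K) (hr : ∀ r, ∀ m ∈ K, (bimod A).ract r m ∈ K) :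
    K = ⊤ := by
  rw [eq_top_iff]
  have key : ∀ f (hf : f ∈ regFun (Gr A)), ∀ m ∈ K,
      (fn A).symm ((⟨f, hf⟩ : regFun (Gr A)) * fn A m) ∈ K := by
    intro f hf
    induction hf using Algebra.adjoin_induction with
    | mem x hx =>
      obtain ⟨ψ, rfl⟩ := hx
      intro m hm
      have := lin_mul ψ m
      exact this ▸ K.add_mem (hl _ m hm) (hr _ m hm)
    | algebraMap c => exact fun m hm => K.smul_mem c hm
    | add x y hx hy h1 h2 =>
      intro m hm
      have := K.add_mem (h1 m hm) (h2 m hm)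
      rwa [← map_add, ← add_mul] at this
    | mul x y hx hy h1 h2 =>
      intro m hm
      have := h1 _ (h2 m hm)
      rwa [LinearEquiv.apply_symm_apply, ← mul_assoc] at this
  intro m _
  have := key _ (fn A m).2 _ h1
  rwa [one, LinearEquiv.apply_symm_apply, mul_one] at this

theorem lact_lin_mem {M : GrBimod (regDeg (Set.univ : Set V))} (ψ : Module.Dual ℂ V) {k : ℤ}
    {m : M} (hm : m ∈ M.deg k) : M.lact (lin Set.univ ψ) m ∈ M.deg (k + 2) := by
  rw [add_comm]
  refine M.lact_mem (pow_le_regDeg _ 1 ?_) hm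
  rw [pow_one]
  exact ⟨ψ, rfl⟩

theorem ract_lin_mem {M : GrBimod (regDeg (Set.univ : Set V))} (ψ : Module.Dual ℂ V) {k : ℤ}
    {m : M} (hm : m ∈ M.deg k) : M.ract (lin Set.univ ψ) m ∈ M.deg (k + 2) := by
  refine M.ract_mem (pow_le_regDeg _ 1 ?_) hm
  rw [pow_one]
  exact ⟨ψ, rfl⟩

/-- A graded version of generation by `1`: products of `k` linear forms are reached from `1` by `k`
left or right multiplications by forms. It serves both to control degrees of maps and to place
positive degrees in `rad`. -/
theorem fn_symm_mem_of_pow (K : ℕ → Submodule ℂ (bimod A)) (h1 : one A ∈ K 0)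
    (hl : ∀ ψ k, ∀ m ∈ K k, (bimod A).lact (lin Set.univ ψ) m ∈ K (k + 1))
    (hr : ∀ ψ k, ∀ m ∈ K k, (bimod A).ract (lin Set.univ ψ) m ∈ K (k + 1)) (k : ℕ) :
    LinearMap.range (lin (Gr A)) ^ k ≤ (K k).comap (fn A).symm.toLinearMap := by
  induction k with
  | zero =>
    rw [pow_zero, Submodule.one_le]
    exact h1
  | succ k ih =>
    rw [pow_succ', Submodule.mul_le]
    rintro _ ⟨ψ, rfl⟩ m hm
    have := lin_mul ψ ((fn A).symm m)
    rw [LinearEquiv.apply_symm_apply] at this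
    rw [Submodule.mem_comap, LinearEquiv.coe_coe, this]
    exact Submodule.add_mem _ (hl _ _ _ (ih hm)) (hr _ _ _ (ih hm))

/-- A bimodule map out of `𝒪(A)` sending `1` to degree `j` raises degrees by `j`. -/
theorem map_deg_of_one {M : GrBimod (regDeg (Set.univ : Set V))} (f : bimod A →ₗ[ℂ] M) {j : ℤ}
    (h1 : f (one A) ∈ M.deg j)
    (hl : ∀ r m, f ((bimod A).lact r m) = M.lact r (f m))
    (hr : ∀ r m, f ((bimod A).ract r m) = M.ract r (f m)) (k : ℤ) :
    ∀ m ∈ (bimod A).deg k, f m ∈ M.deg (k + j) := by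
  have : regDeg (Gr A) k ≤ ((M.deg (k + j)).comap f).comap (fn A).symm.toLinearMap := by
    refine iSup₂_le ?_
    rintro k rfl
    refine fn_symm_mem_of_pow (fun k => (M.deg (2 * (k : ℤ) + j)).comap f) ?_ ?_ ?_ k
    · simpa using h1
    · intro ψ k m hm
      rw [Submodule.mem_comap, hl]
      have := lact_lin_mem ψ hm
      rwa [show 2 * (k : ℤ) + j + 2 = 2 * ((k + 1 : ℕ) : ℤ) + j by push_cast; ring] at this
    · intro ψ k m hm
      rw [Submodule.mem_comap, hr]
      have := ract_lin_mem ψ hm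
      rwa [show 2 * (k : ℤ) + j + 2 = 2 * ((k + 1 : ℕ) : ℤ) + j by push_cast; ring] at this
  exact this

theorem mem_deg_zero {m : bimod A} (hm : m ∈ (bimod A).deg 0) : ∃ c : ℂ, m = c • one A := by
  have : regDeg (Gr A) 0 ≤ 1 := by
    refine iSup₂_le fun k hk => ?_
    obtain rfl : k = 0 := by omega
    rw [pow_zero]
  obtain ⟨c, hc⟩ := Submodule.mem_one.1 (this hm)
  exact ⟨c, hc.symm.trans (Algebra.algebraMap_eq_smul_one c)⟩

instance finiteDimensional_deg [FiniteDimensional ℂ V] (k : ℤ) :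
    FiniteDimensional ℂ ((bimod A).deg k) := by
  have key : ∀ n : ℕ, FiniteDimensional ℂ
      (LinearMap.range (lin (Gr A)) ^ n : Submodule ℂ (regFun (Gr A))) := fun n => by
    exact Module.Finite.iff_fg.2 (Submodule.FG.pow (Module.Finite.iff_fg.1 inferInstance) n)
  change FiniteDimensional ℂ (regDeg (Gr A) k)
  by_cases hk : ∃ n : ℕ, 2 * (n : ℤ) = k
  · obtain ⟨n, rfl⟩ := hk
    have : regDeg (Gr A) (2 * n) ≤ LinearMap.range (lin (Gr A)) ^ n :=
      iSup₂_le fun l hl => by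
        obtain rfl : l = n := by omega
        exact le_rfl
    exact Submodule.finiteDimensional_of_le this
  · have : regDeg (Gr A) k ≤ ⊥ := iSup₂_le fun l hl => (hk ⟨l, hl⟩).elim
    exact Submodule.finiteDimensional_of_le this

theorem one_ne_zero (hA : A.Nonempty) : one A ≠ 0 := by
  intro h
  obtain ⟨a, ha⟩ := hA
  have := congrFun (congrArg (val A) h) ⟨(0, 0), a, ha, by simp⟩
  simp at this

theorem end_scalar_of_one (g : bimod A →ₗ[ℂ] bimod A) {c : ℂ} (h1 : g (one A) = c • one A)
    (hl : ∀ r m, g ((bimod A).lact r m) = (bimod A).lact r (g m))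
    (hr : ∀ r m, g ((bimod A).ract r m) = (bimod A).ract r (g m)) (m : bimod A) :
    g m = c • m := by
  have : LinearMap.eqLocus g (c • LinearMap.id) = ⊤ := by
    refine eq_top_of_stable _ (LinearMap.mem_eqLocus.2 (h1.trans (by simp))) ?_ ?_
    · intro r m hm
      rw [LinearMap.mem_eqLocus] at hm ⊢
      rw [hl, hm]; simp
    · intro r m hm
      rw [LinearMap.mem_eqLocus] at hm ⊢
      rw [hr, hm]; simp
  have h2 : m ∈ LinearMap.eqLocus g (c • LinearMap.id) := by rw [this]; trivial
  simpa using LinearMap.mem_eqLocus.1 h2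

/-- Endomorphisms of (shifts of) `𝒪(A)` are scalars. -/
theorem end_scalar (A : Set (V ≃ₗ[ℂ] V)) (k : ℤ)
    (f : GrBimod.Hom ((bimod A).shift k) ((bimod A).shift k)) :
    ∃ c : ℂ, ∀ x, f.toLin x = c • x := by
  let e := (bimod A).toShift k
  let g : bimod A →ₗ[ℂ] bimod A := e.symm.toLinearMap ∘ₗ f.toLin ∘ₗ e.toLinearMap
  have hg : ∀ m, g m = e.symm (f.toLin (e m)) := fun _ => rfl
  -- After the shift, `1` sits in degree `-k`; undoing the shift, its image lies in degree `0`,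
  -- which consists of constants.
  have h1 : g (one A) ∈ (bimod A).deg (-k + k) := by
    rw [hg, toShift_symm_mem]
    refine f.map_deg (-k) _ (toShift_mem.2 ?_)
    rw [neg_add_cancel]
    exact one_mem_deg
  rw [neg_add_cancel] at h1
  obtain ⟨c, hc⟩ := mem_deg_zero h1
  have key := end_scalar_of_one g hc (fun r m => f.map_lact r m) (fun r m => f.map_ract r m)
  refine ⟨c, fun x => ?_⟩
  obtain ⟨m, rfl⟩ := e.surjective x
  have := congrArg e (key m)
  rwa [hg, LinearEquiv.apply_symm_apply, map_smul] at this

theorem exists_twist {B C : Set (V ≃ₗ[ℂ] V)} (x : V ≃ₗ[ℂ] V)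
    (hL : ∀ z ∈ Gr B, (x z.1, z.2) ∈ Gr C) : ∃ σ : bimod C →ₗ[ℂ] bimod B,
      (∀ m z, val B (σ m) z = val C m ⟨(x z.1.1, z.1.2), hL _ z.2⟩) ∧
      ∀ i, ∀ m ∈ (bimod C).deg i, σ m ∈ (bimod B).deg i :=
  ⟨(pull ((x : V →ₗ[ℂ] V).prodMap LinearMap.id) hL).toLinearMap, fun _ _ => rfl,
    fun _ _ hm => pull_mem _ hL hm⟩

theorem exists_restrict {B : Set (V ≃ₗ[ℂ] V)} (x : V ≃ₗ[ℂ] V) (hL : ∀ v, (x v, v) ∈ Gr B)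
    (m : bimod B) : ∃ r : coordRing V, ∀ v, r.eval v = val B m ⟨(x v, v), hL v⟩ :=
  ⟨pull ((x : V →ₗ[ℂ] V).prod LinearMap.id) (fun v _ => hL v) (fn B m), fun _ => rfl⟩

theorem exists_twist_coordRing (x : V ≃ₗ[ℂ] V) (r : coordRing V) :
    ∃ t : coordRing V, ∀ v, t.eval v = r.eval (x v) :=
  ⟨pull (x : V →ₗ[ℂ] V) (fun _ _ => Set.mem_univ _) r, fun _ => rfl⟩

theorem coordRing_ext {r t : coordRing V} (h : ∀ v, r.eval v = t.eval v) : r = t :=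
  Subtype.ext (funext fun v => h v.1)

/-- A bimodule that embeds into the functions on `Gr A`, is generated by the constant function `1`,
and on which `R` acts through a map `ev` from `R` to the functions on `V`. -/
structure FunModel {R : Type u} [CommRing R] [Algebra ℂ R] {𝓡 : ℤ → Submodule ℂ R}
    (ev : R → V → ℂ) (A : Set (V ≃ₗ[ℂ] V)) (M : GrBimod 𝓡) where
  val : M →ₗ[ℂ] (Gr A → ℂ)
  inj : Function.Injective val
  val_lact : ∀ r m z, val (M.lact r m) z = ev r z.1.1 * val m z
  val_ract : ∀ r m z, val (M.ract r m) z = ev r z.1.2 * val m z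
  one : M
  val_one : ∀ z, val one z = 1
  one_mem : one ∈ M.deg 0
  eq_top : ∀ K : Submodule ℂ M, one ∈ K → (∀ r, ∀ m ∈ K, M.lact r m ∈ K) →
    (∀ r, ∀ m ∈ K, M.ract r m ∈ K) → K = ⊤
  map_deg : ∀ (N : GrBimod 𝓡) (f : M →ₗ[ℂ] N) (j : ℤ), f one ∈ N.deg j →
    (∀ r m, f (M.lact r m) = N.lact r (f m)) → (∀ r m, f (M.ract r m) = N.ract r (f m)) →
    ∀ k, ∀ m ∈ M.deg k, f m ∈ N.deg (k + j)

/-- The bimodule `𝒪(A)`. -/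
def bimodModel (A : Set (V ≃ₗ[ℂ] V)) : FunModel (coordRing.eval (V := V)) A (bimod A) where
  val := val A
  inj := val_injective
  val_lact := val_lact
  val_ract := val_ract
  one := one A
  val_one := val_one
  one_mem := one_mem_deg
  eq_top := eq_top_of_stable
  map_deg _ f _ h1 hl hr := map_deg_of_one f h1 hl hr

end Bimod

/-! ### Tensor products as functions on fibre products; tensoring with the functions on one graph.
-/

namespace FunModel

variable {R : Type u} [CommRing R] [Algebra ℂ R] {𝓡 : ℤ → Submodule ℂ R} [GradedAlgebra 𝓡]
  {ev : R → V → ℂ} {A B C : Set (V ≃ₗ[ℂ] V)} {M N Q : GrBimod 𝓡}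

/-- The points of the fibre product of `Gr A` and `Gr B` over `V`. -/
def Pts (A B : Set (V ≃ₗ[ℂ] V)) : Type u :=
  {p : V × V × V // (p.1, p.2.1) ∈ Gr A ∧ (p.2.1, p.2.2) ∈ Gr B}

/-- The elements of `M ⊗ N` as functions on the fibre product. -/
def evalTens (F : FunModel ev A M) (F' : FunModel ev B N) : M.tens N →ₗ[ℂ] (Pts A B → ℂ) :=
  lift (LinearMap.mk₂ ℂ (fun m n p => F.val m ⟨_, p.2.1⟩ * F'.val n ⟨_, p.2.2⟩)
    (fun m m' n => by funext p; simp [add_mul]) (fun c m n => by funext p; simp [mul_assoc])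
    (fun m n n' => by funext p; simp [mul_add]) (fun c m n => by funext p; simp [mul_left_comm]))
    (fun m r n => by funext p; simp [F.val_ract, F'.val_lact, mul_assoc, mul_left_comm])

theorem evalTens_tm (F : FunModel ev A M) (F' : FunModel ev B N) (m : M) (n : N) (p : Pts A B) :
    F.evalTens F' (tm M N m n) p = F.val m ⟨_, p.2.1⟩ * F'.val n ⟨_, p.2.2⟩ :=
  congrFun (lift_tm _ _ m n) p

theorem evalTens_lact (F : FunModel ev A M) (F' : FunModel ev B N) (r : R) (x : M.tens N)
    (p : Pts A B) :
    F.evalTens F' ((M.tens N).lact r x) p = ev r p.1.1 * F.evalTens F' x p := by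
  have : LinearMap.proj p ∘ₗ F.evalTens F' ∘ₗ (M.tens N).lact r =
      ev r p.1.1 • (LinearMap.proj p ∘ₗ F.evalTens F') := ext_tm fun m n => by
    simp [evalTens_tm, F.val_lact, mul_assoc]
  exact LinearMap.congr_fun this x

theorem evalTens_ract (F : FunModel ev A M) (F' : FunModel ev B N) (r : R) (x : M.tens N)
    (p : Pts A B) :
    F.evalTens F' ((M.tens N).ract r x) p = ev r p.1.2.2 * F.evalTens F' x p := by
  have : LinearMap.proj p ∘ₗ F.evalTens F' ∘ₗ (M.tens N).ract r =
      ev r p.1.2.2 • (LinearMap.proj p ∘ₗ F.evalTens F') := ext_tm fun m n => by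
    simp [evalTens_tm, F'.val_ract, mul_left_comm]
  exact LinearMap.congr_fun this x

/-- `𝒪(x) ⊗ 𝒪(B) ≅ 𝒪(xB)`. -/
theorem single_tens {x : V ≃ₗ[ℂ] V} (F : FunModel ev {x} M) (FB : FunModel ev B N)
    (hG : ∀ v, (x v, v) ∈ Gr {x})
    (hL : ∀ z ∈ Gr B, (x z.1, z.2) ∈ Gr C) (hL' : ∀ z ∈ Gr C, (x.symm z.1, z.2) ∈ Gr B)
    (FC : FunModel ev C Q)
    {σ : Q →ₗ[ℂ] N} (hσ : ∀ m z, FB.val (σ m) z = FC.val m ⟨_, hL _ z.2⟩)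
    (hσd : ∀ i, ∀ m ∈ Q.deg i, σ m ∈ N.deg i)
    {τ : N →ₗ[ℂ] Q} (hτ : ∀ m z, FC.val (τ m) z = FB.val m ⟨_, hL' _ z.2⟩)
    (hr : ∀ m, ∃ r, ∀ v, ev r v = F.val m ⟨_, hG v⟩) (ht : ∀ r, ∃ t, ∀ v, ev t v = ev r (x v)) :
    M.tens N ≈ Q := by
  have hστ : ∀ m, σ (τ m) = m := fun m => by
    apply FB.inj
    funext z
    rw [hσ, hτ]
    exact congrArg (FB.val m) (Subtype.ext (Prod.ext (x.symm_apply_apply _) rfl))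
  have hx : ∀ z : Gr ({x} : Set (V ≃ₗ[ℂ] V)), z.1.1 = x z.1.2 := fun z => by
    obtain ⟨y, hy, h⟩ := z.2
    rw [h, Set.mem_singleton_iff.1 hy]
  -- A single graph is parametrised by its second coordinate, so `M` is generated by `1` as a right
  -- module and every tensor can be written `1 ⊗ n`. The left action on `1` is the right action
  -- twisted by `x`, which the map `σ` accounts for.
  have hr : ∀ m, ∃ r, m = M.ract r F.one := fun m => by
    obtain ⟨r, hr⟩ := hr m
    refine ⟨r, F.inj (funext fun z => ?_)⟩
    rw [F.val_ract, F.val_one, mul_one, hr]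
    exact congrArg (F.val m) (Subtype.ext (Prod.ext (hx z) rfl))
  have ht : ∀ r, ∃ t, (∀ v, ev t v = ev r (x v)) ∧ M.lact r F.one = M.ract t F.one := fun r => by
    obtain ⟨t, ht⟩ := ht r
    refine ⟨t, ht, F.inj (funext fun z => ?_)⟩
    rw [F.val_lact, F.val_ract, hx, ht]
  refine Setoid.symm (equiv_of_bijective (tm M N F.one ∘ₗ σ) ⟨?_, ?_⟩ ?_ ?_ ?_)
  · rw [← LinearMap.ker_eq_bot, LinearMap.ker_eq_bot']
    intro m hm
    rw [LinearMap.comp_apply] at hm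
    apply FC.inj
    funext z
    have h3 : z.1 = (x (x.symm z.1.1), z.1.2) := by simp
    let p : Pts {x} B := ⟨(x (x.symm z.1.1), x.symm z.1.1, z.1.2), hG _, hL' _ z.2⟩
    have h4 : F.evalTens FB (tm M N F.one (σ m)) p = F.evalTens FB 0 p := by rw [hm]
    rw [evalTens_tm, F.val_one, one_mul, hσ, map_zero] at h4
    rw [map_zero]
    refine Eq.trans ?_ h4
    exact congrArg (FC.val m) (Subtype.ext h3)
  · refine LinearMap.range_eq_top.1 (eq_top_of_tm fun m n => ?_)
    obtain ⟨r, rfl⟩ := hr m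
    rw [tm_bal]
    exact ⟨τ (N.lact r n), by rw [LinearMap.comp_apply, hστ]⟩
  · intro r m
    obtain ⟨t, ht, h3⟩ := ht r
    rw [LinearMap.comp_apply, LinearMap.comp_apply, lact_tm, h3, tm_bal]
    refine congrArg _ (FB.inj (funext fun z => ?_))
    rw [hσ, FC.val_lact, FB.val_lact, hσ, ht]
  · intro r m
    rw [LinearMap.comp_apply, LinearMap.comp_apply, ract_tm]
    refine congrArg _ (FB.inj (funext fun z => ?_))
    rw [hσ, FC.val_ract, FB.val_ract, hσ]
  · intro i m hm
    exact tm_mem F.one_mem (hσd i m hm) (zero_add i)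

/-- `𝒪(1) ≅ R`. -/
theorem regular_equiv (F : FunModel ev {1} M) (hG : ∀ v : V, ((1 : V ≃ₗ[ℂ] V) v, v) ∈ Gr {1})
    (hr : ∀ m, ∃ r, ∀ v, ev r v = F.val m ⟨_, hG v⟩) (he : ∀ r t, ev r = ev t → r = t) :
    regular 𝓡 ≈ M := by
  have hx : ∀ z : Gr ({1} : Set (V ≃ₗ[ℂ] V)), z.1.1 = z.1.2 := fun z => by
    obtain ⟨y, hy, h⟩ := z.2
    rw [h, Set.mem_singleton_iff.1 hy]
    rfl
  have hv : ∀ r z, F.val (M.ract r F.one) z = ev r z.1.2 := fun r z => by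
    rw [F.val_ract, F.val_one, mul_one]
  refine equiv_of_bijective (M.ract.toLinearMap.flip F.one ∘ₗ (toReg 𝓡).symm.toLinearMap)
    ⟨fun r t h => ?_, fun m => ?_⟩ (fun r t => ?_) (fun r t => ?_) (fun i t ht => ?_)
  · obtain ⟨r, rfl⟩ := (toReg 𝓡).surjective r
    obtain ⟨t, rfl⟩ := (toReg 𝓡).surjective t
    simp only [LinearMap.comp_apply, LinearEquiv.coe_coe, LinearEquiv.symm_apply_apply,
      LinearMap.flip_apply, AlgHom.toLinearMap_apply] at h
    refine congrArg _ (he r t (funext fun v => ?_))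
    have := congrFun (congrArg F.val h) ⟨_, hG v⟩
    rwa [hv, hv] at this
  · obtain ⟨r, hr⟩ := hr m
    refine ⟨toReg 𝓡 r, F.inj (funext fun z => ?_)⟩
    simp only [LinearMap.comp_apply, LinearEquiv.coe_coe, LinearEquiv.symm_apply_apply,
      LinearMap.flip_apply, AlgHom.toLinearMap_apply]
    rw [hv, hr]
    exact congrArg (F.val m) (Subtype.ext (Prod.ext (hx z).symm rfl))
  · obtain ⟨t, rfl⟩ := (toReg 𝓡).surjective t
    simp only [LinearMap.comp_apply, LinearEquiv.coe_coe, LinearEquiv.symm_apply_apply,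
      LinearMap.flip_apply, AlgHom.toLinearMap_apply, lact_toReg, map_mul, Module.End.mul_apply]
    apply F.inj
    funext z
    rw [F.val_ract, F.val_lact, hx]
  · obtain ⟨t, rfl⟩ := (toReg 𝓡).surjective t
    simp only [LinearMap.comp_apply, LinearEquiv.coe_coe, LinearEquiv.symm_apply_apply,
      LinearMap.flip_apply, AlgHom.toLinearMap_apply, ract_toReg, mul_comm t r, map_mul,
      Module.End.mul_apply]
  · obtain ⟨t, rfl⟩ := (toReg 𝓡).surjective t
    have := M.ract_mem (toReg_mem.1 ht) F.one_mem
    rwa [zero_add] at this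

end FunModel

/-- `𝒪(1) ≅ R`. -/
theorem bimod_one : regular (regDeg (Set.univ : Set V)) ≈ bimod ({1} : Set (V ≃ₗ[ℂ] V)) :=
  (bimodModel {1}).regular_equiv (fun _ => ⟨1, rfl, rfl⟩) (exists_restrict 1 _)
    (fun _ _ h => coordRing_ext (congrFun h))

/-- `𝒪(x) ⊗ 𝒪(B) ≅ 𝒪(xB)`. -/
theorem single_tens (x : V ≃ₗ[ℂ] V) (B C : Set (V ≃ₗ[ℂ] V)) (hC : C = (fun b => x * b) '' B) :
    (bimod {x}).tens (bimod B) ≈ bimod C := by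
  have hL : ∀ z ∈ Gr B, (x z.1, z.2) ∈ Gr C := by
    rintro ⟨u, w⟩ ⟨b, hb, h⟩
    refine ⟨x * b, hC ▸ ⟨b, hb, rfl⟩, ?_⟩
    simp only at h
    simp [h]
  have hL' : ∀ z ∈ Gr C, (x.symm z.1, z.2) ∈ Gr B := by
    rintro ⟨u, w⟩ ⟨c, hc, h⟩
    rw [hC] at hc
    obtain ⟨b, hb, rfl⟩ := hc
    refine ⟨b, hb, ?_⟩
    simp only at h
    simp [h]
  have hG : ∀ v : V, (x v, v) ∈ Gr ({x} : Set (V ≃ₗ[ℂ] V)) := fun v => ⟨x, rfl, rfl⟩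
  obtain ⟨σ, hσ, hσd⟩ := exists_twist x hL
  obtain ⟨τ, hτ, -⟩ := exists_twist x.symm hL'
  exact (bimodModel {x}).single_tens (bimodModel B) hG hL hL' (bimodModel C) hσ hσd hτ
    (exists_restrict x hG) (exists_twist_coordRing x)

end RegFun

/-! ### Tensoring with `𝒪(e, s)`: the two-sheeted fibre product. -/

namespace RegFun

open GrBimod

variable {V : Type u} [AddCommGroup V] [Module ℂ V]

theorem stable_of_adjoin {R : Type u} [CommRing R] [Algebra ℂ R] {M : Type u} [AddCommGroup M]
    [Module ℂ M] (f : R →ₐ[ℂ] Module.End ℂ M) {X : R} (hX : Algebra.adjoin ℂ {X} = ⊤)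
    {K : Submodule ℂ M} (h : ∀ m ∈ K, f X m ∈ K) (r : R) : ∀ m ∈ K, f r m ∈ K := by
  have hr : r ∈ Algebra.adjoin ℂ {X} := hX ▸ Algebra.mem_top
  induction hr using Algebra.adjoin_induction with
  | mem x hx => rwa [Set.mem_singleton_iff.1 hx]
  | algebraMap c =>
    intro m hm
    rw [AlgHom.commutes, Module.algebraMap_end_apply]
    exact K.smul_mem c hm
  | add x y _ _ h1 h2 =>
    intro m hm
    rw [map_add]
    exact K.add_mem (h1 m hm) (h2 m hm)
  | mul x y _ _ h1 h2 =>
    intro m hm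
    rw [map_mul]
    exact h1 _ (h2 m hm)

theorem exists_factor {M N P : Type*} [AddCommGroup M] [Module ℂ M] [AddCommGroup N] [Module ℂ N]
    [AddCommGroup P] [Module ℂ P] {E : M →ₗ[ℂ] P} (hE : Function.Injective E) (f : N →ₗ[ℂ] P)
    (h : ∀ n, ∃ m, E m = f n) : ∃ θ : N →ₗ[ℂ] M, ∀ n, E (θ n) = f n := by
  choose g hg using h
  exact ⟨{ toFun := g
           map_add' := fun x y => hE (by simp [hg])
           map_smul' := fun c x => hE (by simp [hg]) }, hg⟩

namespace FunModel

variable {R : Type u} [CommRing R] [Algebra ℂ R] {𝓡 : ℤ → Submodule ℂ R}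
  {ev : R → V → ℂ} {A B C : Set (V ≃ₗ[ℂ] V)} {M N P Q I : GrBimod 𝓡}
  {s : V ≃ₗ[ℂ] V} {φ : V ≃ₗ[ℂ] ℂ} {ζ : ℂ} {X : R}

theorem mem_Gr_pair {u w : V} (h : (u, w) ∈ Gr ({1, s} : Set (V ≃ₗ[ℂ] V))) : u = w ∨ u = s w := by
  obtain ⟨y, hy, h⟩ := h
  rcases hy with rfl | rfl
  · exact Or.inl h
  · exact Or.inr h

/-- This is the equation `(x - t)(x - ζ t) = 0` of the two lines `x = t` and `x = ζ t`. -/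
theorem lact_lact_one (F : FunModel ev {1, s} P) (hs : ∀ v, φ (s v) = ζ * φ v)
    (hX : ∀ v, ev X v = φ v) :
    P.lact X (P.lact X F.one) =
      (1 + ζ) • P.ract X (P.lact X F.one) - ζ • P.ract X (P.ract X F.one) := by
  apply F.inj
  funext z
  simp only [map_sub, map_smul, Pi.sub_apply, Pi.smul_apply, smul_eq_mul, F.val_lact, F.val_ract,
    F.val_one, hX]
  rcases mem_Gr_pair z.2 with h | h
  · rw [h]; ring
  · rw [h, hs]; ring

variable [GradedAlgebra 𝓡]

/-- The quadratic relation reduces powers of `X` on the left, so `1` and `X` generate `𝒪(e, s)` as a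
right module. -/
theorem exists_eq_tm (F : FunModel ev {1, s} P) (hs : ∀ v, φ (s v) = ζ * φ v)
    (hX : ∀ v, ev X v = φ v) (hgen : Algebra.adjoin ℂ {X} = ⊤) (t : P.tens N) :
    ∃ m m', t = tm P N F.one m + tm P N (P.lact X F.one) m' := by
  let K : Submodule ℂ (P.tens N) :=
    LinearMap.range (tm P N F.one) ⊔ LinearMap.range (tm P N (P.lact X F.one))
  have h1 : ∀ n, tm P N F.one n ∈ K := fun n => Submodule.mem_sup_left ⟨n, rfl⟩
  have h2 : ∀ n, tm P N (P.lact X F.one) n ∈ K := fun n => Submodule.mem_sup_right ⟨n, rfl⟩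
  have hlX : ∀ x ∈ K, (P.tens N).lact X x ∈ K := by
    have : K ≤ K.comap ((P.tens N).lact X) := by
      refine sup_le ?_ ?_
      · rintro _ ⟨n, rfl⟩
        rw [Submodule.mem_comap, lact_tm]
        exact h2 n
      · rintro _ ⟨n, rfl⟩
        rw [Submodule.mem_comap, lact_tm, F.lact_lact_one hs hX, map_sub, map_smul, map_smul,
          LinearMap.sub_apply, LinearMap.smul_apply, LinearMap.smul_apply, tm_bal, tm_bal, tm_bal]
        exact K.sub_mem (K.smul_mem _ (h2 _)) (K.smul_mem _ (h1 _))
    exact this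
  have hl := stable_of_adjoin (P.tens N).lact hgen hlX
  have key : (⨅ n, K.comap ((tm P N).flip n)) = ⊤ := by
    refine F.eq_top _ ?_ ?_ ?_
    · simpa using h1
    · intro r m hm
      simp only [Submodule.mem_iInf, Submodule.mem_comap, LinearMap.flip_apply] at hm ⊢
      intro n
      rw [← lact_tm]
      exact hl r _ (hm n)
    · intro r m hm
      simp only [Submodule.mem_iInf, Submodule.mem_comap, LinearMap.flip_apply] at hm ⊢
      intro n
      rw [tm_bal]
      exact hm _
  have hK : K = ⊤ := eq_top_of_tm fun m n => by
    have hm : m ∈ (⨅ n, K.comap ((tm P N).flip n)) := by rw [key]; trivial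
    simp only [Submodule.mem_iInf, Submodule.mem_comap, LinearMap.flip_apply] at hm
    exact hm n
  have ht : t ∈ K := by rw [hK]; trivial
  obtain ⟨_, ⟨m, rfl⟩, _, ⟨m', rfl⟩, h⟩ := Submodule.mem_sup.1 ht
  exact ⟨m, m', h.symm⟩

/-- For `1 ⊗ m + X ⊗ m'`, evaluation on the sheets `x = t` and `x = ζ t` gives `m + t m' = 0` and `m
+ ζ t m' = 0`. The determinant `(ζ - 1) t` is nonzero off the origin, and by `hN` that is enough. -/
theorem evalTens_injective (F : FunModel ev {1, s} P) (FA : FunModel ev A N)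
    (hs : ∀ v, φ (s v) = ζ * φ v) (hζ1 : ζ ≠ 1)
    (hX : ∀ v, ev X v = φ v) (hgen : Algebra.adjoin ℂ {X} = ⊤)
    (hN : ∀ m, (∀ z : Gr A, z.1.2 ≠ 0 → FA.val m z = 0) → m = 0) :
    Function.Injective (F.evalTens FA) := by
  rw [← LinearMap.ker_eq_bot, LinearMap.ker_eq_bot']
  intro t ht
  obtain ⟨m, m', rfl⟩ := F.exists_eq_tm hs hX hgen t
  have h0 : ∀ p : Pts {1, s} A, FA.val m ⟨_, p.2.2⟩ + φ p.1.1 * FA.val m' ⟨_, p.2.2⟩ = 0 :=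
    fun p => by
      have := congrFun ht p
      simpa [evalTens_tm, F.val_one, F.val_lact, hX] using this
  have h1 : ∀ z : Gr A, FA.val m z + φ z.1.1 * FA.val m' z = 0 := fun z =>
    h0 ⟨(z.1.1, z.1.1, z.1.2), ⟨1, Or.inl rfl, rfl⟩, z.2⟩
  have h2 : ∀ z : Gr A, FA.val m z + φ (s z.1.1) * FA.val m' z = 0 := fun z =>
    h0 ⟨(s z.1.1, z.1.1, z.1.2), ⟨s, Or.inr rfl, rfl⟩, z.2⟩
  have hm' : m' = 0 := by
    refine hN m' fun z hz => ?_
    have hφ : φ z.1.1 ≠ 0 := by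
      obtain ⟨a, _, ha⟩ := z.2
      rw [ha]
      simpa using hz
    have h3 : (φ z.1.1 * (1 - ζ)) * FA.val m' z = 0 := by
      have := h2 z
      rw [hs] at this
      linear_combination h1 z - this
    rcases mul_eq_zero.1 h3 with h | h
    · rcases mul_eq_zero.1 h with h | h
      · exact (hφ h).elim
      · exact (hζ1 (sub_eq_zero.1 h).symm).elim
    · exact h
  have hm : m = 0 := hN m fun z _ => by simpa [hm'] using h1 z
  rw [hm, hm']
  simp

set_option maxHeartbeats 800000 in
/-- `𝒪(1, s) ⊗ 𝒪(A) ≅ 𝒪(A ∪ sA) ⊕ 𝒪(A ∩ sA)[-2]`, provided that some form `αx + βt + γy` with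
`β ≠ 0` vanishes at the points of the fibre product which do not lie over `A ∩ sA`. -/
theorem pair_tens (F : FunModel ev {1, s} P) (FA : FunModel ev A N) {U D : Set (V ≃ₗ[ℂ] V)}
    (FU : FunModel ev U Q) (FD : FunModel ev D I)
    (hs : ∀ v, φ (s v) = ζ * φ v) (hζ1 : ζ ≠ 1) (hζ0 : ζ ≠ 0)
    (hX : ∀ v, ev X v = φ v) (hgen : Algebra.adjoin ℂ {X} = ⊤) (hX2 : X ∈ 𝓡 2)
    (hN : ∀ m, (∀ z : Gr A, z.1.2 ≠ 0 → FA.val m z = 0) → m = 0)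
    (hI : ∀ m, (∀ z : Gr D, z.1.2 ≠ 0 → FD.val m z = 0) → m = 0)
    (hU : ∀ a, a ∈ U ↔ a ∈ A ∨ s⁻¹ * a ∈ A) (hD : ∀ a, a ∈ D ↔ a ∈ A ∧ s⁻¹ * a ∈ A)
    {α β γ : ℂ} (hβ : β ≠ 0)
    (hg1 : ∀ a ∈ A, s⁻¹ * a ∉ A → ∀ v, α * φ (a v) + β * φ (a v) + γ * φ v = 0)
    (hg2 : ∀ a ∈ A, s * a ∉ A → ∀ v, α * φ (s (a v)) + β * φ (a v) + γ * φ v = 0) :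
    P.tens N ≈ Q.sum (I.shift (-2)) := by
  classical
  -- From here on, identities in the tensor product are checked on the points `(x, t, y)` of the
  -- fibre product.
  have hE := F.evalTens_injective FA hs hζ1 hX hgen hN
  have hPU : ∀ p : Pts {1, s} A, (p.1.1, p.1.2.2) ∈ Gr U := by
    rintro ⟨⟨x, t, y⟩, h1, h2⟩
    obtain ⟨a, ha, h2⟩ := h2
    simp only at h1 h2 ⊢
    rcases mem_Gr_pair h1 with h | h
    · exact ⟨a, (hU a).2 (Or.inl ha), by simp [h, h2]⟩
    · exact ⟨s * a, (hU _).2 (Or.inr (by simpa using ha)), by simp [h, h2]⟩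
  -- The form separating the sheets: it vanishes outside the preimage of `Gr D`, and since `β ≠ 0`
  -- it differs at distinct points of one fibre.
  let g : Pts {1, s} A → ℂ := fun p => α * φ p.1.1 + β * φ p.1.2.1 + γ * φ p.1.2.2
  have hg : ∀ p : Pts {1, s} A, (p.1.1, p.1.2.2) ∉ Gr D → g p = 0 := by
    rintro ⟨⟨x, t, y⟩, h1, h2⟩ hp
    obtain ⟨a, ha, h2⟩ := h2
    simp only at h1 h2 hp
    change α * φ x + β * φ t + γ * φ y = 0
    rcases mem_Gr_pair h1 with h | h
    · rw [h, h2]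
      exact hg1 a ha (fun h3 => hp ⟨a, (hD a).2 ⟨ha, h3⟩, by simp [h, h2]⟩) y
    · rw [h, h2]
      exact hg2 a ha (fun h3 => hp ⟨s * a, (hD _).2 ⟨h3, by simpa using ha⟩, by simp [h, h2]⟩) y
  let E₁ : Q →ₗ[ℂ] (Pts {1, s} A → ℂ) :=
    { toFun := fun q p => FU.val q ⟨_, hPU p⟩
      map_add' := fun q q' => by funext p; simp
      map_smul' := fun c q => by funext p; simp }
  -- A function on `Gr D` is multiplied by `g` and extended by `0`. As `g` vanishes off the preimage
  -- of `Gr D`, the constant `1` goes to `g` itself, which comes from the element `G`.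
  let E₂ : I →ₗ[ℂ] (Pts {1, s} A → ℂ) :=
    { toFun := fun i p => g p * (if h : (p.1.1, p.1.2.2) ∈ Gr D then FD.val i ⟨_, h⟩ else 0)
      map_add' := fun i i' => by
        funext p
        by_cases h : (p.1.1, p.1.2.2) ∈ Gr D <;> simp [h, mul_add]
      map_smul' := fun c i => by
        funext p
        by_cases h : (p.1.1, p.1.2.2) ∈ Gr D <;> simp [h, mul_left_comm] }
  have hE₁ : ∀ q p, E₁ q p = FU.val q ⟨_, hPU p⟩ := fun _ _ => rfl
  have hE₂ : ∀ i (p : Pts {1, s} A) (h : (p.1.1, p.1.2.2) ∈ Gr D),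
      E₂ i p = g p * FD.val i ⟨_, h⟩ := fun i p h => by simp [E₂, h]
  have hE₂' : ∀ i (p : Pts {1, s} A), (p.1.1, p.1.2.2) ∉ Gr D → E₂ i p = 0 :=
    fun i p h => by simp [E₂, h]
  have hE₁l : ∀ r q p, E₁ (Q.lact r q) p = ev r p.1.1 * E₁ q p := fun r q p => by
    rw [hE₁, hE₁, FU.val_lact]
  have hE₁r : ∀ r q p, E₁ (Q.ract r q) p = ev r p.1.2.2 * E₁ q p := fun r q p => by
    rw [hE₁, hE₁, FU.val_ract]
  have hE₂l : ∀ r i p, E₂ (I.lact r i) p = ev r p.1.1 * E₂ i p := fun r i p => by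
    by_cases h : (p.1.1, p.1.2.2) ∈ Gr D
    · rw [hE₂ _ p h, hE₂ _ p h, FD.val_lact]; ring
    · rw [hE₂' _ p h, hE₂' _ p h, mul_zero]
  have hE₂r : ∀ r i p, E₂ (I.ract r i) p = ev r p.1.2.2 * E₂ i p := fun r i p => by
    by_cases h : (p.1.1, p.1.2.2) ∈ Gr D
    · rw [hE₂ _ p h, hE₂ _ p h, FD.val_ract]; ring
    · rw [hE₂' _ p h, hE₂' _ p h, mul_zero]
  let T := P.tens N
  let t₀ : T := tm P N F.one FA.one
  let t₁ : T := tm P N F.one (N.lact X FA.one)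
  let G : T := α • T.lact X t₀ + β • t₁ + γ • T.ract X t₀
  have ht₀ : ∀ p, F.evalTens FA t₀ p = 1 := fun p => by
    simp [t₀, evalTens_tm, F.val_one, FA.val_one]
  have hG : ∀ p, F.evalTens FA G p = g p := fun p => by
    simp only [G, map_add, map_smul, Pi.add_apply, Pi.smul_apply, smul_eq_mul]
    rw [evalTens_lact, evalTens_ract, ht₀]
    simp [t₁, evalTens_tm, F.val_one, FA.val_one, FA.val_lact, hX, g]
  have hG₂ : F.evalTens FA G = E₂ FD.one := by
    funext p
    rw [hG]
    by_cases h : (p.1.1, p.1.2.2) ∈ Gr D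
    · rw [hE₂ _ p h, FD.val_one, mul_one]
    · rw [hE₂' _ p h, hg p h]
  have hG₁ : F.evalTens FA t₀ = E₁ FU.one := by
    funext p
    rw [ht₀, hE₁, FU.val_one]
  -- The elements whose function comes from the tensor product form a sub-bimodule containing the
  -- generator `1`, hence are all of `Q`; the same argument gives `θ₂`.
  obtain ⟨θ₁, hθ₁⟩ := exists_factor hE E₁ (by
    have : (LinearMap.range (F.evalTens FA)).comap E₁ = ⊤ := by
      refine FU.eq_top _ ⟨t₀, hG₁⟩ ?_ ?_
      · rintro r q ⟨t, ht⟩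
        exact ⟨T.lact r t, funext fun p => by rw [hE₁l, evalTens_lact, ht]⟩
      · rintro r q ⟨t, ht⟩
        exact ⟨T.ract r t, funext fun p => by rw [hE₁r, evalTens_ract, ht]⟩
    intro q
    have hq : q ∈ (LinearMap.range (F.evalTens FA)).comap E₁ := by rw [this]; trivial
    exact hq)
  obtain ⟨θ₂, hθ₂⟩ := exists_factor hE E₂ (by
    have : (LinearMap.range (F.evalTens FA)).comap E₂ = ⊤ := by
      refine FD.eq_top _ ⟨G, hG₂⟩ ?_ ?_
      · rintro r q ⟨t, ht⟩
        exact ⟨T.lact r t, funext fun p => by rw [hE₂l, evalTens_lact, ht]⟩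
      · rintro r q ⟨t, ht⟩
        exact ⟨T.ract r t, funext fun p => by rw [hE₂r, evalTens_ract, ht]⟩
    intro q
    have hq : q ∈ (LinearMap.range (F.evalTens FA)).comap E₂ := by rw [this]; trivial
    exact hq)
  have hθ₁l : ∀ r q, θ₁ (Q.lact r q) = T.lact r (θ₁ q) := fun r q => hE (funext fun p => by
    rw [hθ₁, hE₁l, evalTens_lact, hθ₁])
  have hθ₁r : ∀ r q, θ₁ (Q.ract r q) = T.ract r (θ₁ q) := fun r q => hE (funext fun p => by
    rw [hθ₁, hE₁r, evalTens_ract, hθ₁])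
  have hθ₂l : ∀ r q, θ₂ (I.lact r q) = T.lact r (θ₂ q) := fun r q => hE (funext fun p => by
    rw [hθ₂, hE₂l, evalTens_lact, hθ₂])
  have hθ₂r : ∀ r q, θ₂ (I.ract r q) = T.ract r (θ₂ q) := fun r q => hE (funext fun p => by
    rw [hθ₂, hE₂r, evalTens_ract, hθ₂])
  have hθ₁1 : θ₁ FU.one = t₀ := hE (by rw [hθ₁, hG₁])
  have hθ₂1 : θ₂ FD.one = G := hE (by rw [hθ₂, hG₂])
  have ht₀d : t₀ ∈ T.deg 0 := tm_mem F.one_mem FA.one_mem (add_zero 0)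
  have hGd : G ∈ T.deg 2 := by
    refine Submodule.add_mem _ (Submodule.add_mem _ (Submodule.smul_mem _ _ ?_)
      (Submodule.smul_mem _ _ ?_)) (Submodule.smul_mem _ _ ?_)
    · have := T.lact_mem hX2 ht₀d
      rwa [add_zero] at this
    · exact tm_mem F.one_mem (N.lact_mem hX2 FA.one_mem) (by norm_num)
    · have := T.ract_mem hX2 ht₀d
      rwa [zero_add] at this
  let e : Q.sum (I.shift (-2)) →ₗ[ℂ] T :=
    θ₁ ∘ₗ fst _ _ + θ₂ ∘ₗ (I.toShift (-2)).symm.toLinearMap ∘ₗ snd _ _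
  have he : ∀ x, e x = θ₁ (fst _ _ x) + θ₂ ((I.toShift (-2)).symm (snd _ _ x)) := fun _ => rfl
  have hel : ∀ r x, e ((Q.sum (I.shift (-2))).lact r x) = T.lact r (e x) := fun r x => by
    rw [he, he, map_add, ← hθ₁l, ← hθ₂l]; rfl
  have her : ∀ r x, e ((Q.sum (I.shift (-2))).ract r x) = T.ract r (e x) := fun r x => by
    rw [he, he, map_add, ← hθ₁r, ← hθ₂r]; rfl
  refine Setoid.symm (equiv_of_bijective e ⟨?_, ?_⟩ hel her ?_)
  · rw [← LinearMap.ker_eq_bot, LinearMap.ker_eq_bot']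
    intro x hx
    set q := fst _ _ x with hq
    set i := (I.toShift (-2)).symm (snd _ _ x) with hi
    have h0 : ∀ p, E₁ q p + E₂ i p = 0 := fun p => by
      rw [← hθ₁, ← hθ₂, ← Pi.add_apply, ← map_add, ← he, hx, map_zero, Pi.zero_apply]
    have hi0 : i = 0 := by
      -- Over a nonzero point `(u, w)` of `Gr D` lie the two points `t = u` and `t = s⁻¹ u`. The
      -- contribution of `q` is the same at both, so subtracting leaves `β (ζ - 1) φ(t)` times the
      -- value of `i`, with `t = s⁻¹ u`.
      refine hI i fun z hz => ?_
      obtain ⟨⟨u, w⟩, hz'⟩ := z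
      obtain ⟨c, hc, h⟩ := id hz'
      simp only at h hz
      obtain ⟨hc1, hc2⟩ := (hD c).1 hc
      have hsu : s ((s⁻¹ * c) w) = u := by
        rw [← LinearEquiv.mul_apply, mul_inv_cancel_left, h]
      let p : Pts {1, s} A := ⟨(u, u, w), ⟨1, Or.inl rfl, rfl⟩, ⟨c, hc1, h⟩⟩
      let p' : Pts {1, s} A :=
        ⟨(u, (s⁻¹ * c) w, w), ⟨s, Or.inr rfl, hsu.symm⟩, ⟨_, hc2, rfl⟩⟩
      have hzU : (u, w) ∈ Gr U := hPU p
      have e1 : FU.val q ⟨(u, w), hzU⟩ +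
          (α * φ u + β * φ u + γ * φ w) * FD.val i ⟨(u, w), hz'⟩ = 0 := by
        have := h0 p
        rwa [hE₁, hE₂ i p hz'] at this
      have e2 : FU.val q ⟨(u, w), hzU⟩ +
          (α * φ u + β * φ ((s⁻¹ * c) w) + γ * φ w) * FD.val i ⟨(u, w), hz'⟩ = 0 := by
        have := h0 p'
        rwa [hE₁, hE₂ i p' hz'] at this
      have h1 : φ u = ζ * φ ((s⁻¹ * c) w) := by rw [← hs, hsu]
      have h2 : φ ((s⁻¹ * c) w) ≠ 0 := by simpa using hz
      have h3 : (β * ((ζ - 1) * φ ((s⁻¹ * c) w))) * FD.val i ⟨(u, w), hz'⟩ = 0 := by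
        have h4 : φ u - φ ((s⁻¹ * c) w) = (ζ - 1) * φ ((s⁻¹ * c) w) := by rw [h1]; ring
        rw [← h4]
        linear_combination e1 - e2
      exact (mul_eq_zero.1 h3).resolve_left
        (mul_ne_zero hβ (mul_ne_zero (sub_ne_zero.2 hζ1) h2))
    have hq0 : q = 0 := by
      apply FU.inj
      rw [map_zero]
      funext z
      rw [hi0, map_zero] at h0
      simp only [hE₁, Pi.zero_apply, add_zero] at h0
      obtain ⟨⟨u, w⟩, hz'⟩ := z
      obtain ⟨c, hc, h⟩ := id hz'
      simp only at h
      rcases (hU c).1 hc with h1 | h1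
      · exact h0 ⟨(u, u, w), ⟨1, Or.inl rfl, rfl⟩, ⟨c, h1, h⟩⟩
      · refine h0 ⟨(u, (s⁻¹ * c) w, w), ⟨s, Or.inr rfl, ?_⟩, ⟨_, h1, rfl⟩⟩
        change u = s ((s⁻¹ * c) w)
        rw [← LinearEquiv.mul_apply, mul_inv_cancel_left, h]
    refine sum_ext (by rw [← hq, hq0, map_zero]) ?_
    rw [map_zero]
    exact ((I.toShift (-2)).symm.map_eq_zero_iff).1 hi0
  · rw [← LinearMap.range_eq_top]
    set K := LinearMap.range e with hK
    have hl : ∀ r, ∀ x ∈ K, T.lact r x ∈ K := by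
      rintro r _ ⟨x, rfl⟩
      exact ⟨_, hel r x⟩
    have hr : ∀ r, ∀ x ∈ K, T.ract r x ∈ K := by
      rintro r _ ⟨x, rfl⟩
      exact ⟨_, her r x⟩
    have k0 : t₀ ∈ K := ⟨inl _ _ FU.one, by rw [he]; simp [hθ₁1]⟩
    have kG : G ∈ K := ⟨inr _ _ (I.toShift (-2) FD.one), by rw [he]; simp [hθ₂1]⟩
    -- As `β ≠ 0`, the middle variable `1 ⊗ X` can be solved for from `G` and the outer actions on
    -- `1 ⊗ 1`.
    have k1 : t₁ ∈ K := by
      have h1 : β • t₁ = G - (α • T.lact X t₀ + γ • T.ract X t₀) := by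
        simp only [G]; abel
      have h2 : β • t₁ ∈ K := by
        rw [h1]
        exact K.sub_mem kG (K.add_mem (K.smul_mem _ (hl _ _ k0)) (K.smul_mem _ (hr _ _ k0)))
      have h3 := K.smul_mem β⁻¹ h2
      rwa [smul_smul, inv_mul_cancel₀ hβ, one_smul] at h3
    -- Asking for both `1 ⊗ n` and `1 ⊗ X n` makes the condition stable under `X`: the quadratic
    -- relation expresses `ζ (1 ⊗ X² n)` through outer left actions on these two tensors, and `ζ` is
    -- invertible.
    let K' : Submodule ℂ N := K.comap (tm P N F.one) ⊓ K.comap (tm P N F.one ∘ₗ N.lact X)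
    have hK'X : ∀ n ∈ K', N.lact X n ∈ K' := by
      rintro n ⟨h1, h2⟩
      refine ⟨h2, ?_⟩
      change tm P N F.one (N.lact X (N.lact X n)) ∈ K
      have h3 : ζ • tm P N F.one (N.lact X (N.lact X n)) =
          (1 + ζ) • T.lact X (tm P N F.one (N.lact X n)) -
            T.lact X (T.lact X (tm P N F.one n)) := by
        simp only [T, lact_tm]
        rw [F.lact_lact_one hs hX, map_sub, map_smul, map_smul,
          LinearMap.sub_apply, LinearMap.smul_apply, LinearMap.smul_apply, tm_bal, tm_bal, tm_bal]
        abel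
      have h4 : ζ • tm P N F.one (N.lact X (N.lact X n)) ∈ K := by
        rw [h3]
        exact K.sub_mem (K.smul_mem _ (hl _ _ h2)) (hl _ _ (hl _ _ h1))
      have h5 := K.smul_mem ζ⁻¹ h4
      rwa [smul_smul, inv_mul_cancel₀ hζ0, one_smul] at h5
    have hK' : K' = ⊤ := by
      refine FA.eq_top _ ⟨k0, k1⟩ (stable_of_adjoin N.lact hgen hK'X) ?_
      rintro r n ⟨h1, h2⟩
      refine ⟨?_, ?_⟩
      · change tm P N F.one (N.ract r n) ∈ K
        rw [← ract_tm]
        exact hr _ _ h1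
      · change tm P N F.one (N.lact X (N.ract r n)) ∈ K
        rw [N.act_comm, ← ract_tm]
        exact hr _ _ h2
    have key : (⨅ n, K.comap ((tm P N).flip n)) = ⊤ := by
      refine F.eq_top _ ?_ ?_ ?_
      · simp only [Submodule.mem_iInf, Submodule.mem_comap, LinearMap.flip_apply]
        intro n
        have hn : n ∈ K' := by rw [hK']; trivial
        exact hn.1
      · intro r m hm
        simp only [Submodule.mem_iInf, Submodule.mem_comap, LinearMap.flip_apply] at hm ⊢
        intro n
        rw [← lact_tm]
        exact hl r _ (hm n)
      · intro r m hm
        simp only [Submodule.mem_iInf, Submodule.mem_comap, LinearMap.flip_apply] at hm ⊢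
        intro n
        rw [tm_bal]
        exact hm _
    refine eq_top_of_tm fun m n => ?_
    have hm : m ∈ (⨅ n, K.comap ((tm P N).flip n)) := by rw [key]; trivial
    simp only [Submodule.mem_iInf, Submodule.mem_comap, LinearMap.flip_apply] at hm
    exact hm n
  · intro i x hx
    rw [he]
    refine Submodule.add_mem _ ?_ ?_
    · have := FU.map_deg _ θ₁ 0 (by rw [hθ₁1]; exact ht₀d) hθ₁l hθ₁r i _ hx.1
      rwa [add_zero] at this
    -- The generator of `I` goes to the degree `2` element `G`; this is the source of the shift
    -- `[-2]`.
    · have := FD.map_deg _ θ₂ 2 (by rw [hθ₂1]; exact hGd) hθ₂l hθ₂r (i + -2) _ hx.2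
      rwa [neg_add_cancel_right] at this

end FunModel

end RegFun

/-! ### Evaluation of the numerical invariant on bimodules of functions. -/

namespace RegFun

open GrBimod

variable {V : Type u} [AddCommGroup V] [Module ℂ V]

namespace FunModel

variable {R : Type u} [CommRing R] [Algebra ℂ R] {𝓡 : ℤ → Submodule ℂ R}
  {ev : R → V → ℂ} {A : Set (V ≃ₗ[ℂ] V)} {M : GrBimod 𝓡} {φ : V ≃ₗ[ℂ] ℂ} {X : R}

/-- The product of the linear forms `x - χⱼ y`, as an element of `R ⊗ R`. -/
noncomputable def lineProd (X : R) (χ : ℕ → ℂ) (n : ℕ) : R ⊗[ℂ] R :=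
  ∏ j ∈ Finset.range n, (X ⊗ₜ[ℂ] (1 : R) - χ j • ((1 : R) ⊗ₜ[ℂ] X))

theorem val_act_lineProd (F : FunModel ev A M) (hX : ∀ v, ev X v = φ v) (χ : ℕ → ℂ) (n : ℕ)
    (m : M) (z : Gr A) :
    F.val (M.act (lineProd X χ n) m) z =
      (∏ j ∈ Finset.range n, (φ z.1.1 - χ j * φ z.1.2)) * F.val m z := by
  induction n generalizing m with
  | zero => simp [lineProd]
  | succ n ih =>
    have h : lineProd X χ (n + 1) =
        lineProd X χ n * (X ⊗ₜ[ℂ] (1 : R) - χ n • ((1 : R) ⊗ₜ[ℂ] X)) :=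
      Finset.prod_range_succ _ _
    rw [h, map_mul, Module.End.mul_apply, ih, Finset.prod_range_succ]
    simp only [map_sub, map_smul, act_tmul, map_one, mul_one, one_mul, LinearMap.sub_apply,
      LinearMap.smul_apply, Pi.sub_apply, Pi.smul_apply, smul_eq_mul, F.val_lact, F.val_ract, hX]
    ring

/-- Every element of `X M + M X` vanishes at the origin, which lies on each graph. -/
theorem one_notMem_rad (F : FunModel ev A M) (hX : ∀ v, ev X v = φ v) (hA : A.Nonempty) :
    F.one ∉ rad X M := by
  intro h
  obtain ⟨a, ha⟩ := hA
  let z : Gr A := ⟨(0, 0), a, ha, by simp⟩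
  obtain ⟨_, ⟨m, rfl⟩, _, ⟨m', rfl⟩, h⟩ := Submodule.mem_sup.1 h
  have h1 := congrFun (congrArg F.val h) z
  rw [map_add, Pi.add_apply, F.val_lact, F.val_ract, F.val_one, hX] at h1
  simp [z] at h1

-- Modulo `rad` only degree `0` of `M` survives, and there it is the line spanned by `1`. So
-- everything depends on whether the shift puts `1` in degree `k` and whether `p` kills it.
open Classical in
theorem inv_shift (F : FunModel ev A M) (hX : ∀ v, ev X v = φ v) (hA : A.Nonempty)
    (h0 : ∀ m ∈ M.deg 0, ∃ c : ℂ, m = c • F.one) (hr : ∀ k, k ≠ 0 → M.deg k ≤ rad X M)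
    (p : R ⊗[ℂ] R) (k l : ℤ) :
    inv p X k (M.shift l) = if k + l = 0 ∧ M.act p F.one = 0 then 1 else 0 := by
  have hann : ∀ m : M, m ∈ (ann p k (M.shift l) : Submodule ℂ (M.shift l)) ↔
      m ∈ M.deg (k + l) ∧ M.act p m = 0 := fun m => Iff.rfl
  have hrad : ∀ m : M, m ∈ (rad X (M.shift l) : Submodule ℂ (M.shift l)) ↔ m ∈ rad X M :=
    fun m => Iff.rfl
  have hone : F.one ≠ 0 := fun h => F.one_notMem_rad hX hA (h ▸ zero_mem _)
  by_cases hk : k + l = 0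
  · by_cases hp : M.act p F.one = 0
    · rw [if_pos ⟨hk, hp⟩]
      have e1 : ann p k (M.shift l) = Submodule.span ℂ {(M.toShift l F.one : M.shift l)} := by
        refine le_antisymm (fun m hm => ?_) ?_
        · obtain ⟨c, hc⟩ := h0 m (hk ▸ ((hann m).1 hm).1)
          exact Submodule.mem_span_singleton.2 ⟨c, hc.symm⟩
        · rw [Submodule.span_singleton_le_iff_mem]
          exact (hann _).2 ⟨hk ▸ F.one_mem, hp⟩
      have e2 : ann p k (M.shift l) ⊓ rad X (M.shift l) = ⊥ := by
        rw [eq_bot_iff]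
        rintro m ⟨hm, hm'⟩
        obtain ⟨c, hc⟩ := h0 m (hk ▸ ((hann m).1 hm).1)
        have h2 : c • F.one ∈ rad X M := hc ▸ (hrad m).1 hm'
        by_cases hc0 : c = 0
        · rw [hc0, zero_smul] at hc
          exact hc
        · refine (F.one_notMem_rad hX hA ?_).elim
          have := (rad X M).smul_mem c⁻¹ h2
          rwa [smul_smul, inv_mul_cancel₀ hc0, one_smul] at this
      have hone' : M.toShift l F.one ≠ 0 := by simpa using hone
      rw [inv, e2, e1, finrank_span_singleton hone']
      simp
    · rw [if_neg (fun h => hp h.2)]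
      have e1 : ann p k (M.shift l) = ⊥ := by
        rw [eq_bot_iff]
        intro m hm
        obtain ⟨h1, h2⟩ := (hann m).1 hm
        obtain ⟨c, hc⟩ := h0 m (hk ▸ h1)
        rw [hc, map_smul] at h2
        rcases smul_eq_zero.1 h2 with h | h
        · rw [h, zero_smul] at hc
          exact hc
        · exact (hp h).elim
      rw [inv, e1]
      simp
  · rw [if_neg (fun h => hk h.1)]
    have e1 : ann p k (M.shift l) ⊓ rad X (M.shift l) = ann p k (M.shift l) :=
      inf_eq_left.2 fun m hm => hr _ hk ((hann m).1 hm).1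
    rw [inv, e1, sub_self]

end FunModel

/-! ### The case of a one-dimensional space. -/

section Line

variable (φ : V ≃ₗ[ℂ] ℂ)

/-- The coordinate function on `V`. -/
def coord : coordRing V := lin Set.univ φ.toLinearMap

theorem eval_coord (v : V) : coordRing.eval (coord φ) v = φ v := rfl

theorem coord_mem : coord φ ∈ regDeg (Set.univ : Set V) 2 :=
  pow_le_regDeg _ 1 (by rw [pow_one]; exact ⟨φ.toLinearMap, rfl⟩)

theorem lin_eq_smul_coord (ψ : Module.Dual ℂ V) :
    ∃ c : ℂ, lin (Set.univ : Set V) ψ = c • coord φ := by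
  refine ⟨ψ (φ.symm 1), coordRing_ext fun v => ?_⟩
  have : v = φ v • φ.symm 1 := by
    rw [← map_smul, smul_eq_mul, mul_one, φ.symm_apply_apply]
  change ψ v = ψ (φ.symm 1) * φ v
  conv_lhs => rw [this, map_smul, smul_eq_mul, mul_comm]

theorem adjoin_coord : Algebra.adjoin ℂ {coord φ} = (⊤ : Subalgebra ℂ (coordRing V)) := by
  rw [← Subalgebra.map_injective (f := (regFun (Set.univ : Set V)).val) Subtype.val_injective |>.eq_iff]
  rw [AlgHom.map_adjoin, Algebra.map_top, Subalgebra.range_val, Set.image_singleton]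
  refine le_antisymm (Algebra.adjoin_le ?_) (Algebra.adjoin_le ?_)
  · rintro _ rfl
    exact (coord φ).2
  · rintro _ ⟨ψ, rfl⟩
    have : linForm Set.univ ψ = ψ (φ.symm 1) • (coord φ).1 := by
      funext v
      have : v.1 = φ v.1 • φ.symm 1 := by
        rw [← map_smul, smul_eq_mul, mul_one, φ.symm_apply_apply]
      change ψ v.1 = ψ (φ.symm 1) * φ v.1
      conv_lhs => rw [this, map_smul, smul_eq_mul, mul_comm]
    rw [this]
    refine Subalgebra.smul_mem _ (Algebra.subset_adjoin ?_) _
    exact Set.mem_singleton _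

theorem exists_polynomial {Z : Set V} (hZ : ∀ c : ℂ, ∀ z ∈ Z, c • z ∈ Z) (f : regFun Z) (z : Z) :
    ∃ p : Polynomial ℂ, ∀ c : ℂ, f.1 ⟨c • z.1, hZ c z z.2⟩ = p.eval c := by
  obtain ⟨f, hf⟩ := f
  induction hf using Algebra.adjoin_induction with
  | mem x hx =>
    obtain ⟨ψ, rfl⟩ := hx
    refine ⟨Polynomial.C (ψ z.1) * Polynomial.X, fun c => ?_⟩
    change ψ (c • z.1) = _
    rw [map_smul, smul_eq_mul, Polynomial.eval_mul, Polynomial.eval_C, Polynomial.eval_X, mul_comm]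
  | algebraMap c => exact ⟨Polynomial.C c, fun _ => by simp⟩
  | add x y hx hy h1 h2 =>
    obtain ⟨p, hp⟩ := h1
    obtain ⟨q, hq⟩ := h2
    exact ⟨p + q, fun c => by simp [← hp, ← hq]⟩
  | mul x y hx hy h1 h2 =>
    obtain ⟨p, hp⟩ := h1
    obtain ⟨q, hq⟩ := h2
    exact ⟨p * q, fun c => by simp [← hp, ← hq]⟩

/-- The only points excluded by the hypothesis are at the origin. Along the line through `(a v, v)`
the function is a polynomial with infinitely many zeros, so it vanishes at the origin too. -/
theorem eq_zero_of_val {A : Set (V ≃ₗ[ℂ] V)} [Nontrivial V] (m : bimod A)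
    (h : ∀ z : Gr A, z.1.2 ≠ 0 → val A m z = 0) : m = 0 := by
  apply val_injective
  rw [map_zero]
  funext z
  by_cases hz : z.1.2 = 0
  · obtain ⟨⟨u, w⟩, a, ha, hu⟩ := z
    simp only at hz hu
    subst hz
    obtain ⟨v, hv⟩ := exists_ne (0 : V)
    obtain ⟨p, hp⟩ := exists_polynomial (Gr_cone A) (fn A m) ⟨(a v, v), a, ha, rfl⟩
    have hp0 : p = 0 := by
      refine Polynomial.eq_zero_of_infinite_isRoot p (Set.Infinite.mono (s := {0}ᶜ) ?_
        (Set.Finite.infinite_compl (Set.finite_singleton 0)))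
      intro c hc
      rw [Set.mem_ofPred_eq, Polynomial.IsRoot.def, ← hp]
      exact h _ (smul_ne_zero hc hv)
    have h0 := hp 0
    rw [hp0, Polynomial.eval_zero] at h0
    rw [Pi.zero_apply, ← h0]
    refine congrArg (val A m) (Subtype.ext ?_)
    simp [hu]
  · exact h z hz

theorem deg_le_rad {A : Set (V ≃ₗ[ℂ] V)} {k : ℤ} (hk : k ≠ 0) :
    (bimod A).deg k ≤ rad (coord φ) (bimod A) := by
  have hl : ∀ ψ m, (bimod A).lact (lin Set.univ ψ) m ∈ rad (coord φ) (bimod A) := fun ψ m => by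
    obtain ⟨c, hc⟩ := lin_eq_smul_coord φ ψ
    rw [hc, map_smul]
    exact Submodule.smul_mem _ c (Submodule.mem_sup_left ⟨m, rfl⟩)
  have hr : ∀ ψ m, (bimod A).ract (lin Set.univ ψ) m ∈ rad (coord φ) (bimod A) := fun ψ m => by
    obtain ⟨c, hc⟩ := lin_eq_smul_coord φ ψ
    rw [hc, map_smul]
    exact Submodule.smul_mem _ c (Submodule.mem_sup_right ⟨m, rfl⟩)
  have : regDeg (Gr A) k ≤ (rad (coord φ) (bimod A)).comap (fn A).symm.toLinearMap := by
    refine iSup₂_le fun n hn => ?_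
    obtain ⟨n, rfl⟩ : ∃ n', n = n' + 1 := ⟨n - 1, by omega⟩
    -- The condition must be void in degree `0`, since `1` is not in `rad`; a single multiplication
    -- by a form, a multiple of the coordinate, already lands there.
    exact fn_symm_mem_of_pow (fun n => if n = 0 then ⊤ else rad (coord φ) (bimod A)) (by simp)
      (fun ψ k m _ => by simpa using hl ψ m) (fun ψ k m _ => by simpa using hr ψ m) (n + 1)
  exact this

theorem pair_tens {s : V ≃ₗ[ℂ] V} {A U D : Set (V ≃ₗ[ℂ] V)} {ζ : ℂ}
    (hs : ∀ v, φ (s v) = ζ * φ v) (hζ1 : ζ ≠ 1) (hζ0 : ζ ≠ 0)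
    (hU : ∀ a, a ∈ U ↔ a ∈ A ∨ s⁻¹ * a ∈ A) (hD : ∀ a, a ∈ D ↔ a ∈ A ∧ s⁻¹ * a ∈ A)
    {α β γ : ℂ} (hβ : β ≠ 0)
    (hg1 : ∀ a ∈ A, s⁻¹ * a ∉ A → ∀ v, α * φ (a v) + β * φ (a v) + γ * φ v = 0)
    (hg2 : ∀ a ∈ A, s * a ∉ A → ∀ v, α * φ (s (a v)) + β * φ (a v) + γ * φ v = 0) :
    (bimod {1, s}).tens (bimod A) ≈ (bimod U).sum ((bimod D).shift (-2)) :=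
  have : Nontrivial V := φ.toEquiv.nontrivial
  (bimodModel {1, s}).pair_tens (bimodModel A) (bimodModel U) (bimodModel D) hs hζ1 hζ0
    (eval_coord φ) (adjoin_coord φ) (coord_mem φ) eq_zero_of_val eq_zero_of_val hU hD hβ hg1 hg2

open Classical in
theorem inv_bimod {A : Set (V ≃ₗ[ℂ] V)} (hA : A.Nonempty) (p : coordRing V ⊗[ℂ] coordRing V)
    (k l : ℤ) :
    inv p (coord φ) k ((bimod A).shift l) =
      if k + l = 0 ∧ (bimod A).act p (one A) = 0 then 1 else 0 :=
  (bimodModel A).inv_shift (eval_coord φ) hA (fun _ => mem_deg_zero) (fun _ => deg_le_rad φ) p k l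

theorem val_act_lineProd {A : Set (V ≃ₗ[ℂ] V)} (χ : ℕ → ℂ) (n : ℕ) (z : Gr A) :
    val A ((bimod A).act (FunModel.lineProd (coord φ) χ n) (one A)) z =
      ∏ j ∈ Finset.range n, (φ z.1.1 - χ j * φ z.1.2) :=
  ((bimodModel A).val_act_lineProd (eval_coord φ) χ n (one A) z).trans (mul_one _)

end Line

end RegFun

/-! ### Chebyshev-type polynomials in two commuting elements. -/

namespace Pres

section Cheb

variable {A : Type*} [Ring A]

/-- `∑ᵢ binom(n - i, i) (-s)ⁱ cⁿ⁻²ⁱ`. -/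
def cheb (s c : A) (n : ℕ) : A :=
  ∑ i ∈ Finset.range (n / 2 + 1), (n - i).choose i • ((-s) ^ i * c ^ (n - 2 * i))

/-- Past `n / 2` the binomial coefficient vanishes, so the truncated exponent `n - 2 * i` is
harmless; a range without division makes the recursion easier to compare termwise. -/
theorem cheb_eq_sum_range (s c : A) (n : ℕ) :
    cheb s c n = ∑ i ∈ Finset.range (n + 1), (n - i).choose i • ((-s) ^ i * c ^ (n - 2 * i)) := by
  refine Finset.sum_subset (fun i hi => ?_) fun i _ hi => ?_
  · rw [Finset.mem_range] at hi ⊢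
    omega
  · rw [Finset.mem_range] at hi
    rw [Nat.choose_eq_zero_of_lt (by omega), zero_smul]

theorem cheb_zero (s c : A) : cheb s c 0 = 1 := by simp [cheb]

theorem cheb_one (s c : A) : cheb s c 1 = c := by simp [cheb]

/-- Pascal's rule, applied to the terms of index `i + 1` after splitting off the leading power of
`c`. -/
theorem cheb_add_two {s c : A} (h : s * c = c * s) (n : ℕ) :
    cheb s c (n + 2) = c * cheb s c (n + 1) - s * cheb s c n := by
  have hc : ∀ i, c * (-s) ^ i = (-s) ^ i * c := fun i =>
    ((Commute.neg_right (show Commute c s from h.symm)).pow_right i).eq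
  have h1 : cheb s c (n + 1) = c ^ (n + 1) + ∑ i ∈ Finset.range (n + 1),
      (n - i).choose (i + 1) • ((-s) ^ (i + 1) * c ^ (n + 1 - 2 * (i + 1))) := by
    rw [cheb_eq_sum_range, Finset.sum_range_succ', add_comm]
    simp [Nat.add_sub_add_right]
  have h2 : cheb s c (n + 2) = c ^ (n + 2) + ∑ i ∈ Finset.range (n + 1),
      (n + 1 - i).choose (i + 1) • ((-s) ^ (i + 1) * c ^ (n - 2 * i)) := by
    rw [cheb_eq_sum_range, Finset.sum_range_succ', Finset.sum_range_succ, add_comm]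
    congr 1
    · simp
    · rw [Nat.choose_eq_zero_of_lt (by omega), zero_smul, add_zero]
      refine Finset.sum_congr rfl fun i _ => ?_
      rw [show n + 2 - (i + 1) = n + 1 - i by omega, show n + 2 - 2 * (i + 1) = n - 2 * i by omega]
  rw [h1, h2, mul_add, ← pow_succ', add_sub_assoc]
  congr 1
  rw [cheb_eq_sum_range, Finset.mul_sum, Finset.mul_sum, ← Finset.sum_sub_distrib]
  refine Finset.sum_congr rfl fun i hi => ?_
  rw [Finset.mem_range] at hi
  rw [show n + 1 - i = (n - i) + 1 by omega, Nat.choose_succ_succ, add_smul, mul_smul_comm,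
    mul_smul_comm, ← mul_assoc, ← mul_assoc, hc, add_comm]
  have h3 : s * (-s) ^ i = -(-s) ^ (i + 1) := by rw [pow_succ', neg_mul, neg_neg]
  rw [h3, neg_mul, smul_neg, sub_neg_eq_add]
  congr 1
  -- The exponents match only when the subtraction is not truncated; otherwise the binomial
  -- coefficient is `0`.
  by_cases hn : 2 * i + 1 ≤ n
  · rw [mul_assoc, ← pow_succ', show n + 1 - 2 * (i + 1) + 1 = n - 2 * i by omega]
  · rw [Nat.choose_eq_zero_of_lt (by omega), zero_smul, zero_smul]

/-- The recursion is required only up to `N`, because the fusion rule for arcs changes once the arc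
is the whole group. -/
theorem eq_cheb {s c : A} (h : s * c = c * s) (b : ℕ → A) (N : ℕ) (h0 : b 0 = 1) (h1 : b 1 = c)
    (h2 : ∀ n, n + 2 ≤ N → b (n + 2) = c * b (n + 1) - s * b n) :
    ∀ n, n ≤ N → b n = cheb s c n := by
  intro n
  induction n using Nat.strong_induction_on with
  | _ n ih =>
    intro hn
    match n, ih, hn with
    | 0, _, _ => rw [h0, cheb_zero]
    | 1, _, _ => rw [h1, cheb_one]
    | n + 2, ih, hn =>
      rw [h2 n hn, cheb_add_two h, ih n (by omega) (by omega), ih (n + 1) (by omega) (by omega)]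

theorem map_cheb {B : Type*} [Ring B] (f : A →+* B) (s c : A) (n : ℕ) :
    f (cheb s c n) = cheb (f s) (f c) n := by
  simp [cheb, map_sum]

end Cheb

theorem Clast_eq (d : ℕ) : Clast d = cheb S C (d - 1) := rfl

/-! ### A spanning family of the presented algebra. -/

section Span

variable (d : ℕ)

theorem mk_Clast : mk d (Clast d) = cheb (mk d S) (mk d C) (d - 1) := by
  have h := map_cheb (A := Free) (B := Alg d) (mk d : Free →+* Alg d) S C (d - 1)
  exact h

theorem mk_S_pow : mk d S ^ d = 1 := by
  rw [← map_pow, ← map_one (mk d)]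
  exact RingQuot.mkAlgHom_rel _ Rel.s_pow

theorem mk_comm : mk d S * mk d C = mk d C * mk d S := by
  rw [← map_mul, ← map_mul]
  exact RingQuot.mkAlgHom_rel _ Rel.comm

theorem mk_S_mul : mk d S * mk d (Clast d) = mk d (Clast d) := by
  rw [← map_mul]
  exact RingQuot.mkAlgHom_rel _ Rel.s_mul

theorem mk_C_mul : mk d C * mk d (Clast d) =
    (LaurentPolynomial.T 1 + LaurentPolynomial.T (-1) : ℤ[T;T⁻¹]) • mk d (Clast d) := by
  rw [← map_mul, ← map_smul]
  exact RingQuot.mkAlgHom_rel _ Rel.C_mul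

/-- The elements `sⁱ Cₙ`, `n < d - 1`, and `C_{d-1}`. -/
noncomputable def spanning : Option (Fin d × Fin (d - 1)) → Alg d
  | none => mk d (Clast d)
  | some x => mk d S ^ (x.1 : ℕ) * cheb (mk d S) (mk d C) x.2

/-- The span contains `1` and is stable under left multiplication by both generators. For `s`, use
`s ^ d = 1` and `s C_{d-1} = C_{d-1}`; for `C`, read the recursion as `C C_n = C_{n+1} + s C_{n-1}`
below the top, and use the last relation at the top. -/
theorem span_spanning (hd : 2 < d) :
    Submodule.span ℤ[T;T⁻¹] (Set.range (spanning d)) = ⊤ := by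
  set L := Submodule.span ℤ[T;T⁻¹] (Set.range (spanning d)) with hL
  set s := mk d S with hs
  set c := mk d C with hc
  have hcs : ∀ i, c * s ^ i = s ^ i * c := fun i =>
    (Commute.pow_right (show Commute c s from (mk_comm d).symm) i).eq
  have h0 : mk d (Clast d) ∈ L := Submodule.subset_span ⟨none, rfl⟩
  have h1 : ∀ i n, n < d → s ^ i * cheb s c n ∈ L := by
    intro i n hn
    by_cases hn' : n < d - 1
    · rw [← Nat.mod_add_div i d, pow_add, pow_mul, mk_S_pow, one_pow, mul_one]
      exact Submodule.subset_span ⟨some (⟨i % d, Nat.mod_lt _ (by omega)⟩, ⟨n, hn'⟩), rfl⟩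
    · obtain rfl : n = d - 1 := by omega
      rw [← mk_Clast]
      induction i with
      | zero => rwa [pow_zero, one_mul]
      | succ i ih => rwa [pow_succ, mul_assoc, mk_S_mul]
  have hS : ∀ x ∈ L, s * x ∈ L := by
    intro x hx
    have : L ≤ L.comap (LinearMap.mulLeft ℤ[T;T⁻¹] s) := by
      rw [hL, Submodule.span_le]
      rintro _ ⟨(_ | x), rfl⟩
      · change s * mk d (Clast d) ∈ L
        rwa [mk_S_mul]
      · change s * (s ^ (x.1 : ℕ) * cheb s c x.2) ∈ L
        rw [← mul_assoc, ← pow_succ']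
        exact h1 _ _ (by omega)
    exact this hx
  have hC : ∀ x ∈ L, c * x ∈ L := by
    intro x hx
    have : L ≤ L.comap (LinearMap.mulLeft ℤ[T;T⁻¹] c) := by
      rw [hL, Submodule.span_le]
      rintro _ ⟨(_ | ⟨i, n, hn⟩), rfl⟩
      · change c * mk d (Clast d) ∈ L
        rw [mk_C_mul]
        exact L.smul_mem _ h0
      · change c * (s ^ (i : ℕ) * cheb s c n) ∈ L
        rw [← mul_assoc, hcs, mul_assoc]
        rcases n with _ | n
        · have h2 := h1 i 1 (by omega)
          rw [cheb_one] at h2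
          rwa [cheb_zero, mul_one]
        · have h2 : c * cheb s c (n + 1) = cheb s c (n + 2) + s * cheb s c n := by
            rw [cheb_add_two (mk_comm d)]; abel
          rw [h2, mul_add, ← mul_assoc, ← pow_succ]
          exact L.add_mem (h1 _ _ (by omega)) (h1 _ _ (by omega))
    exact this hx
  have key : ∀ a : Free, ∀ x ∈ L, mk d a * x ∈ L := by
    intro a
    induction a using FreeAlgebra.induction with
    | grade0 r =>
      intro x hx
      rw [AlgHom.commutes, ← Algebra.smul_def]
      exact L.smul_mem r hx
    | grade1 g =>
      cases g with
      | s => exact hS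
      | C => exact hC
    | mul a b ha hb =>
      intro x hx
      rw [map_mul, mul_assoc]
      exact ha _ (hb x hx)
    | add a b ha hb =>
      intro x hx
      rw [map_add, add_mul]
      exact L.add_mem (ha x hx) (hb x hx)
  rw [eq_top_iff]
  intro y _
  obtain ⟨a, rfl⟩ := RingQuot.mkAlgHom_surjective ℤ[T;T⁻¹] (Rel d) y
  have h2 := h1 0 0 (by omega)
  rw [pow_zero, one_mul, cheb_zero] at h2
  have := key a 1 h2
  rwa [mul_one] at this

theorem exists_hom {A : Type*} [Ring A] [Algebra ℤ[T;T⁻¹] A] (s c : A) (h1 : s ^ d = 1)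
    (h2 : s * c = c * s) (h3 : s * cheb s c (d - 1) = cheb s c (d - 1))
    (h4 : c * cheb s c (d - 1) =
      (LaurentPolynomial.T 1 + LaurentPolynomial.T (-1) : ℤ[T;T⁻¹]) • cheb s c (d - 1)) :
    ∃ f : Alg d →ₐ[ℤ[T;T⁻¹]] A, f (mk d S) = s ∧ f (mk d C) = c := by
  let g : Free →ₐ[ℤ[T;T⁻¹]] A := FreeAlgebra.lift _ fun x => match x with
    | Gen.s => s
    | Gen.C => c
  have gs : g S = s := by simp [g, S]
  have gc : g C = c := by simp [g, C]
  have gl : g (Clast d) = cheb s c (d - 1) := by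
    rw [Clast_eq, ← gs, ← gc]
    exact map_cheb (g : Free →+* A) S C (d - 1)
  have hg : ∀ ⦃x y⦄, Rel d x y → g x = g y := by
    intro x y h
    cases h with
    | s_pow => rw [map_pow, gs, h1, map_one]
    | comm => rw [map_mul, map_mul, gs, gc, h2]
    | s_mul => rw [map_mul, gl, gs, h3]
    | C_mul => rw [map_mul, map_smul, gl, gc, h4]
  exact ⟨RingQuot.liftAlgHom _ ⟨g, hg⟩,
    (RingQuot.liftAlgHom_mkAlgHom_apply _ _ _ _).trans gs,
    (RingQuot.liftAlgHom_mkAlgHom_apply _ _ _ _).trans gc⟩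

end Span

end Pres

/-! ### The defining relations deduced from the fusion rules. -/

open LaurentPolynomial in
/-- Chebyshev elements and the defining relations of `Pres.Alg d`, for elements `b i n` of an algebra
multiplied by `b 1 1` and `b 0 2` like the classes of the bimodules of functions on arcs of a
cyclic group of order `d`. -/
theorem Pres.relations_of_fusion {A : Type*} [Ring A] [Algebra ℤ[T;T⁻¹] A] {d : ℕ} (hd : 2 < d)
    (b : ℕ → ℕ → A) (hzero : ∀ i, b i 0 = 0) (hone : b 0 1 = 1) (hperiod : b d 1 = 1)
    (htop : ∀ i, b i d = b 0 d) (htwist : ∀ i n, b 1 1 * b i n = b (i + 1) n)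
    (hfusion : ∀ i n, n + 1 < d →
      b 0 2 * b i (n + 1) = b i (n + 2) + (T (-2) : ℤ[T;T⁻¹]) • b (i + 1) n)
    (hfusion_top : b 0 2 * b 0 d = b 0 d + (T (-2) : ℤ[T;T⁻¹]) • b 0 d) :
    (∀ i n, b i n = b 1 1 ^ i * b 0 n) ∧
    b 1 1 ^ d = 1 ∧
    b 1 1 * ((T 1 : ℤ[T;T⁻¹]) • b 0 2) = ((T 1 : ℤ[T;T⁻¹]) • b 0 2) * b 1 1 ∧
    (∀ n, n ≤ d - 1 →
      (T n : ℤ[T;T⁻¹]) • b 0 (n + 1) = cheb (b 1 1) ((T 1 : ℤ[T;T⁻¹]) • b 0 2) n) ∧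
    b 1 1 * cheb (b 1 1) ((T 1 : ℤ[T;T⁻¹]) • b 0 2) (d - 1) =
      cheb (b 1 1) ((T 1 : ℤ[T;T⁻¹]) • b 0 2) (d - 1) ∧
    ((T 1 : ℤ[T;T⁻¹]) • b 0 2) * cheb (b 1 1) ((T 1 : ℤ[T;T⁻¹]) • b 0 2) (d - 1) =
      (T 1 + T (-1) : ℤ[T;T⁻¹]) • cheb (b 1 1) ((T 1 : ℤ[T;T⁻¹]) • b 0 2) (d - 1) := by
  have hpow : ∀ i n, b i n = b 1 1 ^ i * b 0 n := by
    intro i n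
    induction i with
    | zero => rw [pow_zero, one_mul]
    | succ i ih => rw [← htwist, ih, pow_succ', mul_assoc]
  -- Both products equal `v b 1 2`: one by rotation, the other by the fusion rule for an arc of
  -- length one, whose second term is the empty arc.
  have hcomm : b 1 1 * ((T 1 : ℤ[T;T⁻¹]) • b 0 2) = ((T 1 : ℤ[T;T⁻¹]) • b 0 2) * b 1 1 := by
    rw [mul_smul_comm, smul_mul_assoc, htwist, hfusion 1 0 (by omega), hzero, smul_zero, add_zero]
  -- The weight `vⁿ` on an arc of length `n + 1` absorbs the shift: `v ^ (n + 2) * v ^ (-2) = v ^ n`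
  -- turns the fusion rule into the recursion for `cheb`.
  have hcheb : ∀ n, n ≤ d - 1 →
      (T n : ℤ[T;T⁻¹]) • b 0 (n + 1) = cheb (b 1 1) ((T 1 : ℤ[T;T⁻¹]) • b 0 2) n := by
    refine eq_cheb hcomm (fun n => (T n : ℤ[T;T⁻¹]) • b 0 (n + 1)) _ ?_ ?_ ?_
    · simp [hone]
    · simp
    · intro n hn
      change (T ((n + 2 : ℕ) : ℤ) : ℤ[T;T⁻¹]) • b 0 (n + 3) =
        (T 1 : ℤ[T;T⁻¹]) • b 0 2 * ((T ((n + 1 : ℕ) : ℤ) : ℤ[T;T⁻¹]) • b 0 (n + 2)) -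
        b 1 1 * ((T (n : ℤ) : ℤ[T;T⁻¹]) • b 0 (n + 1))
      rw [smul_mul_smul_comm, mul_smul_comm, htwist, hfusion 0 (n + 1) (by omega), smul_add,
        smul_smul, ← T_add, ← T_add, zero_add]
      rw [show (1 : ℤ) + ((n + 1 : ℕ) : ℤ) = ((n + 2 : ℕ) : ℤ) by push_cast; ring,
        show ((n + 2 : ℕ) : ℤ) + -2 = n by push_cast; ring, add_sub_cancel_right]
  have hlast : (T ((d - 1 : ℕ) : ℤ) : ℤ[T;T⁻¹]) • b 0 d =
      cheb (b 1 1) ((T 1 : ℤ[T;T⁻¹]) • b 0 2) (d - 1) := by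
    rw [← hcheb (d - 1) le_rfl, Nat.sub_add_cancel (by omega)]
  refine ⟨hpow, ?_, hcomm, hcheb, ?_, ?_⟩
  · rw [← hperiod, hpow d 1, hone, mul_one]
  · rw [← hlast, mul_smul_comm, htwist, htop]
  -- Here `v (1 + v⁻²) = v + v⁻¹`.
  · rw [← hlast, smul_mul_smul_comm, hfusion_top, smul_smul, smul_add, smul_smul, ← add_smul,
      add_mul]
    simp only [← T_add]
    rw [show (1 : ℤ) + ((d - 1 : ℕ) : ℤ) + -2 = -1 + ((d - 1 : ℕ) : ℤ) by ring]

/-! ### From an abstract system of arc bimodules to the presentation. -/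

namespace GrBimod

/-- An equality rather than an isomorphism, because `Indec` asks for objects equal to a shift of
some `B i n`. -/
theorem shift_shift_eq {R : Type u} [CommRing R] [Algebra ℂ R] {𝓡 : ℤ → Submodule ℂ R}
    (M : GrBimod 𝓡) (k l : ℤ) : (M.shift k).shift l = M.shift (k + l) := by
  simp only [shift, add_assoc, add_comm l k]

section ArcSystem

variable {R : Type u} [CommRing R] [Algebra ℂ R] {𝓡 : ℤ → Submodule ℂ R} [GradedAlgebra 𝓡]

/-- Bimodules `B i n` having the formal properties of the bimodules of functions on the arcs
`{sⁱ, …, sⁱ⁺ⁿ⁻¹}` of a cyclic group `⟨s⟩` of order `d`. -/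
structure ArcSystem (𝓡 : ℤ → Submodule ℂ R) [GradedAlgebra 𝓡] (d : ℕ) where
  two_lt : 2 < d
  B : ℕ → ℕ → GrBimod 𝓡
  zero : ∀ i, Subsingleton (B i 0)
  nontrivial : ∀ i n, 0 < n → Nontrivial (B i n)
  unit : regular 𝓡 ≈ B 0 1
  period : B d 1 ≈ B 0 1
  top : ∀ i n, d ≤ n → B i n ≈ B 0 d
  twist : ∀ i n, (B 1 1).tens (B i n) ≈ B (i + 1) n
  fusion : ∀ i n, n + 1 < d →
    (B 0 2).tens (B i (n + 1)) ≈ (B i (n + 2)).sum ((B (i + 1) n).shift (-2))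
  fusion_top : (B 0 2).tens (B 0 d) ≈ (B 0 d).sum ((B 0 d).shift (-2))
  end_scalar : ∀ i n k (f : Hom ((B i n).shift k) ((B i n).shift k)), ∃ c : ℂ, ∀ x, f.toLin x = c • x
  finite : ∀ i n k, FiniteDimensional ℂ ((B i n).deg k)
  W : Type u
  arc : ℕ → ℕ → Set W
  arc_inj : ∀ i n j m, i < d → j < d → n < d - 1 → m < d - 1 →
    arc i (n + 1) = arc j (m + 1) → i = j ∧ n = m
  arc_ne_top : ∀ i n, n < d - 1 → arc i (n + 1) ≠ arc 0 d
  X : R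
  p : ℕ → ℕ → R ⊗[ℂ] R
  inv_of_subset : ∀ i n j m k l, 0 < m → arc j m ⊆ arc i n → k + l = 0 →
    inv (p i n) X k ((B j m).shift l) = 1
  inv_of_not : ∀ i n j m k l, 0 < m → ¬ (arc j m ⊆ arc i n ∧ k + l = 0) →
    inv (p i n) X k ((B j m).shift l) = 0

namespace ArcSystem

variable {d : ℕ} (𝓐 : ArcSystem 𝓡 d)

/-- The generator of the category. -/
abbrev G : GrBimod 𝓡 := 𝓐.B 0 2

/-- Tensoring with the generator lengthens an arc with given start through the first summand of the
fusion rule. The start moves by one through the second summand, applied to an arc of length `2`,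
which is allowed because `2 < d`. -/
theorem generated (i n : ℕ) : Generated 𝓐.G (𝓐.B i n) := by
  have hd := 𝓐.two_lt
  have climb : ∀ i, Generated 𝓐.G (𝓐.B i 1) →
      ∀ n, Generated 𝓐.G (𝓐.B i n) ∧ Generated 𝓐.G (𝓐.B i (n + 1)) := by
    intro i hi n
    induction n with
    | zero => exact ⟨.of_subsingleton (𝓐.zero i), hi⟩
    | succ n ih =>
      refine ⟨ih.2, ?_⟩
      by_cases hn : n + 1 < d
      · exact (Generated.gen.tens ih.2).of_sum_left (𝓐.fusion i n hn)
      · exact ih.2.congr (Setoid.trans (𝓐.top i _ (by omega))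
          (Setoid.symm (𝓐.top i _ (by omega))))
  suffices ∀ i, Generated 𝓐.G (𝓐.B i 1) from (climb i (this i) n).1
  intro i
  induction i with
  | zero => exact Generated.unit.congr 𝓐.unit
  | succ i ih =>
    exact ((Generated.gen.tens (climb i ih 1).2).of_sum_right (𝓐.fusion i 1 hd)).of_shift

/-- The class of `B i n`. -/
noncomputable def b (i n : ℕ) : GrothRing 𝓐.G := cls (𝓐.B i n) (𝓐.generated i n)

theorem b_zero (i : ℕ) : 𝓐.b i 0 = 0 := cls_eq_zero _ (𝓐.zero i)

theorem b_one : 𝓐.b 0 1 = 1 := cls_eq (Setoid.symm 𝓐.unit)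

theorem b_period : 𝓐.b d 1 = 1 := (cls_eq 𝓐.period).trans 𝓐.b_one

theorem b_top (i n : ℕ) (hn : d ≤ n) : 𝓐.b i n = 𝓐.b 0 d := cls_eq (𝓐.top i n hn)

theorem b_twist (i n : ℕ) : 𝓐.b 1 1 * 𝓐.b i n = 𝓐.b (i + 1) n :=
  (cls_mul _ _).trans (cls_eq (𝓐.twist i n))

theorem T_smul_b (i n : ℕ) (k : ℤ) : (LaurentPolynomial.T k : ℤ[T;T⁻¹]) • 𝓐.b i n =
    cls ((𝓐.B i n).shift k) ((𝓐.generated i n).shift k) := T_smul_cls _ _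

theorem b_fusion (i n : ℕ) (hn : n + 1 < d) : 𝓐.b 0 2 * 𝓐.b i (n + 1) =
    𝓐.b i (n + 2) + (LaurentPolynomial.T (-2) : ℤ[T;T⁻¹]) • 𝓐.b (i + 1) n := by
  rw [T_smul_b]
  exact (cls_mul _ _).trans (cls_of_sum _ _ _ (𝓐.fusion i n hn))

theorem b_fusion_top : 𝓐.b 0 2 * 𝓐.b 0 d =
    𝓐.b 0 d + (LaurentPolynomial.T (-2) : ℤ[T;T⁻¹]) • 𝓐.b 0 d := by
  rw [T_smul_b]
  exact (cls_mul _ _).trans (cls_of_sum _ _ _ 𝓐.fusion_top)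

/-- The shifts of the nonzero bimodules `B i n`. -/
def Indec (M : GrBimod 𝓡) : Prop := ∃ i n k, 0 < n ∧ M = (𝓐.B i n).shift k

theorem Indec.shift {M : GrBimod 𝓡} (k : ℤ) (hM : 𝓐.Indec M) : 𝓐.Indec (M.shift k) := by
  obtain ⟨i, n, l, hn, rfl⟩ := hM
  exact ⟨i, n, l + k, hn, shift_shift_eq _ _ _⟩

theorem isSum_B (i n : ℕ) : IsSum 𝓐.Indec (𝓐.B i n) := by
  rcases Nat.eq_zero_or_pos n with rfl | hn
  · exact .zero (𝓐.zero i)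
  · exact (IsSum.single ⟨i, n, 0, hn, rfl⟩ (𝓐.zero 0)).congr (Setoid.symm (shift_zero _))

theorem isSum_tens {M : GrBimod 𝓡} (hM : 𝓐.Indec M) : IsSum 𝓐.Indec (𝓐.G.tens M) := by
  obtain ⟨i, n, k, hn, rfl⟩ := hM
  obtain ⟨n, rfl⟩ : ∃ m, n = m + 1 := ⟨n - 1, by omega⟩
  have hS : ∀ M k, 𝓐.Indec M → 𝓐.Indec (M.shift k) := fun M k => Indec.shift 𝓐 k
  refine (IsSum.shift (M := 𝓐.G.tens (𝓐.B i (n + 1))) hS ?_ k).congr (tens_shift _ _ _)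
  by_cases hn' : n + 1 < d
  · exact ((𝓐.isSum_B _ _).sum ((𝓐.isSum_B _ _).shift hS _)).congr (𝓐.fusion i n hn')
  · exact ((𝓐.isSum_B _ _).sum ((𝓐.isSum_B _ _).shift hS _)).congr
      (Setoid.trans (tens_congr (Setoid.refl _) (𝓐.top i _ (by omega))) 𝓐.fusion_top)

/-- All objects of the category generated by `B 0 2` are sums of shifts of the `B i n`. -/
theorem isSum_of_generated {M : GrBimod 𝓡} (hM : Generated 𝓐.G M) : IsSum 𝓐.Indec M := by
  refine hM.isSum (fun M k => Indec.shift 𝓐 k) ((𝓐.isSum_B 0 1).congr 𝓐.unit)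
    (fun M hM => 𝓐.isSum_tens hM) (fun h e => (IsSum.of_summand ?_ ?_ h e).1)
  · rintro _ ⟨i, n, k, hn, rfl⟩
    exact 𝓐.nontrivial i n hn
  · rintro _ ⟨i, n, k, hn, rfl⟩
    exact 𝓐.end_scalar i n k

theorem finite_of_generated {M : GrBimod 𝓡} (hM : Generated 𝓐.G M) (k : ℤ) :
    FiniteDimensional ℂ (M.deg k) := by
  refine (𝓐.isSum_of_generated hM).finiteDimensional_deg ?_ k
  rintro _ ⟨i, n, l, hn, rfl⟩ k
  exact 𝓐.finite i n (k + l)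

open Classical in
/-- A functional extracting the coefficients of the classes of the `B j m`. -/
theorem exists_functional (i n : ℕ) (k : ℤ) : ∃ f : GrothRing 𝓐.G →+ ℤ,
    ∀ (j m : ℕ) (c : ℤ[T;T⁻¹]), 0 < m →
      f (c • 𝓐.b j m) = if 𝓐.arc j m ⊆ 𝓐.arc i n then c.coeff k else 0 := by
  -- The sign: `vᵏ` is the shift by `k`, which moves the degree `0` generator to degree `-k`.
  -- Finite-dimensionality, needed for additivity, holds because all objects are sums of arc
  -- bimodules.
  obtain ⟨f, hf⟩ := exists_addHom (G := 𝓐.G) (inv (𝓐.p i n) 𝓐.X (-k))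
    (fun M N h => inv_congr _ _ _ h) (fun M N hM hN => by
      have := 𝓐.finite_of_generated hM (-k)
      have := 𝓐.finite_of_generated hN (-k)
      exact inv_sum _ _ _ _ _)
  refine ⟨f, fun j m c hm => ?_⟩
  induction c using LaurentPolynomial.induction_on' with
  | add p q hp hq =>
    rw [add_smul, map_add, hp, hq]
    split_ifs <;> simp
  | C_mul_T l a =>
    have h1 : (LaurentPolynomial.C a * LaurentPolynomial.T l : ℤ[T;T⁻¹]) • 𝓐.b j m =
        a • cls ((𝓐.B j m).shift l) ((𝓐.generated j m).shift l) := by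
      rw [← T_smul_b, mul_smul, show LaurentPolynomial.C a = ((a : ℤ) : ℤ[T;T⁻¹]) from
        eq_intCast LaurentPolynomial.C a, Algebra.smul_def (a : ℤ[T;T⁻¹]), map_intCast, zsmul_eq_mul]
    rw [h1, map_zsmul, hf, ← LaurentPolynomial.single_eq_C_mul_T, AddMonoidAlgebra.coeff_single,
      Finsupp.single_apply]
    by_cases h : 𝓐.arc j m ⊆ 𝓐.arc i n
    · rw [if_pos h]
      by_cases hk : l = k
      · rw [𝓐.inv_of_subset i n j m _ _ hm h (by omega), if_pos hk, smul_eq_mul, mul_one]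
      · rw [𝓐.inv_of_not i n j m _ _ hm (fun h' => hk (by omega)), if_neg hk, smul_zero]
    · rw [if_neg h, 𝓐.inv_of_not i n j m _ _ hm (fun h' => h h'.1), smul_zero]

/-- Linear independence of classes of `B i n` for distinct arcs. -/
theorem eq_zero_of_sum_eq_zero {I : Type*} [Fintype I] (st ln : I → ℕ) (hln : ∀ x, 0 < ln x)
    (hinj : Function.Injective fun x => 𝓐.arc (st x) (ln x)) (c : I → ℤ[T;T⁻¹])
    (hc : ∑ x, c x • 𝓐.b (st x) (ln x) = 0) : ∀ x, c x = 0 := by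
  classical
  by_contra! hne
  obtain ⟨x₀, hx₀⟩ := hne
  -- Take an arc minimal for inclusion among those with nonzero coefficient. Its functionals see
  -- only arcs contained in it, hence only its own coefficient, which must therefore vanish.
  obtain ⟨x, hx, hmin⟩ := Finset.exists_minimalFor (fun x => 𝓐.arc (st x) (ln x))
    (Finset.univ.filter fun x => c x ≠ 0) ⟨x₀, by simpa using hx₀⟩
  refine (Finset.mem_filter.1 hx).2 (LaurentPolynomial.ext fun k => ?_)
  obtain ⟨f, hf⟩ := 𝓐.exists_functional (st x) (ln x) k
  have h1 := congrArg f hc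
  rw [map_zero, map_sum, Finset.sum_eq_single x] at h1
  · rw [hf _ _ _ (hln x), if_pos subset_rfl] at h1
    exact h1
  · intro y _ hy
    rw [hf _ _ _ (hln y)]
    by_cases hcy : c y = 0
    · simp [hcy]
    · rw [if_neg]
      intro hsub
      exact hy (hinj (le_antisymm hsub (hmin (Finset.mem_filter.2 ⟨Finset.mem_univ _, hcy⟩) hsub)))
  · exact fun h => absurd (Finset.mem_univ x) h

/-- The presentation of the Grothendieck ring. -/
theorem exists_presentation : ∃ e : Pres.Alg d ≃ₐ[ℤ[T;T⁻¹]] GrothRing 𝓐.G,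
    e (Pres.mk d Pres.S) = 𝓐.b 1 1 ∧
    e (Pres.mk d Pres.C) = (LaurentPolynomial.T 1 : ℤ[T;T⁻¹]) • 𝓐.b 0 2 ∧
    e (Pres.mk d (Pres.Clast d)) = (LaurentPolynomial.T (d - 1) : ℤ[T;T⁻¹]) • 𝓐.b 0 d := by
  have hd := 𝓐.two_lt
  obtain ⟨hpow, h1, h2, hcheb, h3, h4⟩ := Pres.relations_of_fusion hd 𝓐.b 𝓐.b_zero 𝓐.b_one
    𝓐.b_period (fun i => 𝓐.b_top i d le_rfl) 𝓐.b_twist 𝓐.b_fusion 𝓐.b_fusion_top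
  obtain ⟨f, hs, hc⟩ := Pres.exists_hom d _ _ h1 h2 h3 h4
  have hfcheb : ∀ n, n ≤ d - 1 → f (Pres.cheb (Pres.mk d Pres.S) (Pres.mk d Pres.C) n) =
      (LaurentPolynomial.T n : ℤ[T;T⁻¹]) • 𝓐.b 0 (n + 1) := by
    intro n hn
    rw [hcheb n hn, ← hs, ← hc]
    have h5 := Pres.map_cheb (A := Pres.Alg d) (B := GrothRing 𝓐.G)
      (f : Pres.Alg d →+* GrothRing 𝓐.G) (Pres.mk d Pres.S) (Pres.mk d Pres.C) n
    exact h5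
  have hlast : f (Pres.mk d (Pres.Clast d)) =
      (LaurentPolynomial.T (d - 1) : ℤ[T;T⁻¹]) • 𝓐.b 0 d := by
    rw [Pres.mk_Clast, hfcheb _ le_rfl, Nat.sub_add_cancel (by omega),
      Nat.cast_sub (by omega), Nat.cast_one]
  -- Each arc class is a power of `s` times an arc class starting at `0`, and the latter is a power
  -- of `v` times the image of some `C_m`.
  have hb : ∀ i n, 0 < n → 𝓐.b i n ∈ f.range := by
    intro i n hn
    have key : ∀ m, m ≤ d - 1 → 𝓐.b i (m + 1) ∈ f.range := by
      intro m hm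
      rw [hpow]
      refine f.range.mul_mem (f.range.pow_mem ⟨_, hs⟩ i) ?_
      have h5 : 𝓐.b 0 (m + 1) = (LaurentPolynomial.T (-m) : ℤ[T;T⁻¹]) •
          (LaurentPolynomial.T m : ℤ[T;T⁻¹]) • 𝓐.b 0 (m + 1) := by
        rw [smul_smul, ← LaurentPolynomial.T_add, neg_add_cancel, LaurentPolynomial.T_zero,
          one_smul]
      rw [h5]
      exact f.range.smul_mem ⟨_, hfcheb m hm⟩ _
    by_cases hnd : n ≤ d
    · have := key (n - 1) (by omega)
      rwa [Nat.sub_add_cancel hn] at this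
    · rw [𝓐.b_top i n (by omega), ← 𝓐.b_top i d le_rfl]
      have := key (d - 1) le_rfl
      rwa [Nat.sub_add_cancel (by omega)] at this
  -- The partial sums occurring in `IsSum` are themselves summands of `M`, so they belong to the
  -- category and have classes.
  have hcls : ∀ M, IsSum 𝓐.Indec M → ∀ hM : Generated 𝓐.G M, cls M hM ∈ f.range := by
    intro M h
    induction h with
    | zero h0 =>
      intro hM
      rw [cls_eq_zero hM h0]
      exact f.range.zero_mem
    | cons hX _ hN ih =>
      intro hM
      rw [cls_of_sum hM (hM.of_sum_left hN) (hM.of_sum_right hN) hN]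
      refine f.range.add_mem ?_ (ih _)
      obtain ⟨i, n, k, hn, rfl⟩ := hX
      have := f.range.smul_mem (hb i n hn) (LaurentPolynomial.T k)
      rwa [T_smul_b] at this
  have hsurj : Function.Surjective f := by
    intro x
    change x ∈ f.range
    induction x using grothRing_induction with
    | h0 => exact f.range.zero_mem
    | hc M hM => exact hcls M (𝓐.isSum_of_generated hM) hM
    | hneg x hx => exact neg_mem hx
    | hadd x y hx hy => exact f.range.add_mem hx hy
  -- The spanning family goes to the classes of pairwise distinct arcs, each times a power `v ^ w`;
  -- independence of these classes kills all coefficients, `v` being invertible.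
  have hinj : Function.Injective f := by
    rw [injective_iff_map_eq_zero]
    intro z hz
    have hz' : z ∈ Submodule.span ℤ[T;T⁻¹] (Set.range (Pres.spanning d)) := by
      rw [Pres.span_spanning d hd]
      trivial
    obtain ⟨c, rfl⟩ := (Submodule.mem_span_range_iff_exists_fun _).1 hz'
    let st : Option (Fin d × Fin (d - 1)) → ℕ := fun x => x.elim 0 fun y => y.1
    let ln : Option (Fin d × Fin (d - 1)) → ℕ := fun x => x.elim d fun y => y.2 + 1
    let w : Option (Fin d × Fin (d - 1)) → ℤ := fun x => x.elim (d - 1) fun y => (y.2 : ℕ)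
    have hsp : ∀ x, f (Pres.spanning d x) =
        (LaurentPolynomial.T (w x) : ℤ[T;T⁻¹]) • 𝓐.b (st x) (ln x) := by
      rintro (_ | ⟨i, n⟩)
      · exact hlast
      · change f (Pres.mk d Pres.S ^ (i : ℕ) * Pres.cheb (Pres.mk d Pres.S) (Pres.mk d Pres.C) n) =
          (LaurentPolynomial.T (n : ℕ) : ℤ[T;T⁻¹]) • 𝓐.b i (n + 1)
        rw [map_mul, map_pow, hs, hfcheb _ (by omega), mul_smul_comm, ← hpow]
    have h5 := 𝓐.eq_zero_of_sum_eq_zero st ln ?_ ?_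
      (fun x => c x * LaurentPolynomial.T (w x)) ?_
    · refine Finset.sum_eq_zero fun x _ => ?_
      have h6 : c x = 0 := by
        have h7 := congrArg (· * LaurentPolynomial.T (-w x)) (h5 x)
        simpa only [mul_assoc, ← LaurentPolynomial.T_add, add_neg_cancel,
          LaurentPolynomial.T_zero, mul_one, zero_mul] using h7
      rw [h6, zero_smul]
    · rintro (_ | ⟨i, n⟩)
      · exact (by omega : 0 < d)
      · exact Nat.succ_pos _
    · rintro (_ | ⟨i, n⟩) (_ | ⟨j, m⟩) h
      · rfl
      · exact absurd h.symm (𝓐.arc_ne_top _ _ m.2)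
      · exact absurd h (𝓐.arc_ne_top _ _ n.2)
      · obtain ⟨h6, h7⟩ := 𝓐.arc_inj _ _ _ _ i.2 j.2 n.2 m.2 h
        rw [Fin.ext h6, Fin.ext h7]
    · rw [map_sum] at hz
      rw [← hz]
      refine Finset.sum_congr rfl fun x _ => ?_
      rw [map_smul, hsp, smul_smul]
  exact ⟨AlgEquiv.ofBijective f ⟨hinj, hsurj⟩, hs, hc, hlast⟩

end ArcSystem

end ArcSystem

end GrBimod

/-! ### Combinatorics of arcs in a cyclic group. -/

section Arc

variable {W : Type*} [Group W] (s : W)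

/-- The arc `{sⁱ, …, sⁱ⁺ⁿ⁻¹}` in the cyclic group generated by `s`. -/
def arc (i n : ℕ) : Set W := {w | ∃ j < n, w = s ^ (i + j)}

variable {s}

theorem mem_arc_succ_left {i n : ℕ} {a : W} : a ∈ arc s (i + 1) n ↔ s⁻¹ * a ∈ arc s i n := by
  refine exists_congr fun j => and_congr_right fun _ => ?_
  rw [inv_mul_eq_iff_eq_mul, ← pow_succ', add_right_comm]

theorem mem_arc_add_two {i n : ℕ} {a : W} :
    a ∈ arc s i (n + 2) ↔ a ∈ arc s i (n + 1) ∨ s⁻¹ * a ∈ arc s i (n + 1) := by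
  rw [← mem_arc_succ_left]
  constructor
  · rintro ⟨j, hj, rfl⟩
    by_cases h : j < n + 1
    · exact Or.inl ⟨j, h, rfl⟩
    · exact Or.inr ⟨n, by omega, by rw [show i + j = i + 1 + n by omega]⟩
  · rintro (⟨j, hj, rfl⟩ | ⟨j, hj, rfl⟩)
    · exact ⟨j, by omega, rfl⟩
    · exact ⟨j + 1, by omega, by rw [show i + 1 + j = i + (j + 1) by omega]⟩

theorem pow_mem_arc (i n : ℕ) : s ^ i ∈ arc s i (n + 1) := ⟨0, Nat.succ_pos n, rfl⟩

theorem pow_add_mem_arc (i n : ℕ) : s ^ (i + n) ∈ arc s i (n + 1) := ⟨n, Nat.lt_succ_self n, rfl⟩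

/-- Together with its mirror image below, this recognises the ends of an arc from the set alone; it
serves both for `arc_inj` and to find the lines on which the separating form must vanish. -/
theorem eq_pow_of_mem_arc {i n : ℕ} {a : W} (ha : a ∈ arc s i (n + 1))
    (h : s⁻¹ * a ∉ arc s i (n + 1)) : a = s ^ i := by
  obtain ⟨j, hj, rfl⟩ := ha
  rcases j with _ | j
  · rfl
  · exact absurd ⟨j, by omega, by rw [← add_assoc, pow_succ', inv_mul_cancel_left]⟩ h

theorem eq_pow_add_of_mem_arc {i n : ℕ} {a : W} (ha : a ∈ arc s i (n + 1))
    (h : s * a ∉ arc s i (n + 1)) : a = s ^ (i + n) := by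
  obtain ⟨j, hj, rfl⟩ := ha
  by_cases hjn : j = n
  · rw [hjn]
  · exact absurd ⟨j + 1, by omega, by rw [← add_assoc, pow_succ']⟩ h

theorem inv_mul_pow_notMem_arc {i n : ℕ} (hn : n + 1 < orderOf s) :
    s⁻¹ * s ^ i ∉ arc s i (n + 1) := by
  rintro ⟨j, hj, h⟩
  rw [inv_mul_eq_iff_eq_mul, ← pow_succ', add_assoc, pow_add, left_eq_mul] at h
  exact absurd (Nat.le_of_dvd (Nat.succ_pos j) (orderOf_dvd_of_pow_eq_one h)) (by omega)

theorem mul_pow_add_notMem_arc {i n : ℕ} (hn : n + 1 < orderOf s) :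
    s * s ^ (i + n) ∉ arc s i (n + 1) := by
  rintro ⟨j, hj, h⟩
  rw [← pow_succ', show i + n + 1 = i + j + (n + 1 - j) by omega, pow_add _ (i + j),
    mul_eq_left] at h
  exact absurd (Nat.le_of_dvd (by omega) (orderOf_dvd_of_pow_eq_one h)) (by omega)

/-- Translating a proper arc by `s` loses exactly the initial point from the intersection. For the
whole group nothing would be lost, which is why that case has its own fusion rule. -/
theorem mem_arc_succ_left_iff {i n : ℕ} (hn : n + 1 < orderOf s) {a : W} :
    a ∈ arc s (i + 1) n ↔ a ∈ arc s i (n + 1) ∧ s⁻¹ * a ∈ arc s i (n + 1) := by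
  constructor
  · rintro ⟨j, hj, rfl⟩
    exact ⟨⟨j + 1, by omega, by rw [show i + 1 + j = i + (j + 1) by omega]⟩, j, by omega,
      by rw [add_right_comm, pow_succ', inv_mul_cancel_left]⟩
  · rintro ⟨⟨j, hj, rfl⟩, h⟩
    rcases j with _ | j
    · exact absurd h (inv_mul_pow_notMem_arc hn)
    · exact ⟨j, by omega, by rw [show i + 1 + j = i + (j + 1) by omega]⟩

theorem arc_eq_zpowers {i n : ℕ} (h0 : 0 < orderOf s) (hn : orderOf s ≤ n) :
    arc s i n = (Subgroup.zpowers s : Set W) := by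
  ext a
  constructor
  · rintro ⟨j, _, rfl⟩
    exact Subgroup.pow_mem _ (Subgroup.mem_zpowers s) _
  · rintro ⟨k, rfl⟩
    -- The position of `s ^ k` on an arc starting at `s ^ i` is `k - i` reduced modulo the order.
    have h1 := Int.emod_nonneg (k - i) (b := orderOf s) (by omega)
    have h2 := Int.emod_lt_of_pos (k - i) (b := orderOf s) (by omega)
    refine ⟨((k - i) % orderOf s).toNat, by omega, ?_⟩
    rw [← zpow_natCast, Nat.cast_add, Int.toNat_of_nonneg h1, zpow_add, zpow_mod_orderOf,
      ← zpow_add, add_sub_cancel]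

theorem arc_zero_two : arc s 0 2 = {1, s} := by
  ext a
  constructor
  · rintro ⟨j, hj, rfl⟩
    interval_cases j <;> simp
  · rintro (rfl | rfl)
    · exact ⟨0, by omega, by simp⟩
    · exact ⟨1, by omega, by simp⟩

theorem arc_one (i : ℕ) : arc s i 1 = {s ^ i} := by
  ext a
  constructor
  · rintro ⟨j, hj, rfl⟩
    interval_cases j
    simp
  · rintro rfl
    exact pow_mem_arc i 0

/-- A proper arc determines its two end points, hence its start and its length. -/
theorem arc_inj {i n j m : ℕ} (hi : i < orderOf s) (hj : j < orderOf s) (hn : n + 1 < orderOf s)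
    (hm : m + 1 < orderOf s) (h : arc s i (n + 1) = arc s j (m + 1)) : i = j ∧ n = m := by
  have h1 : s ^ i = s ^ j :=
    eq_pow_of_mem_arc (h ▸ pow_mem_arc i n) (h ▸ inv_mul_pow_notMem_arc hn)
  have h2 : s ^ (i + n) = s ^ (j + m) :=
    eq_pow_add_of_mem_arc (h ▸ pow_add_mem_arc i n) (h ▸ mul_pow_add_notMem_arc hn)
  refine ⟨pow_injOn_Iio_orderOf hi hj h1, ?_⟩
  rw [pow_add, pow_add, h1, mul_right_inj] at h2
  exact pow_injOn_Iio_orderOf (by simp; omega) (by simp; omega) h2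

end Arc

/-! ### The arcs of `⟨s⟩` acting on a line, and the conclusion. -/

namespace RegFun

open GrBimod

variable {V : Type u} [AddCommGroup V] [Module ℂ V] {s : V ≃ₗ[ℂ] V} (φ : V ≃ₗ[ℂ] ℂ) {ζ : ℂ}

section Eigenvalue

theorem pow_apply (hs : ∀ v, φ (s v) = ζ * φ v) (k : ℕ) (v : V) :
    φ ((s ^ k) v) = ζ ^ k * φ v := by
  induction k with
  | zero => simp
  | succ k ih => rw [pow_succ', pow_succ', LinearEquiv.mul_apply, hs, ih, mul_assoc]

theorem pow_eq_of_pow_eq (hs : ∀ v, φ (s v) = ζ * φ v) {k l : ℕ} (h : ζ ^ k = ζ ^ l) :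
    s ^ k = s ^ l :=
  LinearEquiv.ext fun v => φ.injective (by rw [pow_apply φ hs, pow_apply φ hs, h])

/-- On a line, `s ^ k` is determined by its eigenvalue `ζ ^ k`. This supplies both `ζ ≠ 1` and the
nonvanishing of `β` in the fusion rule. -/
theorem pow_ne_one (hs : ∀ v, φ (s v) = ζ * φ v) {k : ℕ} (h0 : 0 < k) (hk : k < orderOf s) :
    ζ ^ k ≠ 1 := fun h =>
  pow_ne_one_of_lt_orderOf h0.ne' hk (by
    rw [← pow_zero s]
    exact pow_eq_of_pow_eq φ hs (by rw [h, pow_zero]))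

theorem exists_eigenvalue : ∃ ζ : ℂ, ζ ≠ 0 ∧ ∀ v, φ (s v) = ζ * φ v := by
  refine ⟨φ (s (φ.symm 1)), by simp, fun v => ?_⟩
  have : v = φ v • φ.symm 1 := by
    rw [← map_smul, smul_eq_mul, mul_one, φ.symm_apply_apply]
  conv_lhs => rw [this, map_smul, map_smul, smul_eq_mul, mul_comm]

theorem fusion_arc (hs : ∀ v, φ (s v) = ζ * φ v) (hζ0 : ζ ≠ 0) (hd : 1 < orderOf s) (i n : ℕ)
    (hn : n + 1 < orderOf s) :
    (bimod (arc s 0 2)).tens (bimod (arc s i (n + 1))) ≈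
      (bimod (arc s i (n + 2))).sum ((bimod (arc s (i + 1) n)).shift (-2)) := by
  rw [arc_zero_two]
  refine pair_tens φ hs (by simpa using pow_ne_one φ hs one_pos hd) hζ0
    (fun a => mem_arc_add_two) (fun a => mem_arc_succ_left_iff hn)
    -- The form must vanish on two lines in `(x, t, y)`-space, directed by `(ζ ^ i, ζ ^ i, 1)`
    -- (initial point, sheet `x = t`) and `(ζ ^ (i + n + 1), ζ ^ (i + n), 1)` (final point, sheet `x
    -- = s t`). Its coefficients are their cross product divided by `ζ ^ i`.
    (α := 1 - ζ ^ n) (β := ζ ^ (n + 1) - 1) (γ := -(ζ ^ (n + 1) - ζ ^ n) * ζ ^ i)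
    (sub_ne_zero.2 (pow_ne_one φ hs n.succ_pos hn)) ?_ ?_
  · intro a ha h v
    rw [eq_pow_of_mem_arc ha h, pow_apply φ hs]
    ring
  · intro a ha h v
    rw [eq_pow_add_of_mem_arc ha h, hs, pow_apply φ hs]
    ring

theorem fusion_zpowers (hs : ∀ v, φ (s v) = ζ * φ v) (hζ0 : ζ ≠ 0) (hd : 1 < orderOf s) :
    (bimod (arc s 0 2)).tens (bimod (Subgroup.zpowers s : Set (V ≃ₗ[ℂ] V))) ≈
      (bimod (Subgroup.zpowers s : Set (V ≃ₗ[ℂ] V))).sum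
        ((bimod (Subgroup.zpowers s : Set (V ≃ₗ[ℂ] V))).shift (-2)) := by
  rw [arc_zero_two]
  have h1 : ∀ a, s⁻¹ * a ∈ (Subgroup.zpowers s : Set (V ≃ₗ[ℂ] V)) ↔
      a ∈ (Subgroup.zpowers s : Set (V ≃ₗ[ℂ] V)) := fun a =>
    Subgroup.mul_mem_cancel_left _ (inv_mem (Subgroup.mem_zpowers s))
  have h2 : ∀ a, s * a ∈ (Subgroup.zpowers s : Set (V ≃ₗ[ℂ] V)) ↔
      a ∈ (Subgroup.zpowers s : Set (V ≃ₗ[ℂ] V)) := fun a =>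
    Subgroup.mul_mem_cancel_left _ (Subgroup.mem_zpowers s)
  exact pair_tens φ hs (by simpa using pow_ne_one φ hs one_pos hd) hζ0
    (fun a => by rw [h1, or_self]) (fun a => by rw [h1, and_self])
    -- Since `sW = W`, no vanishing is required, and the middle coordinate `t` alone separates the
    -- sheets.
    (α := 0) (β := 1) (γ := 0) _root_.one_ne_zero
    (fun a ha h => absurd ((h1 a).2 ha) h) (fun a ha h => absurd ((h2 a).2 ha) h)

/-- The product of linear forms is an equation of the lines of `arc s i n`. It kills `1` exactly
when it vanishes on all lines of the other arc, and at the point of such a line with `y = 1` this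
forces the slope to be one of the `ζ ^ (i + l)`. -/
theorem act_lineProd_eq_zero_iff (hs : ∀ v, φ (s v) = ζ * φ v) (i n j m : ℕ) :
    (bimod (arc s j m)).act (FunModel.lineProd (coord φ) (fun k => ζ ^ (i + k)) n)
      (one (arc s j m)) = 0 ↔ arc s j m ⊆ arc s i n := by
  constructor
  · rintro h _ ⟨k, hk, rfl⟩
    have h1 := val_act_lineProd φ (A := arc s j m) (fun k => ζ ^ (i + k)) n
      ⟨((s ^ (j + k)) (φ.symm 1), φ.symm 1), _, ⟨k, hk, rfl⟩, rfl⟩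
    rw [h, map_zero, Pi.zero_apply, eq_comm, Finset.prod_eq_zero_iff] at h1
    obtain ⟨l, hl, h1⟩ := h1
    refine ⟨l, Finset.mem_range.1 hl, pow_eq_of_pow_eq φ hs ?_⟩
    simpa [pow_apply φ hs, sub_eq_zero] using h1
  · intro h
    apply val_injective
    funext z
    rw [val_act_lineProd, map_zero, Pi.zero_apply]
    obtain ⟨⟨u, w⟩, a, ha, hu⟩ := z
    obtain ⟨l, hl, rfl⟩ := h ha
    refine Finset.prod_eq_zero (Finset.mem_range.2 hl) ?_
    simp only at hu ⊢
    rw [hu, pow_apply φ hs, sub_self]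

end Eigenvalue

/-- The bimodules of functions on the arcs of `⟨s⟩`. -/
noncomputable def arcSystem (hs : ∀ v, φ (s v) = ζ * φ v) (hζ0 : ζ ≠ 0) (hd : 2 < orderOf s) :
    ArcSystem (regDeg (Set.univ : Set V)) (orderOf s) where
  two_lt := hd
  B i n := bimod (arc s i n)
  zero i := by
    have : IsEmpty (Gr (arc s i 0)) := ⟨fun z => by
      obtain ⟨_, _, ⟨j, hj, _⟩, _⟩ := z
      exact absurd hj (Nat.not_lt_zero j)⟩
    exact (val_injective (A := arc s i 0)).subsingleton
  nontrivial i n hn := by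
    obtain ⟨n, rfl⟩ : ∃ m, n = m + 1 := ⟨n - 1, by omega⟩
    exact ⟨one _, 0, one_ne_zero ⟨_, pow_mem_arc i n⟩⟩
  unit := by
    rw [arc_one, pow_zero]
    exact bimod_one
  period := by rw [arc_one, arc_one, pow_orderOf_eq_one, pow_zero]
  top i n hn := by
    rw [arc_eq_zpowers (by omega) hn, arc_eq_zpowers (by omega) le_rfl]
  twist i n := by
    rw [arc_one, pow_one]
    refine single_tens s _ _ (Set.ext fun a => ?_)
    rw [mem_arc_succ_left]
    exact ⟨fun h => ⟨_, h, mul_inv_cancel_left s a⟩, by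
      rintro ⟨b, hb, rfl⟩
      simpa using hb⟩
  fusion i n hn := fusion_arc φ hs hζ0 (by omega) i n hn
  fusion_top := by
    rw [arc_eq_zpowers (by omega) le_rfl]
    exact fusion_zpowers φ hs hζ0 (by omega)
  end_scalar i n k f := end_scalar _ k f
  finite i n k :=
    have : FiniteDimensional ℂ V := φ.symm.finiteDimensional
    finiteDimensional_deg k
  W := V ≃ₗ[ℂ] V
  arc := arc s
  arc_inj i n j m hi hj hn hm h := arc_inj hi hj (by omega) (by omega) h
  arc_ne_top i n hn h := by
    rw [arc_eq_zpowers (n := orderOf s) (by omega) le_rfl] at h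
    refine inv_mul_pow_notMem_arc (s := s) (i := i) (n := n) (by omega) ?_
    rw [h]
    exact mul_mem (inv_mem (Subgroup.mem_zpowers s)) (Subgroup.pow_mem _ (Subgroup.mem_zpowers s) _)
  X := coord φ
  p i n := FunModel.lineProd (coord φ) (fun k => ζ ^ (i + k)) n
  inv_of_subset i n j m k l hm h hk := by
    rw [inv_bimod φ (A := arc s j m) ⟨s ^ j, 0, hm, rfl⟩, if_pos ⟨hk, (act_lineProd_eq_zero_iff φ hs i n j m).2 h⟩]
  inv_of_not i n j m k l hm h := by
    rw [inv_bimod φ (A := arc s j m) ⟨s ^ j, 0, hm, rfl⟩,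
      if_neg fun h' => h ⟨(act_lineProd_eq_zero_iff φ hs i n j m).1 h'.2, h'.1⟩]

end RegFun

theorem mainTheorem5 {V : Type u} [AddCommGroup V] [Module ℂ V] (hV : Module.finrank ℂ V = 1)
    (s : V ≃ₗ[ℂ] V) (d : ℕ) (hs : orderOf s = d) (hd : 2 < d) :
    ∃ (h₁ : GrBimod.Generated (RegFun.genBimod s) (RegFun.bimod {s}))
      (h₂ : GrBimod.Generated (RegFun.genBimod s)
        (RegFun.bimod (Subgroup.zpowers s : Set (V ≃ₗ[ℂ] V))))
      (e : Pres.Alg d ≃ₐ[ℤ[T;T⁻¹]] AW s),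
      e (Pres.mk d Pres.S) = GrBimod.cls (RegFun.bimod {s}) h₁ ∧
      e (Pres.mk d Pres.C) =
        GrBimod.cls ((RegFun.bimod {1, s}).shift 1) (GrBimod.Generated.gen.shift 1) ∧
      e (Pres.mk d (Pres.Clast d)) =
        GrBimod.cls ((RegFun.bimod (Subgroup.zpowers s : Set (V ≃ₗ[ℂ] V))).shift (d - 1))
          (h₂.shift (d - 1)) := by
  subst hs
  -- The ring and its classes depend on these sets through proofs of membership in the category, so
  -- the sets are made variable before being identified with arcs.
  suffices H : ∀ A B C : Set (V ≃ₗ[ℂ] V), A = arc s 0 2 → B = arc s 1 1 → C = arc s 0 (orderOf s) →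
      ∃ (h₁ : GrBimod.Generated (RegFun.bimod A) (RegFun.bimod B))
        (h₂ : GrBimod.Generated (RegFun.bimod A) (RegFun.bimod C))
        (e : Pres.Alg (orderOf s) ≃ₐ[ℤ[T;T⁻¹]] GrBimod.GrothRing (RegFun.bimod A)),
        e (Pres.mk _ Pres.S) = GrBimod.cls (RegFun.bimod B) h₁ ∧
        e (Pres.mk _ Pres.C) =
          GrBimod.cls ((RegFun.bimod A).shift 1) (GrBimod.Generated.gen.shift 1) ∧
        e (Pres.mk _ (Pres.Clast (orderOf s))) =
          GrBimod.cls ((RegFun.bimod C).shift (orderOf s - 1)) (h₂.shift (orderOf s - 1)) from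
    H {1, s} {s} _ arc_zero_two.symm (by rw [arc_one, pow_one])
      (arc_eq_zpowers (by omega) le_rfl).symm
  rintro _ _ _ rfl rfl rfl
  have hV' : Module.Finite ℂ V := Module.finite_of_finrank_eq_succ hV
  let φ : V ≃ₗ[ℂ] ℂ := LinearEquiv.ofFinrankEq V ℂ (by rw [hV, Module.finrank_self])
  obtain ⟨ζ, hζ0, hζ⟩ := RegFun.exists_eigenvalue (s := s) φ
  let 𝓐 := RegFun.arcSystem φ hζ hζ0 hd
  obtain ⟨e, h1, h2, h3⟩ := 𝓐.exists_presentation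
  exact ⟨𝓐.generated 1 1, 𝓐.generated 0 _, e, h1, h2.trans (𝓐.T_smul_b 0 2 1),
    h3.trans (𝓐.T_smul_b 0 _ _)⟩
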